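/- Let $p$ be an odd prime and let $A$ be a complete discrete valuation ring with maximal ideal generated by $p$ and perfect residue field $k$. Let $\phi$ be the Frobenius lift of $A$ and $\delta a=(\phi(a)-a^p)/p$ the attached $p$-derivation. Let $a_1,a_2,a_3\in A$ with $(a_1-a_2)(a_2-a_3)(a_3-a_1)\in A^\times$, and put $H_1=\sum a_ix_i^2$, $H_2=\sum x_i^2\in A[x_1,x_2,x_3]$, $N(z_1,z_2)=\prod_{i=1}^3(z_1-a_iz_2)$. Let $A_{p-1}\in A[z_1,z_2]$ be the coefficient of $x^{p-1}$ in $F^{(p-1)/2}$, where $F=((a_2-a_3)x^2+z_1-a_2z_2)((a_3-a_1)x^2-z_1+a_1z_2)$. Put $Q=x_1x_2\,N(H_1,H_2)\,A_{p-1}(H_1,H_2)$ and $X=\operatorname{Spec}A[x_1,x_2,x_3][1/Q]$. A hat denotes $p$-adic completion. For the $p$-adic completion $\widehat V$ of a scheme $V=\operatorname{Spec} B$ over $A$, $\Omega^1_{\widehat V}=\varprojlim_n\Omega_{(B/p^n)/(A/p^n)}$ and $\Omega^i_{\widehat V}=\wedge^i_{\widehat B}\,\Omega^1_{\widehat V}$.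 An arithmetic flow on $\widehat V$ is a map $\delta^V:\mathcal O(\widehat V)\to\mathcal O(\widehat V)$ extending $\delta$ on $A$ such that $\phi^V(b)=b^p+p\,\delta^V b$ is a ring endomorphism (the attached Frobenius lift). For $c=(c_1,c_2)\in A^2$ let $E^0_c=X\cap\{H_1=c_1,H_2=c_2\}$, with the $1$-form $\omega_c=\dfrac{dx_3}{(a_1-a_2)x_1x_2}$. Call an arithmetic flow $\delta^X$ on $\widehat X$ an arithmetic Euler flow if (1) $\delta^XH_1=\delta^XH_2=0$; and (2) for all $c\in A^2$ with $\delta c_1=\delta c_2=0$ and $N(c)A_{p-1}(c)\in A^\times$, $\delta^X$ induces an arithmetic flow on $\widehat{E^0_c}$, whose Frobenius lift $\phi_c$ satisfies $\frac{\phi_c^*}{p}\omega_c\equiv A_{p-1}(c)^{-1}\omega_c$ mod $p$ in $\Omega^1_{\widehat{E^0_c}}$. For $c_2\in A^\times$ let $S^0_{c_2}=X\cap\{H_2=c_2\}$, with the symplectic form $\eta_{c_2}$ given by $\frac{dx_2\wedge dx_3}{x_1}=\frac{dx_3\wedge dx_1}{x_2}$ (and by $\frac{dx_1\wedge dx_2}{x_3}$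 where $x_3\ne0$). Consider, for an arithmetic flow $\delta^X$ on $\widehat X$ and $c_2\in A^\times$ with $\delta c_2=0$, the following property: $(\ast)$ $\delta^X$ induces a unique arithmetic flow on $\widehat{S^0_{c_2}}$; $A_{p-1}(H_1,c_2)$ is invertible on $\widehat{S^0_{c_2}}$; $\lambda:=H_1^{p-1}/A_{p-1}(H_1,c_2)$ is a pseudo-$\delta$-constant for the induced flow, i.e. a $p$-adic limit of fractions $u/s$ with $s$ a unit and $u,s$ in the subring of $\mathcal O(\widehat{S^0_{c_2}})$ generated by the elements killed by the flow; and the Frobenius lift $\phi_{c_2}$ of the induced flow satisfies $$\frac{\phi_{c_2}^*}{p^2}\,\eta_{c_2}\equiv\lambda\,\eta_{c_2}\pmod p\quad\text{in }\Omega^2_{\widehat{S^0_{c_2}}}.$$ (In (2) and $(\ast)$, $\frac{\phi^*}{p^i}w$ denotes the unique $i$-form $\tau$ with $p^i\tau=\phi^*w$; its existence and uniqueness are part of the claim.) Theorem. There is an arithmetic Euler flow on $\widehat X$ which satisfies $(\ast)$ for every $c_2\in A^\times$ with $\delta c_2=0$. If $k$ is infinite, then every arithmetic Euler flow on $\widehat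 X$ satisfies $(\ast)$ for every $c_2\in A^\times$ with $\delta c_2=0$. -/

import Mathlib

noncomputable section

namespace ArithmeticEuler

open KaehlerDifferential

/-! ## `p`-derivations, arithmetic flows, pseudo-constants -/

/-- A `p`-derivation on `B`: a map of sets `δ` such that `b ↦ b ^ p + p * δ b` is a ring
homomorphism (the attached Frobenius lift `frob`). -/
@[ext]
structure PDerivation (p : ℕ) (B : Type*) [CommRing B] where
  toFun : B → B
  frob : B →+* B
  frob_apply : ∀ b, frob b = b ^ p + (p : B) * toFun b

instance {p : ℕ} {B : Type*} [CommRing B] : CoeFun (PDerivation p B) (fun _ => B → B) :=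
  ⟨PDerivation.toFun⟩

/-- An arithmetic `δA`-flow on the affine `p`-adic formal scheme `Spf C` over `A`: a `p`-derivation
on `C` extending the `p`-derivation `δA` of `A`. -/
@[ext]
structure ArithFlow {p : ℕ} {A : Type*} [CommRing A] (δA : PDerivation p A)
    (C : Type*) [CommRing C] [Algebra A C] extends PDerivation p C where
  extends_base : ∀ a : A, toFun (algebraMap A C a) = algebraMap A C (δA a)

section Flow

variable {p : ℕ} {A : Type*} [CommRing A] {δA : PDerivation p A}
  {C : Type*} [CommRing C] [Algebra A C]

instance : CoeFun (ArithFlow δA C) (fun _ => C → C) := ⟨fun δ => δ.toPDerivation.toFun⟩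

theorem ArithFlow.frob_algebraMap (δ : ArithFlow δA C) (a : A) :
    δ.frob (algebraMap A C a) = algebraMap A C (δA.frob a) := by
  rw [δ.frob_apply, δA.frob_apply, δ.extends_base]
  simp

end Flow

/-- The subring `ℤ[B^δ]` generated by the `δ`-constants of `B`. -/
def constSubring {p : ℕ} {B : Type*} [CommRing B] (δ : PDerivation p B) : Subring B :=
  Subring.closure {b | δ b = 0}

/-- `b` is a pseudo-`δ`-constant: a `p`-adic limit in `B` of fractions `u / s` with
`u, s ∈ ℤ[B^δ]` and `s` a unit of `B`. -/
def IsPseudoConstant {p : ℕ} {B : Type*} [CommRing B] (δ : PDerivation p B) (b : B) : Prop :=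
  ∀ n : ℕ, ∃ u ∈ constSubring δ, ∃ s : Bˣ, (s : B) ∈ constSubring δ ∧
    ∃ r : B, b - u * ((s⁻¹ : Bˣ) : B) = (p : B) ^ n * r

/-! ## Pull-back of differential forms along semilinear ring maps -/

/-- The additive group `M`, viewed as a `B`-module through a ring homomorphism `f : B → B'`. -/
def Restr {B B' : Type*} [CommRing B] [CommRing B'] (_f : B →+* B') (M : Type*) : Type _ := M

section Restr

variable {B B' : Type*} [CommRing B] [CommRing B'] (f : B →+* B')
  (M : Type*) [AddCommGroup M] [Module B' M]

instance : AddCommGroup (Restr f M) := inferInstanceAs (AddCommGroup M)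

instance : Module B (Restr f M) := Module.compHom M f

variable {M}

/-- A linear map into `Restr f M` is an `f`-semilinear map into `M`. -/
def Restr.toSemilinear {N : Type*} [AddCommGroup N] [Module B N] (L : N →ₗ[B] Restr f M) :
    N →ₛₗ[f] M where
  toFun := L
  map_add' := L.map_add
  map_smul' := L.map_smul

end Restr

section Pullback

variable {A : Type*} [CommRing A]
  {B : Type*} [CommRing B] [Algebra A B] {B' : Type*} [CommRing B'] [Algebra A B']

/-- The `f`-semilinear map `Ω_{B/A} → Ω_{B'/A}`, `b₀ db₁ ↦ f(b₀) d(f b₁)`, attached to a ring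
homomorphism `f : B → B'` lying over an endomorphism `σ` of `A`. -/
def kaehlerPullback (σ : A →+* A) (f : B →+* B')
    (h : ∀ a, f (algebraMap A B a) = algebraMap A B' (σ a)) : Ω[B⁄A] →ₛₗ[f] Ω[B'⁄A] :=
  letI : Module A (Restr f Ω[B'⁄A]) := Module.compHom (Restr f Ω[B'⁄A]) (algebraMap A B)
  haveI : IsScalarTower A B (Restr f Ω[B'⁄A]) := ⟨fun a b m => by
    rw [Algebra.smul_def, mul_smul]; rfl⟩
  let D' : Derivation A B (Restr f Ω[B'⁄A]) :=
    { toFun := fun b => (D A B' (f b) : Ω[B'⁄A])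
      map_add' := fun x y => by
        simp only [map_add]; rfl
      map_smul' := fun a b => by
        change D A B' (f (a • b)) = f (algebraMap A B a) • D A B' (f b)
        rw [Algebra.smul_def, map_mul, h, ← Algebra.smul_def, Derivation.map_smul,
          algebraMap_smul]
      map_one_eq_zero' := by
        change D A B' (f 1) = 0
        simp
      leibniz' := fun x y => by
        change D A B' (f (x * y)) = f x • D A B' (f y) + f y • D A B' (f x)
        rw [map_mul, Derivation.leibniz] }
  let L : Ω[B⁄A] →ₗ[B] Restr f Ω[B'⁄A] := D'.liftKaehlerDifferential
  Restr.toSemilinear f L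

theorem kaehlerPullback_D (σ : A →+* A) (f : B →+* B')
    (h : ∀ a, f (algebraMap A B a) = algebraMap A B' (σ a)) (b : B) :
    kaehlerPullback σ f h (D A B b) = D A B' (f b) := by
  let _ : Module A (Restr f Ω[B'⁄A]) := Module.compHom (Restr f Ω[B'⁄A]) (algebraMap A B)
  have _ : IsScalarTower A B (Restr f Ω[B'⁄A]) := ⟨fun a b m => by
    rw [Algebra.smul_def, mul_smul]; rfl⟩
  exact Derivation.liftKaehlerDifferential_comp_D (M := Restr f Ω[B'⁄A]) _ b

theorem kaehlerPullback_comm {B₁ B₂ B₃ B₄ : Type*} [CommRing B₁] [CommRing B₂] [CommRing B₃]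
    [CommRing B₄] [Algebra A B₁] [Algebra A B₂] [Algebra A B₃] [Algebra A B₄]
    {σ₁ σ₂ σ₃ σ₄ : A →+* A}
    {f : B₁ →+* B₂} {g : B₂ →+* B₄} {f' : B₁ →+* B₃} {g' : B₃ →+* B₄}
    (hf) (hg) (hf') (hg') (hcomm : g.comp f = g'.comp f') (w : Ω[B₁⁄A]) :
    kaehlerPullback σ₂ g hg (kaehlerPullback σ₁ f hf w) =
      kaehlerPullback σ₄ g' hg' (kaehlerPullback σ₃ f' hf' w) := by
  have hb (b : B₁) : g (f b) = g' (f' b) := congrArg (fun e : B₁ →+* B₄ => e b) hcomm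
  have hw : w ∈ Submodule.span B₁ (Set.range (D A B₁)) := by
    rw [span_range_derivation]; trivial
  induction hw using Submodule.span_induction with
  | mem x hx =>
    obtain ⟨b, rfl⟩ := hx
    simp only [kaehlerPullback_D, hb]
  | zero => simp
  | add x y _ _ hx hy => simp only [map_add, hx, hy]
  | smul b x _ hx => simp only [LinearMap.map_smulₛₗ, hx, hb]

end Pullback

/-! ## Two-fold wedge products -/

section Wedge

variable {C M : Type*} [CommRing C] [AddCommGroup M] [Module C M]

theorem ιMulti_two_self (v : M) : exteriorPower.ιMulti C 2 ![v, v] = 0 :=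
  (exteriorPower.ιMulti C 2).map_eq_zero_of_eq ![v, v] (i := 0) (j := 1) rfl (by decide)

theorem ιMulti_two_add_right (u v w : M) : exteriorPower.ιMulti C 2 ![u, v + w] =
    exteriorPower.ιMulti C 2 ![u, v] + exteriorPower.ιMulti C 2 ![u, w] := by
  have h (z : M) : Function.update ![u, v] 1 z = ![u, z] := by
    funext i; fin_cases i <;> rfl
  simpa only [h] using (exteriorPower.ιMulti C 2).map_update_add ![u, v] 1 v w

theorem ιMulti_two_add_left (u v w : M) : exteriorPower.ιMulti C 2 ![u + v, w] =
    exteriorPower.ιMulti C 2 ![u, w] + exteriorPower.ιMulti C 2 ![v, w] := by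
  have h (z : M) : Function.update ![u, w] 0 z = ![z, w] := by
    funext i; fin_cases i <;> rfl
  simpa only [h] using (exteriorPower.ιMulti C 2).map_update_add ![u, w] 0 u v

theorem ιMulti_two_smul_right (c : C) (v w : M) : exteriorPower.ιMulti C 2 ![v, c • w] =
    c • exteriorPower.ιMulti C 2 ![v, w] := by
  have h (z : M) : Function.update ![v, w] 1 z = ![v, z] := by
    funext i; fin_cases i <;> rfl
  simpa only [h] using (exteriorPower.ιMulti C 2).map_update_smul ![v, w] 1 c w

theorem ιMulti_two_swap (v w : M) : exteriorPower.ιMulti C 2 ![v, w] =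
    -exteriorPower.ιMulti C 2 ![w, v] := by
  have h := ιMulti_two_self (C := C) (v + w)
  rw [ιMulti_two_add_left, ιMulti_two_add_right, ιMulti_two_add_right, ιMulti_two_self,
    ιMulti_two_self, zero_add, add_zero] at h
  exact eq_neg_of_add_eq_zero_left h

theorem ιMulti_two_of_relation {x0 x1 x2 : C} {d0 d1 d2 : M} (hx : IsUnit x0)
    (h2 : IsUnit (2 : C))
    (h : (x0 • d0 + x0 • d0) + (x1 • d1 + x1 • d1) + (x2 • d2 + x2 • d2) = 0) {η : ⋀[C]^2 M}
    (h0 : η = Ring.inverse x0 • exteriorPower.ιMulti C 2 ![d1, d2]) :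
    x0 • η = exteriorPower.ιMulti C 2 ![d1, d2] ∧ x1 • η = exteriorPower.ιMulti C 2 ![d2, d0] ∧
      x2 • η = exteriorPower.ιMulti C 2 ![d0, d1] := by
  have h0' : x0 • η = exteriorPower.ιMulti C 2 ![d1, d2] := by
    rw [h0, smul_smul, Ring.mul_inverse_cancel _ hx, one_smul]
  have e0 : x0 • d0 = (-x1) • d1 + (-x2) • d2 := by
    rw [← sub_eq_zero, ← h2.smul_eq_zero, ← h]
    module
  refine ⟨h0', ?_, ?_⟩
  · rw [← hx.smul_left_cancel, smul_comm, h0', ← ιMulti_two_smul_right x0, e0, ιMulti_two_add_right,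
      ιMulti_two_smul_right, ιMulti_two_smul_right, ιMulti_two_self, ιMulti_two_swap d1 d2]
    module
  · rw [← hx.smul_left_cancel, smul_comm, h0', ιMulti_two_swap d0 d1, smul_neg,
      ← ιMulti_two_smul_right x0, e0, ιMulti_two_add_right,
      ιMulti_two_smul_right, ιMulti_two_smul_right, ιMulti_two_self]
    module
end Wedge

/-! ## Differential forms on the formal scheme `Spf C` -/

section Forms

variable (p : ℕ) (A : Type*) [CommRing A] (C : Type*) [CommRing C] [Algebra A C]

/-- `C / pⁿ C`, the ring of the `n`-th infinitesimal neighbourhood `X_n` of the special fibre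
in `Spf C`. -/
abbrev Lvl (n : ℕ) : Type _ := C ⧸ Ideal.span {((p : C) ^ n)}

/-- The reduction `C / pⁿ⁺¹ → C / pⁿ`. -/
def lvlMap (n : ℕ) : Lvl p C (n + 1) →+* Lvl p C n :=
  Ideal.Quotient.factor (Ideal.span_singleton_le_span_singleton.2 ⟨(p : C), pow_succ _ _⟩)

theorem lvlMap_mk (n : ℕ) (c : C) :
    lvlMap p C n (Ideal.Quotient.mk _ c) = Ideal.Quotient.mk _ c := rfl

theorem lvlMap_algebraMap (n : ℕ) (a : A) :
    lvlMap p C n (algebraMap A (Lvl p C (n + 1)) a) =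
      algebraMap A (Lvl p C n) (RingHom.id A a) := rfl

/-- The restriction of differentials `Ω_{X_{n+1}} → Ω_{X_n}`. Since `A → A / pⁿ` is surjective,
differentials of `C / pⁿ` over `A / pⁿ` are the same as differentials over `A`. -/
def omegaTrans (n : ℕ) : Ω[Lvl p C (n + 1)⁄A] →ₛₗ[lvlMap p C n] Ω[Lvl p C n⁄A] :=
  kaehlerPullback (RingHom.id A) (lvlMap p C n) (lvlMap_algebraMap p A C n)

theorem pi_smul_lvl {p : ℕ} {A C : Type*} [CommRing A] [CommRing C] [Algebra A C] (c : C)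
    (y : ∀ n, Ω[Lvl p C n⁄A]) (m : ℕ) :
    (c • y) m = (Ideal.Quotient.mk _ c : Lvl p C m) • y m := by
  rw [Pi.smul_apply, ← Ideal.Quotient.algebraMap_eq, algebraMap_smul]

/-- `1`-forms on the formal scheme `Spf C` over `A`: the inverse limit over `n` of the modules of
Kaehler differentials of `C / pⁿ`. -/
def Omega1 : Submodule C (∀ n : ℕ, Ω[Lvl p C n⁄A]) where
  carrier := {w | ∀ n, omegaTrans p A C n (w (n + 1)) = w n}
  add_mem' hx hy n := by
    rw [Pi.add_apply, map_add, hx n, hy n, Pi.add_apply]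
  zero_mem' n := by simp
  smul_mem' c x hx n := by
    rw [pi_smul_lvl, pi_smul_lvl, LinearMap.map_smulₛₗ, hx n]
    rfl

/-- `i`-forms on the formal scheme `Spf C`: the `i`-th exterior power over `C` of the `1`-forms. -/
abbrev OmegaPow (i : ℕ) : Type _ := ⋀[C]^i (Omega1 p A C)

/-- The differential `d c` of a function `c`, as a `1`-form on `Spf C`. -/
def dform (c : C) : Omega1 p A C :=
  ⟨fun n => D A (Lvl p C n) (Ideal.Quotient.mk _ c), fun n =>
    kaehlerPullback_D (RingHom.id A) (lvlMap p C n) (lvlMap_algebraMap p A C n) _⟩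

theorem dform_add (x y : C) : dform p A C (x + y) = dform p A C x + dform p A C y :=
  Subtype.ext <| funext fun n => (D A (Lvl p C n)).map_add (Ideal.Quotient.mk _ x)
    (Ideal.Quotient.mk _ y)

theorem dform_mul (x y : C) :
    dform p A C (x * y) = x • dform p A C y + y • dform p A C x :=
  Subtype.ext <| funext fun n => ((D A (Lvl p C n)).leibniz (Ideal.Quotient.mk _ x)
    (Ideal.Quotient.mk _ y)).trans (congrArg₂ (fun u v => u + v)
      (pi_smul_lvl x (dform p A C y).1 n).symm (pi_smul_lvl y (dform p A C x).1 n).symm)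

theorem dform_algebraMap (c : A) : dform p A C (algebraMap A C c) = 0 :=
  Subtype.ext <| funext fun n => (D A (Lvl p C n)).map_algebraMap c

/-- The wedge product of two `1`-forms. -/
def wedge (v w : Omega1 p A C) : OmegaPow p A C 2 := exteriorPower.ιMulti C 2 ![v, w]

/-- The `1`-form `dx₃ / (e x₁ x₂)`, where `e x₁ x₂` is invertible. -/
def curveForm (x : Fin 3 → C) (e : C) : Omega1 p A C :=
  Ring.inverse (e * x 0 * x 1) • dform p A C (x 2)

/-- The `2`-form `dx₂ ∧ dx₃ / x₁`, where `x₁` is invertible. -/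
def areaForm (x : Fin 3 → C) : OmegaPow p A C 2 :=
  Ring.inverse (x 0) • wedge p A C (dform p A C (x 1)) (dform p A C (x 2))

variable {p A C}

theorem dform_sphere {x0 x1 x2 : C} {c : A}
    (h : x0 * x0 + x1 * x1 + x2 * x2 = algebraMap A C c) :
    (x0 • dform p A C x0 + x0 • dform p A C x0) + (x1 • dform p A C x1 + x1 • dform p A C x1) +
      (x2 • dform p A C x2 + x2 • dform p A C x2) = 0 := by
  have hd := congrArg (dform p A C) h
  rwa [dform_algebraMap, dform_add, dform_add, dform_mul, dform_mul, dform_mul] at hd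

/-- On a sphere `x₁² + x₂² + x₃² = c` the forms `dx₂ ∧ dx₃ / x₁`, `dx₃ ∧ dx₁ / x₂` and
`dx₁ ∧ dx₂ / x₃` agree: they are glued by the symplectic form. -/
theorem areaForm_spec {x : Fin 3 → C} {c : A} (hx : IsUnit (x 0)) (h2 : IsUnit (2 : C))
    (h : x 0 * x 0 + x 1 * x 1 + x 2 * x 2 = algebraMap A C c) :
    x 0 • areaForm p A C x = wedge p A C (dform p A C (x 1)) (dform p A C (x 2)) ∧
      x 1 • areaForm p A C x = wedge p A C (dform p A C (x 2)) (dform p A C (x 0)) ∧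
      x 2 • areaForm p A C x = wedge p A C (dform p A C (x 0)) (dform p A C (x 1)) :=
  ιMulti_two_of_relation hx h2 (dform_sphere h) rfl

end Forms

/-- `y` is the quotient `x / m` in the abelian group `M`: the one and only element with
`m • y = x`. -/
def IsQuot {M : Type*} [AddCommGroup M] (m : ℕ) (x y : M) : Prop :=
  m • y = x ∧ ∀ y' : M, m • y' = x → y' = y

/-- Congruence modulo `p` in an abelian group. -/
def CongrMod {M : Type*} [AddCommGroup M] (p : ℕ) (x y : M) : Prop := ∃ z : M, x - y = p • z

section FormPullback

variable {p : ℕ} {A : Type*} [CommRing A] {δA : PDerivation p A}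
  {C : Type*} [CommRing C] [Algebra A C]

/-- The endomorphism of `C / pⁿ` induced by the Frobenius lift of a flow. -/
def ArithFlow.lvlFrob (δ : ArithFlow δA C) (n : ℕ) : Lvl p C n →+* Lvl p C n :=
  Ideal.quotientMap _ δ.frob (by
    rw [Ideal.span_singleton_le_iff_mem, Ideal.mem_comap, map_pow, map_natCast]
    exact Ideal.mem_span_singleton_self _)

theorem ArithFlow.lvlFrob_mk (δ : ArithFlow δA C) (n : ℕ) (c : C) :
    δ.lvlFrob n (Ideal.Quotient.mk _ c) = Ideal.Quotient.mk _ (δ.frob c) := rfl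

theorem ArithFlow.lvlFrob_algebraMap (δ : ArithFlow δA C) (n : ℕ) (a : A) :
    δ.lvlFrob n (algebraMap A (Lvl p C n) a) = algebraMap A (Lvl p C n) (δA.frob a) := by
  change (Ideal.Quotient.mk _ (δ.frob (algebraMap A C a)) : Lvl p C n) = _
  rw [δ.frob_algebraMap]; rfl

/-- The pull-back on differentials of `C / pⁿ` by the Frobenius lift of a flow. -/
def ArithFlow.lvlPullback (δ : ArithFlow δA C) (n : ℕ) :
    Ω[Lvl p C n⁄A] →ₛₗ[δ.lvlFrob n] Ω[Lvl p C n⁄A] :=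
  kaehlerPullback δA.frob (δ.lvlFrob n) (δ.lvlFrob_algebraMap n)

theorem ArithFlow.lvlFrob_comm (δ : ArithFlow δA C) (n : ℕ) :
    (lvlMap p C n).comp (δ.lvlFrob (n + 1)) = (δ.lvlFrob n).comp (lvlMap p C n) := by
  refine Ideal.Quotient.ringHom_ext (RingHom.ext fun c => ?_)
  change lvlMap p C n (δ.lvlFrob (n + 1) (Ideal.Quotient.mk _ c)) =
    δ.lvlFrob n (lvlMap p C n (Ideal.Quotient.mk _ c))
  rw [δ.lvlFrob_mk, lvlMap_mk, lvlMap_mk, δ.lvlFrob_mk]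

theorem ArithFlow.lvlPullback_comm (δ : ArithFlow δA C) (n : ℕ) (w : Ω[Lvl p C (n + 1)⁄A]) :
    omegaTrans p A C n (δ.lvlPullback (n + 1) w) = δ.lvlPullback n (omegaTrans p A C n w) :=
  kaehlerPullback_comm _ _ _ _ (δ.lvlFrob_comm n) w

/-- The pull-back `φ^*` on `1`-forms by the Frobenius lift `φ` of a flow. -/
def ArithFlow.pullback1 (δ : ArithFlow δA C) : Omega1 p A C →ₛₗ[δ.frob] Omega1 p A C where
  toFun w := ⟨fun n => δ.lvlPullback n (w.1 n), fun n =>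
    (δ.lvlPullback_comm n _).trans (congrArg _ (w.2 n))⟩
  map_add' x y := Subtype.ext <| funext fun n => (δ.lvlPullback n).map_add (x.1 n) (y.1 n)
  map_smul' c x := Subtype.ext <| funext fun n => by
    change δ.lvlPullback n ((c • x.1) n) =
      (δ.frob c • (fun n => δ.lvlPullback n (x.1 n) : ∀ n, Ω[Lvl p C n⁄A])) n
    rw [pi_smul_lvl, pi_smul_lvl, LinearMap.map_smulₛₗ]
    rfl

/-- The alternating map `(w₁, …, w_i) ↦ φ^*w₁ ∧ ⋯ ∧ φ^*w_i`. -/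
def ArithFlow.pullbackAlt (δ : ArithFlow δA C) (i : ℕ) :
    (Omega1 p A C) [⋀^Fin i]→ₗ[C] (Restr δ.frob (OmegaPow p A C i)) where
  toFun v := (exteriorPower.ιMulti C i (fun j => δ.pullback1 (v j)) : OmegaPow p A C i)
  map_update_add' v j x y := by
    have h (z) : (fun k => δ.pullback1 (Function.update v j z k)) =
        Function.update (fun k => δ.pullback1 (v k)) j (δ.pullback1 z) :=
      Function.comp_update (fun u => δ.pullback1 u) v j z
    simp only [h, map_add]
    exact (exteriorPower.ιMulti C i).map_update_add _ _ _ _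
  map_update_smul' v j c x := by
    have h (z) : (fun k => δ.pullback1 (Function.update v j z k)) =
        Function.update (fun k => δ.pullback1 (v k)) j (δ.pullback1 z) :=
      Function.comp_update (fun u => δ.pullback1 u) v j z
    simp only [h, LinearMap.map_smulₛₗ]
    exact (exteriorPower.ιMulti C i).map_update_smul _ _ _ _
  map_eq_zero_of_eq' v _ _ hjk hne :=
    (exteriorPower.ιMulti C i).map_eq_zero_of_eq (fun j => δ.pullback1 (v j))
      (congrArg δ.pullback1 hjk) hne

/-- The pull-back `φ^*` on `i`-forms:
`φ^*(c w₁ ∧ ⋯ ∧ w_i) = φ(c) φ^*w₁ ∧ ⋯ ∧ φ^*w_i`. -/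
def ArithFlow.pullback (δ : ArithFlow δA C) (i : ℕ) :
    OmegaPow p A C i →ₛₗ[δ.frob] OmegaPow p A C i :=
  Restr.toSemilinear δ.frob (exteriorPower.alternatingMapLinearEquiv (δ.pullbackAlt i))

theorem ArithFlow.pullback1_dform (δ : ArithFlow δA C) (c : C) :
    δ.pullback1 (dform p A C c) = dform p A C (δ.frob c) :=
  Subtype.ext (funext fun n =>
    kaehlerPullback_D δA.frob (δ.lvlFrob n) (δ.lvlFrob_algebraMap n) _)

theorem ArithFlow.pullback_ιMulti (δ : ArithFlow δA C) (i : ℕ) (v : Fin i → Omega1 p A C) :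
    δ.pullback i (exteriorPower.ιMulti C i v) =
      exteriorPower.ιMulti C i (fun j => δ.pullback1 (v j)) :=
  exteriorPower.alternatingMapLinearEquiv_apply_ιMulti (δ.pullbackAlt i) v

theorem ArithFlow.pullback_wedge (δ : ArithFlow δA C) (v w : Omega1 p A C) :
    δ.pullback 2 (wedge p A C v w) = wedge p A C (δ.pullback1 v) (δ.pullback1 w) := by
  unfold wedge
  rw [δ.pullback_ιMulti]
  congr 1
  funext j
  fin_cases j <;> rfl

/-- For a `1`-form `w` and a function `μ`: the form `φ^* w` has a unique quotient
`(φ^* / p) w` by `p`, and `(φ^* / p) w ≡ μ w mod p`. -/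
def ArithFlow.Scales1 (δ : ArithFlow δA C) (w : Omega1 p A C) (μ : C) : Prop :=
  ∃ τ : Omega1 p A C, IsQuot p (δ.pullback1 w) τ ∧ CongrMod p τ (μ • w)

/-- For a `2`-form `w` and a function `μ`: the form `φ^* w` has a unique quotient
`(φ^* / p²) w` by `p²`, and `(φ^* / p²) w ≡ μ w mod p`. -/
def ArithFlow.Scales2 (δ : ArithFlow δA C) (w : OmegaPow p A C 2) (μ : C) : Prop :=
  ∃ τ : OmegaPow p A C 2, IsQuot (p ^ 2) (δ.pullback 2 w) τ ∧ CongrMod p τ (μ • w)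

end FormPullback

/-! ## `p`-adic completion -/

section Completion

variable (p : ℕ)

/-- The `p`-adic completion of a ring. -/
abbrev PHat (R : Type*) [CommRing R] : Type _ := AdicCompletion (Ideal.span {(p : R)}) R

variable {R S : Type*} [CommRing R] [CommRing S]

/-- The map induced by a ring homomorphism on the `n`-th quotient of the `p`-adic completion. -/
def completionLvl (g : R →+* S) (n : ℕ) : PHat p R →+* S ⧸ Ideal.span {(p : S)} ^ n :=
  (Ideal.quotientMap (Ideal.span {(p : S)} ^ n) g (by
    rw [Ideal.span_singleton_pow, Ideal.span_singleton_pow, Ideal.span_singleton_le_iff_mem,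
      Ideal.mem_comap, map_pow, map_natCast]
    exact Ideal.mem_span_singleton_self _) : R ⧸ Ideal.span {(p : R)} ^ n →+* _).comp
      (AdicCompletion.evalₐ (Ideal.span {(p : R)}) n : PHat p R →+* _)

theorem completionLvl_compat (g : R →+* S) {m n : ℕ} (hle : m ≤ n) :
    (Ideal.Quotient.factorPow (Ideal.span {(p : S)}) hle).comp (completionLvl p g n) =
      completionLvl p g m := by
  ext x
  induction x using AdicCompletion.induction_on with
  | _ x =>
    simp only [completionLvl, RingHom.comp_apply, RingHom.coe_coe, AdicCompletion.evalₐ_mk,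
      Ideal.quotientMap_mk]
    have hx : (Ideal.Quotient.mk (Ideal.span {(p : R)} ^ m) (x n)) =
        Ideal.Quotient.mk _ (x m) := by
      have h := x.property hle
      rw [SModEq.comm, SModEq.sub_mem] at h
      rw [Ideal.Quotient.eq]
      simpa using h
    rw [Ideal.Quotient.eq] at hx
    change Ideal.Quotient.mk (Ideal.span {(p : S)} ^ m) (g (x n)) = Ideal.Quotient.mk _ (g (x m))
    rw [Ideal.Quotient.eq, ← map_sub]
    revert hx
    rw [Ideal.span_singleton_pow, Ideal.span_singleton_pow, Ideal.mem_span_singleton,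
      Ideal.mem_span_singleton]
    intro hx
    simpa using map_dvd g hx

/-- The map induced on `p`-adic completions by a ring homomorphism. -/
def completionMap (g : R →+* S) : PHat p R →+* PHat p S :=
  AdicCompletion.liftRingHom (Ideal.span {(p : S)}) (completionLvl p g) (completionLvl_compat p g)

theorem completionMap_algebraMap (g : R →+* S) (r : R) :
    completionMap p g (algebraMap R (PHat p R) r) = algebraMap S (PHat p S) (g r) := by
  apply AdicCompletion.ext_evalₐ
  intro n
  rw [completionMap, AdicCompletion.evalₐ_liftRingHom]
  simp [completionLvl, AdicCompletion.algebraMap_apply]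

end Completion

/-! ## Geometry of the Euler top -/

section Euler

open MvPolynomial

variable (p : ℕ) {A : Type*} [CommRing A] (a : Fin 3 → A)

/-- `H₁ = a₁ x₁² + a₂ x₂² + a₃ x₃²`. -/
def H1 : MvPolynomial (Fin 3) A := ∑ i, C (a i) * X i ^ 2

variable (A) in
/-- `H₂ = x₁² + x₂² + x₃²`. -/
def H2 : MvPolynomial (Fin 3) A := ∑ i, X i ^ 2

/-- `N(z₁, z₂) = ∏ (z₁ - a_i z₂)`. -/
def discN : MvPolynomial (Fin 2) A := ∏ i, (X 0 - C (a i) * X 1)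

/-- The quartic
`F = ((a₂ - a₃) x² + z₁ - a₂ z₂) ((a₃ - a₁) x² - z₁ + a₁ z₂) ∈ A[z₁, z₂][x]`. -/
def quartic : Polynomial (MvPolynomial (Fin 2) A) :=
  (Polynomial.C (C (a 1 - a 2)) * Polynomial.X ^ 2 + Polynomial.C (X 0 - C (a 1) * X 1)) *
  (Polynomial.C (C (a 2 - a 0)) * Polynomial.X ^ 2 - Polynomial.C (X 0 - C (a 0) * X 1))

/-- The Hasse invariant `A_{p-1} ∈ A[z₁, z₂]`: the coefficient of `x^{p-1}` in
`F^{(p-1)/2}`. -/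
def hasse : MvPolynomial (Fin 2) A := (quartic a ^ ((p - 1) / 2)).coeff (p - 1)

/-- `Q = x₁ x₂ N(H₁, H₂) A_{p-1}(H₁, H₂)`. -/
def polyQ : MvPolynomial (Fin 3) A :=
  X 0 * X 1 * aeval ![H1 a, H2 A] (discN a) * aeval ![H1 a, H2 A] (hasse p a)

/-- The coordinate ring `A[x₁, x₂, x₃][1/Q]` of `X`. -/
abbrev RingX : Type _ := Localization.Away (polyQ p a)

/-- The coordinate ring of `V(J) ∩ X`, for the closed subscheme `V(J)` of affine space. -/
abbrev RingV (J : Ideal (MvPolynomial (Fin 3) A)) : Type _ :=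
  RingX p a ⧸ J.map (algebraMap (MvPolynomial (Fin 3) A) (RingX p a))

/-- The ring of functions on the `p`-adic completion of `X`. -/
abbrev HatX : Type _ := PHat p (RingX p a)

/-- The ring of functions on the `p`-adic completion of `V(J) ∩ X`. -/
abbrev HatV (J : Ideal (MvPolynomial (Fin 3) A)) : Type _ := PHat p (RingV p a J)

/-- The restriction of functions from the completion of `X` to that of `V(J) ∩ X`. -/
def restrict (J : Ideal (MvPolynomial (Fin 3) A)) : HatX p a →+* HatV p a J :=
  completionMap p (Ideal.Quotient.mk _)

/-- The flow `δV` on the completion of `V(J) ∩ X` is induced by the flow `δX` on the completion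
of `X`. -/
def Induces {p : ℕ} {δA : PDerivation p A} {a : Fin 3 → A} (J : Ideal (MvPolynomial (Fin 3) A))
    (δX : ArithFlow δA (HatX p a)) (δV : ArithFlow δA (HatV p a J)) : Prop :=
  ∀ f : HatX p a, δV (restrict p a J f) = restrict p a J (δX f)

/-- A polynomial as a function on the completion of `X`. -/
def fnX (f : MvPolynomial (Fin 3) A) : HatX p a :=
  algebraMap (RingX p a) _ (algebraMap _ (RingX p a) f)

/-- A polynomial as a function on the completion of `V(J) ∩ X`. -/
def fnV (J : Ideal (MvPolynomial (Fin 3) A)) : MvPolynomial (Fin 3) A →ₐ[A] HatV p a J where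
  toRingHom := (algebraMap (RingV p a J) (HatV p a J)).comp
    ((Ideal.Quotient.mk _).comp (algebraMap _ (RingX p a)))
  commutes' r := by
    change AdicCompletion.of _ _ (Ideal.Quotient.mk _ (algebraMap (MvPolynomial (Fin 3) A)
      (RingX p a) (algebraMap A _ r))) = AdicCompletion.of _ _ (algebraMap A (RingV p a J) r)
    rw [← IsScalarTower.algebraMap_apply A (MvPolynomial (Fin 3) A) (RingX p a)]
    rfl

/-- The ideal of the sphere `S_{c₂} : H₂ = c₂`. -/
def idealS (c₂ : A) : Ideal (MvPolynomial (Fin 3) A) := Ideal.span {H2 A - C c₂}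

/-- The ideal of the curve `E_c : H₁ = c₁, H₂ = c₂`. -/
def idealE (c₁ c₂ : A) : Ideal (MvPolynomial (Fin 3) A) :=
  Ideal.span {H1 a - C c₁, H2 A - C c₂}

/-- The coordinate functions `x₁, x₂, x₃` on the completion of `V(J) ∩ X`. -/
def coord (J : Ideal (MvPolynomial (Fin 3) A)) (i : Fin 3) : HatV p a J := fnV p a J (X i)

theorem restrict_fnX (J : Ideal (MvPolynomial (Fin 3) A)) (f : MvPolynomial (Fin 3) A) :
    restrict p a J (fnX p a f) = fnV p a J f :=
  completionMap_algebraMap p _ _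

theorem isUnit_fnV_polyQ (J : Ideal (MvPolynomial (Fin 3) A)) : IsUnit (fnV p a J (polyQ p a)) :=
  ((IsLocalization.Away.algebraMap_isUnit (S := RingX p a) (polyQ p a)).map
    (Ideal.Quotient.mk (J.map (algebraMap (MvPolynomial (Fin 3) A) (RingX p a))))).map
    (algebraMap (RingV p a J) (HatV p a J))

theorem isUnit_fnV_X_zero (J : Ideal (MvPolynomial (Fin 3) A)) : IsUnit (fnV p a J (X 0)) := by
  have h := isUnit_fnV_polyQ p a J
  simp only [polyQ, map_mul, IsUnit.mul_iff] at h
  exact h.1.1.1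

theorem isUnit_fnV_X_one (J : Ideal (MvPolynomial (Fin 3) A)) : IsUnit (fnV p a J (X 1)) := by
  have h := isUnit_fnV_polyQ p a J
  simp only [polyQ, map_mul, IsUnit.mul_iff] at h
  exact h.1.1.2

theorem fnV_eq_zero_of_mem (J : Ideal (MvPolynomial (Fin 3) A)) {f : MvPolynomial (Fin 3) A}
    (hf : f ∈ J) : fnV p a J f = 0 := by
  change algebraMap (RingV p a J) (HatV p a J) (Ideal.Quotient.mk _ (algebraMap _ (RingX p a) f)) = 0
  rw [Ideal.Quotient.eq_zero_iff_mem.2 (Ideal.mem_map_of_mem _ hf), map_zero]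

/-- The canonical `1`-form `ω_c = dx₃ / ((a₁ - a₂) x₁ x₂)` on the completion of `E_c ∩ X`, where
`x₁` and `x₂` are invertible. -/
def omegaE (c₁ c₂ : A) : Omega1 p A (HatV p a (idealE a c₁ c₂)) :=
  curveForm p A _ (coord p a _) (algebraMap A _ (a 0 - a 1))

/-- The symplectic form `η_{c₂} = dx₂ ∧ dx₃ / x₁` on the completion of `S_{c₂} ∩ X`, where
`x₁` is invertible. -/
def etaS (c₂ : A) : OmegaPow p A (HatV p a (idealS c₂)) 2 :=
  areaForm p A _ (coord p a _)

/-- The function `A_{p-1}(H₁, c₂)` on the completion of `S_{c₂} ∩ X`. -/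
def hasseS (c₂ : A) : HatV p a (idealS c₂) :=
  aeval ![fnV p a (idealS c₂) (H1 a), algebraMap A _ c₂] (hasse p a)

/-- The function `λ = H₁^{p-1} / A_{p-1}(H₁, c₂)` on the completion of `S_{c₂} ∩ X`. -/
def lambdaS (c₂ : A) : HatV p a (idealS c₂) :=
  fnV p a (idealS c₂) (H1 a) ^ (p - 1) * Ring.inverse (hasseS p a c₂)

theorem fnV_H2 (c₂ : A) : fnV p a (idealS c₂) (H2 A) = algebraMap A _ c₂ := by
  have := fnV_eq_zero_of_mem p a (idealS c₂) (Ideal.mem_span_singleton_self (H2 A - C c₂))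
  rw [map_sub, sub_eq_zero] at this
  rw [this]
  exact (fnV p a (idealS c₂)).commutes c₂

theorem isUnit_hasseS (c₂ : A) : IsUnit (hasseS p a c₂) := by
  have h := isUnit_fnV_polyQ p a (idealS c₂)
  simp only [polyQ, map_mul, IsUnit.mul_iff] at h
  have h2 := fnV_H2 p a c₂
  have h3 : fnV p a (idealS c₂) (aeval ![H1 a, H2 A] (hasse p a)) = hasseS p a c₂ := by
    rw [hasseS, ← h2, ← AlgHom.comp_apply, comp_aeval]
    congr 2
    funext i
    fin_cases i <;> rfl
  exact h3 ▸ h.2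

/-- An arithmetic Euler flow: a flow on the completion of `X` with prime integrals `H₁`, `H₂`,
inducing on each `E_c ∩ X` (`c₁, c₂` being `δ`-constants with `N(c) A_{p-1}(c)` a unit) a
Frobenius lift `φ_c` with `(φ_c^* / p) ω_c ≡ A_{p-1}(c)⁻¹ ω_c mod p`. -/
structure IsEulerFlow {p : ℕ} {a : Fin 3 → A} {δA : PDerivation p A}
    (δX : ArithFlow δA (HatX p a)) : Prop where
  prime_integral₁ : δX (fnX p a (H1 a)) = 0
  prime_integral₂ : δX (fnX p a (H2 A)) = 0
  linearization : ∀ c₁ c₂ : A, δA c₁ = 0 → δA c₂ = 0 →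
    IsUnit (aeval ![c₁, c₂] (discN a) * aeval ![c₁, c₂] (hasse p a)) →
    ∃ δE : ArithFlow δA (HatV p a (idealE a c₁ c₂)), Induces (idealE a c₁ c₂) δX δE ∧
      δE.Scales1 (omegaE p a c₁ c₂) (algebraMap A _ (Ring.inverse (aeval ![c₁, c₂] (hasse p a))))

/-- The Hamiltonian property modulo `p` on the sphere `S_{c₂}`: the flow `δX` induces one and
only one flow on the completion of `S_{c₂} ∩ X`, the function `A_{p-1}(H₁, c₂)` is invertible there,
`λ` is a pseudo-constant, and the Frobenius lift `φ` satisfies `(φ^* / p²) η_{c₂} ≡ λ η_{c₂} mod p`. -/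
def HamiltonianModP {p : ℕ} {a : Fin 3 → A} {δA : PDerivation p A}
    (δX : ArithFlow δA (HatX p a)) (c₂ : A) : Prop :=
  ∃ δS : ArithFlow δA (HatV p a (idealS c₂)), Induces (idealS c₂) δX δS ∧
    (∀ δ' : ArithFlow δA (HatV p a (idealS c₂)), Induces (idealS c₂) δX δ' → δ' = δS) ∧
    IsUnit (hasseS p a c₂) ∧ IsPseudoConstant δS.toPDerivation (lambdaS p a c₂) ∧
    δS.Scales2 (etaS p a c₂) (lambdaS p a c₂)

end Euler

end ArithmeticEuler

end

noncomputable section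
namespace ArithmeticEuler

/-! ## Completeness and torsion of `p`-adic completions -/

section Adic

variable (p : ℕ) (R : Type*) [CommRing R]

/-! Everything is governed by one function modulo `p`. Write y = (a₁ - a₂)x₁x₂ and α = A_{p-1}(H₁,
H₂), and let D be the Euler vector field, which kills H₁ and H₂ and satisfies D x₃ = y; on E_c it is
dual to ω = dx₃/y. If φ is a Frobenius lift and f = δx₃, then (φ^*/p)ω = (x₃^{p-1}dx₃ + df)/φ(y),
and φ(y) ≡ y^p. Pairing with D shows that (φ^*/p)ω ≡ α⁻¹ω on E_c exactly when the obstruction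
α(x₃^{p-1}y + D f) - y^p vanishes there modulo `p` (`scales1_iff`).

The same obstruction controls the spheres. There η = -½ dH₁ ∧ ω, and φ(H₁) = H₁^p, so (φ^*/p²)η = -½
H₁^{p-1} dH₁ ∧ (φ^*/p)ω. If the obstruction vanishes on the sphere, (φ^*/p)ω - α⁻¹ω is modulo `p` a
multiple of dH₁, which the wedge product kills; this gives the factor λ = H₁^{p-1}/α
(`scales2_of_obstruction`). That λ is a pseudo-constant follows because H₁ and c₂ are constants and
elements of A are limits of sums of Teichmüller digits.

Existence. The relation y² = F(x₃) gives y^p = F^{(p-1)/2}(x₃) y. The polynomial F^{(p-1)/2} has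
degree at most 2(p-1), so after removing its x^{p-1} term it has an antiderivative G over A[z₁, z₂];
with g = G(x₃) at z = (H₁, H₂) one finds D g = y^p - αx₃^{p-1}y. Hence δx₃ = g/α makes the
obstruction vanish on all of X. Prescribing φ(x₃), φ(H₁) = H₁^p and φ(H₂) = H₂^p determines φ(x₁)²
and φ(x₂)², and Hensel's lemma extracts the square roots because x₁, x₂ and 2 are units
(`exists_frobenius_lift`, `exists_flow`).

Arbitrary Euler flows. The obstruction is a function modulo `p` on X that vanishes on E_c for every
pair of constants c with N(c)A_{p-1}(c) a unit. Teichmüller lifts supply such a c₁ in all but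
finitely many residue classes, unless the sphere is empty modulo `p`. When k is infinite these
curves are dense in the sphere modulo `p`, so the obstruction vanishes there
(`restrictLvl_idealS_eq_zero`).

The division of forms by powers of `p` needs `p`-torsion-free rings (`saturated_idealS`,
`saturated_idealE`) and free modules of forms (`exists_basis_curve`, `exists_basis_sphere`). -/

instance isAdicComplete_phat : IsAdicComplete (Ideal.span {(p : PHat p R)}) (PHat p R) := by
  have h := AdicCompletion.isAdicComplete (M := R) (I := Ideal.span {(p : R)})
    ⟨{(p : R)}, by simp⟩
  rw [← IsAdicComplete.map_algebraMap_iff (S := PHat p R), Ideal.map_span,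
    Set.image_singleton, map_natCast] at h
  exact h

variable {p R}

/-- Since (p) is finitely generated, the kernel of projection to level n is pⁿ times the completion;
no Noetherian hypothesis enters. -/
theorem phat_evalₐ_eq_zero {n : ℕ} {x : PHat p R}
    (hx : AdicCompletion.evalₐ (Ideal.span {(p : R)}) n x = 0) :
    ∃ c, x = (p : PHat p R) ^ n * c := by
  have h : (Ideal.span {(p : R)}) ^ n • (⊤ : Ideal R) ≤ Ideal.span {(p : R)} ^ n :=
    Ideal.mul_le_left
  have h' : (Ideal.span {(p : R)}) ^ n ≤ (Ideal.span {(p : R)}) ^ n • (⊤ : Ideal R) := by simp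
  have hx1 : x ∈ (AdicCompletion.eval (Ideal.span {(p : R)}) R n).ker := by
    rw [LinearMap.mem_ker, ← AdicCompletion.factor_evalₐ_eq_eval _ _ h', hx, map_zero]
  rw [← AdicCompletion.pow_smul_top_eq_ker_eval ⟨{(p : R)}, by simp⟩,
    Ideal.span_singleton_pow] at hx1
  rw [Submodule.ideal_span_singleton_smul] at hx1
  obtain ⟨c, -, hc⟩ := hx1
  refine ⟨c, ?_⟩
  rw [← hc]
  change ((p : R) ^ n) • c = _
  rw [Algebra.smul_def]; simp

theorem phat_exists_eq_add (n : ℕ) (x : PHat p R) :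
    ∃ b : R, ∃ c, x = algebraMap R _ b + (p : PHat p R) ^ n * c := by
  obtain ⟨b, hb⟩ := Ideal.Quotient.mk_surjective (AdicCompletion.evalₐ (Ideal.span {(p : R)}) n x)
  obtain ⟨c, hc⟩ := phat_evalₐ_eq_zero (n := n) (x := x - algebraMap R _ b) (by
    rw [map_sub, ← hb, AlgHom.commutes]
    simp)
  exact ⟨b, c, by rw [← hc]; ring⟩

theorem phat_evalₐ_natCast_pow (n : ℕ) :
    AdicCompletion.evalₐ (Ideal.span {(p : R)}) n ((p : PHat p R) ^ n) = 0 := by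
  rw [map_pow, map_natCast, ← map_natCast (Ideal.Quotient.mk _), ← map_pow,
    Ideal.Quotient.eq_zero_iff_mem]
  exact Ideal.pow_mem_pow (Ideal.mem_span_singleton_self _) _

theorem phat_pow_dvd_of_dvd {n : ℕ} {b : R}
    (h : (p : PHat p R) ^ n ∣ algebraMap R (PHat p R) b) : (p : R) ^ n ∣ b := by
  obtain ⟨d, hd⟩ := h
  have h1 := congrArg (AdicCompletion.evalₐ (Ideal.span {(p : R)}) n) hd
  rwa [map_mul, phat_evalₐ_natCast_pow, zero_mul, AlgHom.commutes, Ideal.Quotient.algebraMap_eq,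
    Ideal.Quotient.eq_zero_iff_mem, Ideal.span_singleton_pow, Ideal.mem_span_singleton] at h1

theorem phat_torsionFree (h : ∀ b : R, (p : R) * b = 0 → b = 0) (x : PHat p R)
    (hx : (p : PHat p R) * x = 0) : x = 0 := by
  refine AdicCompletion.ext_evalₐ fun n => ?_
  -- One digit more than n, because cancelling p costs one power.
  obtain ⟨b, c, rfl⟩ := phat_exists_eq_add (n + 1) x
  have hb : (p : R) ^ (n + 1) ∣ p * b := by
    refine phat_pow_dvd_of_dvd ⟨-(p * c), ?_⟩
    rw [map_mul, map_natCast]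
    linear_combination hx
  obtain ⟨r, hr⟩ := hb
  have hb' : b = (p : R) ^ n * r := by
    rw [← sub_eq_zero]
    apply h
    rw [mul_sub, hr]; ring
  rw [hb', map_mul, map_pow, map_natCast, pow_succ, mul_assoc, ← mul_add, map_mul,
    phat_evalₐ_natCast_pow, zero_mul, map_zero]

end Adic

section Level

variable {p : ℕ} {C : Type*} [CommRing C]

theorem lvl_natCast_pow (n : ℕ) : ((p : Lvl p C n)) ^ n = 0 := by
  rw [← map_natCast (Ideal.Quotient.mk _), ← map_pow, Ideal.Quotient.eq_zero_iff_mem]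
  exact Ideal.mem_span_singleton_self _

theorem lvl_mk_eq_zero {n : ℕ} {c : C} :
    (Ideal.Quotient.mk _ c : Lvl p C n) = 0 ↔ ∃ d, c = (p : C) ^ n * d := by
  rw [Ideal.Quotient.eq_zero_iff_mem, Ideal.mem_span_singleton]; rfl

end Level

section Complete

variable {p : ℕ} {C : Type*} [CommRing C] [hC : IsAdicComplete (Ideal.span {(p : C)}) C]

theorem eq_zero_of_forall_pow_dvd {x : C} (h : ∀ n : ℕ, ∃ c, x = (p : C) ^ n * c) : x = 0 := by
  refine IsHausdorff.haus (I := Ideal.span {(p : C)}) hC.toIsHausdorff x fun n => ?_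
  obtain ⟨c, rfl⟩ := h n
  rw [SModEq.zero, smul_eq_mul, Ideal.mul_top, Ideal.span_singleton_pow]
  exact Ideal.mul_mem_right _ _ (Ideal.mem_span_singleton_self _)

theorem exists_of_lvl_compatible (f : ∀ n, Lvl p C n) (hf : ∀ n, lvlMap p C n (f (n + 1)) = f n) :
    ∃ c : C, ∀ n, Ideal.Quotient.mk _ c = f n := by
  choose g hg using fun n => Ideal.Quotient.mk_surjective (f n)
  have hstep : ∀ n, ∃ d, g (n + 1) - g n = (p : C) ^ n * d := fun n => by
    rw [← lvl_mk_eq_zero, map_sub, hg, ← hf n, ← hg (n + 1), lvlMap_mk, sub_self]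
  have hle : ∀ {m n : ℕ}, m ≤ n → ∃ d, g n - g m = (p : C) ^ m * d := by
    intro m n hmn
    induction n, hmn using Nat.le_induction with
    | base => exact ⟨0, by simp⟩
    | succ n hmn ih =>
      obtain ⟨d, hd⟩ := ih
      obtain ⟨e, he⟩ := hstep n
      obtain ⟨k, rfl⟩ := Nat.exists_eq_add_of_le hmn
      exact ⟨d + p ^ k * e, by linear_combination hd + he⟩
  obtain ⟨c, hc⟩ := hC.toIsPrecomplete.prec' g (fun {m n} hmn => by
    rw [SModEq.comm, SModEq.sub_mem, smul_eq_mul, Ideal.mul_top, Ideal.span_singleton_pow,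
      Ideal.mem_span_singleton]
    exact hle hmn)
  refine ⟨c, fun n => ?_⟩
  rw [← hg, ← sub_eq_zero, ← map_sub, lvl_mk_eq_zero]
  have := hc n
  rw [SModEq.comm, SModEq.sub_mem, smul_eq_mul, Ideal.mul_top, Ideal.span_singleton_pow,
    Ideal.mem_span_singleton] at this
  exact this

/-- In a `p`-adically complete ring p lies in the Jacobson radical. -/
theorem isUnit_of_sub_dvd {u v : C} (hu : IsUnit u) (h : ∃ d, v - u = p * d) : IsUnit v := by
  have hJ : Ideal.span {(p : C)} ≤ Ideal.jacobson ⊥ := IsAdicComplete.le_jacobson_bot _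
  obtain ⟨d, hd⟩ := h
  obtain ⟨u, rfl⟩ := hu
  have h1 := (Ideal.mem_jacobson_bot.1 (hJ (Ideal.mem_span_singleton_self (p : C))))
    (d * ((u⁻¹ : Cˣ) : C))
  have h2 : v = (p * (d * ((u⁻¹ : Cˣ) : C)) + 1) * u := by
    have := u.inv_mul
    linear_combination hd - p * d * this
  rw [h2]
  exact h1.mul u.isUnit

/-- Hensel's lemma for X² - (1 + pu) at the approximate root 1, where the derivative is the unit 2.
-/
theorem exists_sq_eq_one_add (h2 : IsUnit (2 : C)) (u : C) :
    ∃ s r : C, s ^ 2 = 1 + p * u ∧ s = 1 + p * r := by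
  have hH : HenselianRing C (Ideal.span {(p : C)}) := inferInstance
  obtain ⟨s, hs, hs1⟩ := hH.is_henselian (Polynomial.X ^ 2 - Polynomial.C (1 + p * u))
    (Polynomial.monic_X_pow_sub_C _ two_ne_zero) 1 (by
      simp only [Polynomial.eval_sub, Polynomial.eval_pow, Polynomial.eval_X, one_pow,
        Polynomial.eval_C]
      rw [Ideal.mem_span_singleton]
      exact ⟨-u, by ring⟩) (by
      have : (Polynomial.derivative (Polynomial.X ^ 2 - Polynomial.C (1 + (p : C) * u))).eval 1
          = 2 := by
        simp [one_add_one_eq_two]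
      rw [this]
      exact h2.map _)
  rw [Ideal.mem_span_singleton] at hs1
  obtain ⟨r, hr⟩ := hs1
  refine ⟨s, r, ?_, by linear_combination hr⟩
  simp only [Polynomial.IsRoot, Polynomial.eval_sub, Polynomial.eval_pow, Polynomial.eval_X,
        Polynomial.eval_C] at hs
  linear_combination hs

end Complete

open MvPolynomial KaehlerDifferential

universe u

/-! ## Localized quotients of a polynomial ring and their reductions -/

/-- The algebra `T` is the quotient by the ideal `J` of the localization at `Q` of the polynomial
ring, in terms of its generation and its mapping property. -/
structure IsPres {A : Type u} [CommRing A] {σ : Type} (Q : MvPolynomial σ A)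
    (J : Ideal (MvPolynomial σ A)) {T : Type u} [CommRing T] [Algebra A T]
    (π : MvPolynomial σ A →ₐ[A] T) : Prop where
  isUnit : IsUnit (π Q)
  vanish : ∀ f ∈ J, π f = 0
  gen : ∀ x : T, ∃ f, ∃ m : ℕ, x * π Q ^ m = π f
  lift : ∀ (U : Type u) [CommRing U] [Algebra A U] (ψ : MvPolynomial σ A →ₐ[A] U),
    IsUnit (ψ Q) → (∀ f ∈ J, ψ f = 0) → ∃ Ψ : T →ₐ[A] U, ∀ f, Ψ (π f) = ψ f

namespace IsPres

variable {A : Type u} [CommRing A] {σ : Type} {Q : MvPolynomial σ A}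
  {J : Ideal (MvPolynomial σ A)} {T : Type u} [CommRing T] [Algebra A T]
  {π : MvPolynomial σ A →ₐ[A] T}

/-- Ring homomorphisms out of `T` are determined by their values on polynomials. -/
theorem hom_ext (h : IsPres Q J π) {U : Type*} [CommRing U] {f g : T →+* U}
    (hfg : ∀ r, f (π r) = g (π r)) : f = g := by
  ext x
  obtain ⟨r, m, hr⟩ := h.gen x
  have hu : IsUnit (f (π Q ^ m)) := (h.isUnit.pow m).map f
  refine hu.mul_right_cancel ?_
  rw [← map_mul, hr, hfg, ← hr, map_mul, map_pow, map_pow, hfg]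

/-- This stability lets closed subschemes and reductions modulo pⁿ be handled alike, as localized
quotients of a polynomial ring. -/
theorem quotient (h : IsPres Q J π) (K : Ideal (MvPolynomial σ A)) {T' : Type u} [CommRing T']
    [Algebra A T'] (q : T →ₐ[A] T') (hq : Function.Surjective q)
    (hk : ∀ x, q x = 0 ↔ x ∈ K.map π.toRingHom) :
    IsPres Q (J ⊔ K) (q.comp π) where
  isUnit := h.isUnit.map q
  vanish := by
    intro f hf
    rw [Submodule.mem_sup] at hf
    obtain ⟨y, hy, z, hz, rfl⟩ := hf
    rw [AlgHom.comp_apply, map_add, h.vanish y hy, zero_add, hk]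
    exact Ideal.mem_map_of_mem π.toRingHom hz
  gen x := by
    obtain ⟨y, rfl⟩ := hq x
    obtain ⟨f, m, hf⟩ := h.gen y
    exact ⟨f, m, by rw [AlgHom.comp_apply, AlgHom.comp_apply, ← hf, map_mul, map_pow]⟩
  lift U _ _ ψ hQ hJ := by
    obtain ⟨Ψ, hΨ⟩ := h.lift U ψ hQ fun f hf => hJ f (Ideal.mem_sup_left hf)
    have hker : ∀ x ∈ RingHom.ker q, Ψ x = 0 := by
      intro x hx
      rw [RingHom.mem_ker, hk] at hx
      have : K.map π.toRingHom ≤ RingHom.ker Ψ := by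
        rw [Ideal.map_le_iff_le_comap]
        intro f hf
        rw [Ideal.mem_comap, RingHom.mem_ker]
        exact (hΨ f).trans (hJ f (Ideal.mem_sup_right hf))
      exact this hx
    refine ⟨(Ideal.Quotient.liftₐ _ Ψ hker).comp
      (Ideal.quotientKerAlgEquivOfSurjective hq).symm.toAlgHom, fun f => ?_⟩
    have : (Ideal.quotientKerAlgEquivOfSurjective hq).symm (q (π f)) =
        Ideal.Quotient.mk _ (π f) := by
      rw [AlgEquiv.symm_apply_eq]
      rfl
    change Ideal.Quotient.liftₐ _ Ψ hker
      ((Ideal.quotientKerAlgEquivOfSurjective hq).symm (q (π f))) = _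
    rw [this]
    exact hΨ f

end IsPres

section Hat

variable (p : ℕ) {A : Type u} [CommRing A]

theorem isPres_localization {σ : Type} (Q : MvPolynomial σ A) :
    IsPres Q ⊥ (IsScalarTower.toAlgHom A (MvPolynomial σ A) (Localization.Away Q)) where
  isUnit := IsLocalization.Away.algebraMap_isUnit Q
  vanish f hf := by rw [Ideal.mem_bot.1 hf, map_zero]
  gen x := by
    obtain ⟨n, f, hf⟩ := IsLocalization.Away.surj Q x
    exact ⟨f, n, hf⟩
  lift U _ _ ψ hQ _ := by
    refine ⟨{ toRingHom := IsLocalization.Away.lift (S := Localization.Away Q) (g := ψ.toRingHom) Q hQ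
              commutes' := fun r => ?_ }, fun f => ?_⟩
    · rw [IsScalarTower.algebraMap_apply A (MvPolynomial σ A) (Localization.Away Q)]
      exact (IsLocalization.Away.lift_eq Q hQ _).trans (ψ.commutes r)
    · exact IsLocalization.Away.lift_eq Q hQ _

theorem isPres_quotient {σ : Type} (Q : MvPolynomial σ A) (J : Ideal (MvPolynomial σ A)) :
    IsPres Q J ((Ideal.Quotient.mkₐ A (J.map (algebraMap (MvPolynomial σ A)
      (Localization.Away Q)))).comp
        (IsScalarTower.toAlgHom A (MvPolynomial σ A) (Localization.Away Q))) := by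
  have h := (isPres_localization Q).quotient J (Ideal.Quotient.mkₐ A (J.map (algebraMap
    (MvPolynomial σ A) (Localization.Away Q)))) (Ideal.Quotient.mkₐ_surjective _ _)
    (fun x => Ideal.Quotient.eq_zero_iff_mem)
  rwa [bot_sup_eq] at h

variable {B : Type u} [CommRing B] [Algebra A B]

/-- The map from `A[x]` to the reduction modulo `pⁿ` of the `p`-adic completion of an
`A[x]`-algebra. -/
def lvlPi {σ : Type} (β : MvPolynomial σ A →ₐ[A] B) (n : ℕ) :
    MvPolynomial σ A →ₐ[A] Lvl p (PHat p B) n :=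
  haveI : IsScalarTower A B (PHat p B) := IsScalarTower.of_algebraMap_eq fun _ => rfl
  (Ideal.Quotient.mkₐ A _).comp ((IsScalarTower.toAlgHom A B (PHat p B)).comp β)

/-- Modulo pⁿ the completion agrees with the original ring. Differentials at each level can
therefore be computed from polynomial equations, although the completion itself is not of finite
type. -/
theorem isPres_lvl {σ : Type} {Q : MvPolynomial σ A} {J : Ideal (MvPolynomial σ A)}
    {β : MvPolynomial σ A →ₐ[A] B} (h : IsPres Q J β) (n : ℕ) :
    IsPres Q (J ⊔ Ideal.span {(p : MvPolynomial σ A) ^ n}) (lvlPi p β n) := by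
  have : IsScalarTower A B (PHat p B) := IsScalarTower.of_algebraMap_eq fun _ => rfl
  refine h.quotient _ ((Ideal.Quotient.mkₐ A _).comp (IsScalarTower.toAlgHom A B (PHat p B)))
    (fun x => ?_) (fun x => ?_)
  · obtain ⟨y, rfl⟩ := Ideal.Quotient.mk_surjective x
    obtain ⟨b, c, rfl⟩ := phat_exists_eq_add n y
    refine ⟨b, ?_⟩
    change Ideal.Quotient.mk _ (algebraMap B (PHat p B) b) = _
    rw [eq_comm, ← sub_eq_zero, ← map_sub, lvl_mk_eq_zero]
    exact ⟨c, by ring⟩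
  · change (Ideal.Quotient.mk _ (algebraMap B (PHat p B) x) : Lvl p (PHat p B) n) = 0 ↔ _
    rw [lvl_mk_eq_zero, Ideal.map_span, Set.image_singleton, map_pow, map_natCast,
      Ideal.mem_span_singleton]
    constructor
    · exact fun h => phat_pow_dvd_of_dvd h
    · rintro ⟨d, rfl⟩
      exact ⟨algebraMap B _ d, by simp⟩

end Hat

/-! ## Derivations and differentials of localized quotients -/

section Derivations

variable {A : Type u} [CommRing A] {σ : Type} {Q : MvPolynomial σ A}
  {J : Ideal (MvPolynomial σ A)} {T : Type u} [CommRing T] [Algebra A T]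
  {π : MvPolynomial σ A →ₐ[A] T}

/-- The homomorphism to the dual numbers attached to a map and a tangent vector. -/
def dualHom (π : MvPolynomial σ A →ₐ[A] T) (v : σ → T) : MvPolynomial σ A →ₐ[A] DualNumber T :=
  aeval fun i => TrivSqZeroExt.inl (π (X i)) + TrivSqZeroExt.inr (v i)

theorem fst_dualHom (π : MvPolynomial σ A →ₐ[A] T) (v : σ → T) (f : MvPolynomial σ A) :
    TrivSqZeroExt.fst (dualHom π v f) = π f := by
  have : (TrivSqZeroExt.fstHom A T T).comp (dualHom π v) = π := by
    refine MvPolynomial.algHom_ext fun i => ?_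
    simp [dualHom]
  exact congrArg (fun e : MvPolynomial σ A →ₐ[A] T => e f) this

/-- A derivation is a section of T[ε] → T. A tangent vector gives a map from polynomials to T[ε] in
which Q is invertible, since its image modulo ε is; the mapping property extends it, and rigidity on
polynomials makes it a section. -/
theorem IsPres.exists_derivation (h : IsPres Q J π) (v : σ → T)
    (hJ : J ≤ RingHom.ker (dualHom π v)) :
    ∃ D : Derivation A T T, ∀ i, D (π (X i)) = v i := by
  obtain ⟨Ψ, hΨ⟩ := h.lift (DualNumber T) (dualHom π v) (by
    rw [TrivSqZeroExt.isUnit_iff_isUnit_fst, fst_dualHom]; exact h.isUnit) fun f hf => hJ hf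
  have hfst : ∀ x, TrivSqZeroExt.fst (Ψ x) = x := by
    have := h.hom_ext (f := ((TrivSqZeroExt.fstHom A T T).comp Ψ).toRingHom)
      (g := RingHom.id T) fun r => by
        change TrivSqZeroExt.fst (Ψ (π r)) = π r
        rw [hΨ, fst_dualHom]
    exact fun x => congrArg (fun e : T →+* T => e x) this
  refine ⟨Derivation.mk' ((TrivSqZeroExt.sndHom T T).restrictScalars A ∘ₗ Ψ.toLinearMap)
    fun x y => ?_, fun i => ?_⟩
  · change TrivSqZeroExt.snd (Ψ (x * y)) = x • TrivSqZeroExt.snd (Ψ y) +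
      y • TrivSqZeroExt.snd (Ψ x)
    rw [map_mul, TrivSqZeroExt.snd_mul, hfst, hfst]
    simp [mul_comm]
  · change TrivSqZeroExt.snd (Ψ (π (X i))) = v i
    rw [hΨ]
    simp [dualHom]

theorem IsPres.span_differentials (h : IsPres Q J π) :
    Submodule.span T (Set.range fun i => D A T (π (X i))) = ⊤ := by
  rw [eq_top_iff, ← KaehlerDifferential.span_range_derivation, Submodule.span_le]
  set S := Submodule.span T (Set.range fun i => D A T (π (X i)))
  have hpoly : ∀ f, D A T (π f) ∈ S := by
    intro f
    induction f using MvPolynomial.induction_on with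
    | C a =>
      rw [← MvPolynomial.algebraMap_eq, AlgHom.commutes, Derivation.map_algebraMap]
      exact S.zero_mem
    | add f g hf hg => rw [map_add, map_add]; exact S.add_mem hf hg
    | mul_X f i hf =>
      rw [map_mul, Derivation.leibniz]
      exact S.add_mem (S.smul_mem _ (Submodule.subset_span ⟨i, rfl⟩)) (S.smul_mem _ hf)
  rintro _ ⟨x, rfl⟩
  obtain ⟨f, m, hf⟩ := h.gen x
  -- Quotient rule: applying d to xQᵐ = f puts Qᵐ dx in the span, and Qᵐ is a unit.
  obtain ⟨u, hu⟩ := h.isUnit.pow m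
  have h1 := hpoly f
  rw [← hf, Derivation.leibniz, ← map_pow] at h1
  have h2 := (S.add_mem_iff_right (S.smul_mem x (hpoly (Q ^ m)))).1 h1
  rw [map_pow, ← hu] at h2
  have := S.smul_mem ((u⁻¹ : Tˣ) : T) h2
  rwa [smul_smul, u.inv_mul, one_smul] at this

/-- Pairing a linear relation with the vector fields `E i` isolates its coefficients up to units. -/
theorem linearIndependent_differentials {ι : Type*} [Finite ι] (t : ι → T)
    (E : ι → Derivation A T T) (h0 : ∀ i j, i ≠ j → E i (t j) = 0)
    (h1 : ∀ i, IsUnit (E i (t i))) : LinearIndependent T fun i => D A T (t i) := by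
  have := Fintype.ofFinite ι
  rw [Fintype.linearIndependent_iff]
  intro g hg i
  have := congrArg (E i).liftKaehlerDifferential hg
  rw [map_sum, map_zero, Finset.sum_eq_single i] at this
  · rw [map_smul, Derivation.liftKaehlerDifferential_comp_D, smul_eq_mul] at this
    exact (h1 i).mul_left_eq_zero.1 this
  · intro j _ hj
    rw [map_smul, Derivation.liftKaehlerDifferential_comp_D, h0 i j hj.symm, smul_zero]
  · simp

end Derivations

/-! ### Bases of `1`-forms on a formal scheme -/

section Basis

variable {p : ℕ} {A : Type*} [CommRing A] {C : Type*} [CommRing C] [Algebra A C]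

theorem omegaTrans_smul_D (n : ℕ) (f : Lvl p C (n + 1)) (t : C) :
    omegaTrans p A C n (f • D A (Lvl p C (n + 1)) (Ideal.Quotient.mk _ t)) =
      lvlMap p C n f • D A (Lvl p C n) (Ideal.Quotient.mk _ t) := by
  rw [LinearMap.map_smulₛₗ]
  congr 1
  exact kaehlerPullback_D (RingHom.id A) (lvlMap p C n) (lvlMap_algebraMap p A C n) _

variable [IsAdicComplete (Ideal.span {(p : C)}) C]

/-- Functions whose differentials form a basis of the differentials at each infinitesimal level
have differentials that form a basis of the `1`-forms on the formal scheme. -/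
theorem exists_basis_omega1 {ι : Type*} [Finite ι] (t : ι → C)
    (hli : ∀ n, LinearIndependent (Lvl p C n)
      fun i => D A (Lvl p C n) (Ideal.Quotient.mk _ (t i)))
    (hsp : ∀ n, Submodule.span (Lvl p C n)
      (Set.range fun i => D A (Lvl p C n) (Ideal.Quotient.mk _ (t i))) = ⊤) :
    ∃ b : Module.Basis ι C (Omega1 p A C), ∀ i, b i = dform p A C (t i) := by
  have := Fintype.ofFinite ι
  have hval : ∀ (g : ι → C) (n : ℕ), (∑ i, g i • dform p A C (t i)).1 n =
      ∑ i, (Ideal.Quotient.mk _ (g i) : Lvl p C n) •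
        D A (Lvl p C n) (Ideal.Quotient.mk _ (t i)) := by
    intro g n
    rw [AddSubmonoidClass.coe_finsetSum, Finset.sum_apply]
    refine Finset.sum_congr rfl fun i _ => ?_
    exact pi_smul_lvl _ _ _
  have h1 : LinearIndependent C fun i => dform p A C (t i) := by
    rw [Fintype.linearIndependent_iff]
    intro g hg i
    refine eq_zero_of_forall_pow_dvd (p := p) fun n => ?_
    rw [← lvl_mk_eq_zero]
    refine Fintype.linearIndependent_iff.1 (hli n) (fun i => Ideal.Quotient.mk _ (g i)) ?_ i
    rw [← hval, hg]
    rfl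
  have h2 : ⊤ ≤ Submodule.span C (Set.range fun i => dform p A C (t i)) := by
    intro w _
    have hw : ∀ n, ∃ f : ι → Lvl p C n,
        ∑ i, f i • D A (Lvl p C n) (Ideal.Quotient.mk _ (t i)) = w.1 n := fun n =>
      (Submodule.mem_span_range_iff_exists_fun (Lvl p C n)).1 (by rw [hsp n]; trivial)
    choose f hf using hw
    -- Coordinates are unique at each level, so those at level n + 1 reduce to those at level n;
    -- completeness then glues them into elements of C.
    have hcomp : ∀ n i, lvlMap p C n (f (n + 1) i) = f n i := by
      intro n i
      have h3 := w.2 n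
      rw [← hf (n + 1), ← hf n, map_sum] at h3
      simp only [omegaTrans_smul_D] at h3
      rw [← sub_eq_zero, ← Finset.sum_sub_distrib] at h3
      simp only [← sub_smul] at h3
      exact sub_eq_zero.1 (Fintype.linearIndependent_iff.1 (hli n) _ h3 i)
    have hlim : ∀ i, ∃ c : C, ∀ n, Ideal.Quotient.mk _ c = f n i := fun i =>
      exists_of_lvl_compatible (fun n => f n i) fun n => hcomp n i
    choose g hg using hlim
    rw [Submodule.mem_span_range_iff_exists_fun]
    refine ⟨g, Subtype.ext (funext fun n => ?_)⟩
    rw [hval, ← hf n]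
    exact Finset.sum_congr rfl fun i _ => by rw [hg]
  exact ⟨Module.Basis.mk h1 h2, fun i => Module.Basis.mk_apply _ _ _⟩

end Basis

theorem nsmul_eq_zero_of_basis {p : ℕ} {C M ι : Type*} [CommRing C] [AddCommGroup M] [Module C M]
    (b : Module.Basis ι C M) (h : ∀ x : C, (p : C) * x = 0 → x = 0) {m : M} (hm : p • m = 0) :
    m = 0 := by
  rw [← b.repr.map_eq_zero_iff]
  ext i
  refine h _ ?_
  have := congrArg (fun w => b.repr w i) hm
  simpa using this

theorem isQuot_pow_of_basis {p : ℕ} {C M ι : Type*} [CommRing C] [AddCommGroup M] [Module C M]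
    (b : Module.Basis ι C M) (h : ∀ x : C, (p : C) * x = 0 → x = 0) (n : ℕ) (y : M) :
    IsQuot (p ^ n) ((p ^ n) • y) y := by
  refine ⟨rfl, fun y' hy => ?_⟩
  rw [← sub_eq_zero, ← smul_sub] at hy
  rw [← sub_eq_zero]
  generalize y' - y = z at hy
  induction n with
  | zero => simpa using hy
  | succ n ih =>
    rw [pow_succ', mul_smul] at hy
    exact ih (nsmul_eq_zero_of_basis b h hy)

/-! ### Vector fields and differentials on X, the spheres and the curves -/

section Geometry

variable (p : ℕ) {A : Type u} [CommRing A] (a : Fin 3 → A)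
  {T : Type u} [CommRing T] [Algebra A T] (π : MvPolynomial (Fin 3) A →ₐ[A] T)

theorem map_H1 : π (H1 a) = algebraMap A T (a 0) * π (X 0) ^ 2 +
    algebraMap A T (a 1) * π (X 1) ^ 2 + algebraMap A T (a 2) * π (X 2) ^ 2 := by
  simp only [H1, Fin.sum_univ_three, map_add, map_mul, map_pow]
  simp only [← MvPolynomial.algebraMap_eq, AlgHom.commutes]

theorem map_H2 : π (H2 A) = π (X 0) ^ 2 + π (X 1) ^ 2 + π (X 2) ^ 2 := by
  simp only [H2, Fin.sum_univ_three, map_add, map_pow]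

/-- The function `y = (a₁ - a₂) x₁ x₂`, with `ω = dx₃ / y`. -/
def yfun : MvPolynomial (Fin 3) A := C (a 0 - a 1) * X 0 * X 1

theorem map_yfun : π (yfun a) = algebraMap A T (a 0 - a 1) * π (X 0) * π (X 1) := by
  rw [yfun, map_mul, map_mul, ← MvPolynomial.algebraMap_eq, AlgHom.commutes]

/-- The components of the Euler vector field. -/
def eulerField : Fin 3 → MvPolynomial (Fin 3) A :=
  ![C (a 1 - a 2) * X 1 * X 2, C (a 2 - a 0) * X 2 * X 0, yfun a]

/-- The Hasse invariant at the prime integrals, `A_{p-1}(H₁, H₂)`. -/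
def hasseH : MvPolynomial (Fin 3) A := aeval ![H1 a, H2 A] (hasse p a)

variable {p a π}

theorem isUnit_of_polyQ (h : IsUnit (π (polyQ p a))) : IsUnit (π (X 0)) ∧ IsUnit (π (X 1)) ∧
    IsUnit (π (aeval ![H1 a, H2 A] (discN a))) ∧ IsUnit (π (hasseH p a)) := by
  simp only [polyQ, map_mul, IsUnit.mul_iff] at h
  exact ⟨h.1.1.1, h.1.1.2, h.1.2, h.2⟩

theorem isUnit_yfun (h : IsUnit (π (polyQ p a))) (ha : IsUnit (a 0 - a 1)) :
    IsUnit (π (yfun a)) := by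
  obtain ⟨h0, h1, -, -⟩ := isUnit_of_polyQ h
  rw [map_yfun]
  exact ((ha.map _).mul h0).mul h1

theorem snd_dualHom_H1 (v : Fin 3 → T) : TrivSqZeroExt.snd (dualHom π v (H1 a)) =
    2 * (algebraMap A T (a 0) * π (X 0) * v 0 + algebraMap A T (a 1) * π (X 1) * v 1 +
      algebraMap A T (a 2) * π (X 2) * v 2) := by
  simp only [H1, Fin.sum_univ_three, map_add, map_mul, map_pow]
  simp only [← MvPolynomial.algebraMap_eq, AlgHom.commutes, dualHom, aeval_X, pow_two,
    TrivSqZeroExt.algebraMap_eq_inl', TrivSqZeroExt.snd_add, TrivSqZeroExt.snd_mul,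
    TrivSqZeroExt.fst_add, TrivSqZeroExt.fst_mul, TrivSqZeroExt.fst_inl, TrivSqZeroExt.snd_inl,
    TrivSqZeroExt.fst_inr, TrivSqZeroExt.snd_inr, smul_eq_mul, MulOpposite.smul_eq_mul_unop,
    MulOpposite.unop_op]
  ring

theorem snd_dualHom_H2 (v : Fin 3 → T) : TrivSqZeroExt.snd (dualHom π v (H2 A)) =
    2 * (π (X 0) * v 0 + π (X 1) * v 1 + π (X 2) * v 2) := by
  simp only [H2, Fin.sum_univ_three, map_add, map_pow]
  simp only [dualHom, aeval_X, pow_two,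
    TrivSqZeroExt.snd_add, TrivSqZeroExt.snd_mul,
    TrivSqZeroExt.fst_add, TrivSqZeroExt.fst_inl, TrivSqZeroExt.snd_inl,
    TrivSqZeroExt.fst_inr, TrivSqZeroExt.snd_inr, smul_eq_mul, MulOpposite.smul_eq_mul_unop,
    MulOpposite.unop_op]
  ring

theorem dualHom_C {σ : Type} {π : MvPolynomial σ A →ₐ[A] T} (v : σ → T) (c : A) :
    dualHom π v (C c) = TrivSqZeroExt.inl (algebraMap A T c) := by
  rw [← MvPolynomial.algebraMap_eq, AlgHom.commutes, TrivSqZeroExt.algebraMap_eq_inl']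

theorem dualHom_sub_C_eq_zero {v : Fin 3 → T} {f : MvPolynomial (Fin 3) A} {c : A}
    (h1 : π (f - C c) = 0) (h2 : TrivSqZeroExt.snd (dualHom π v f) = 0) :
    dualHom π v (f - C c) = 0 := by
  refine TrivSqZeroExt.ext ?_ ?_
  · rw [fst_dualHom, h1, TrivSqZeroExt.fst_zero]
  · rw [map_sub, TrivSqZeroExt.snd_sub, h2, dualHom_C, TrivSqZeroExt.snd_inl,
      TrivSqZeroExt.snd_zero, sub_zero]

theorem dualHom_natCast_pow {σ : Type} {π : MvPolynomial σ A →ₐ[A] T} (v : σ → T) {n : ℕ}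
    (h : π ((p : MvPolynomial σ A) ^ n) = 0) :
    dualHom π v ((p : MvPolynomial σ A) ^ n) = 0 := by
  rw [map_pow, map_natCast] at h ⊢
  have : (p : DualNumber T) ^ n = TrivSqZeroExt.inlHom T T ((p : T) ^ n) := by
    rw [map_pow, map_natCast]
  rw [this, h, map_zero]

variable {J : Ideal (MvPolynomial (Fin 3) A)} {n : ℕ}

/-- The Euler vector field is tangent to the level sets of `H₁` and `H₂`. -/
theorem exists_euler_field
    (h : IsPres (polyQ p a) (J ⊔ Ideal.span {(p : MvPolynomial (Fin 3) A) ^ n}) π)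
    (hJ : J = ⊥ ∨ (∃ c₂, J = idealS c₂) ∨ ∃ c₁ c₂, J = idealE a c₁ c₂) :
    ∃ D : Derivation A T T,
      (∀ i, D (π (X i)) = π (eulerField a i)) ∧
      D (π (H1 a)) = 0 ∧ D (π (H2 A)) = 0 := by
  have hC : ∀ c : A, π (C c) = algebraMap A T c := π.commutes
  have e1 : TrivSqZeroExt.snd (dualHom π (fun i => π (eulerField a i)) (H1 a)) = 0 := by
    rw [snd_dualHom_H1]
    simp only [eulerField, Matrix.cons_val, yfun, map_mul, hC, map_sub]
    ring
  have e2 : TrivSqZeroExt.snd (dualHom π (fun i => π (eulerField a i)) (H2 A)) = 0 := by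
    rw [snd_dualHom_H2]
    simp only [eulerField, Matrix.cons_val, yfun, map_mul, hC, map_sub]
    ring
  obtain ⟨D, hD⟩ := h.exists_derivation (fun i => π (eulerField a i)) (by
    refine sup_le ?_ ?_
    · have hv : ∀ f ∈ J, π f = 0 := fun f hf => h.vanish f (Ideal.mem_sup_left hf)
      obtain rfl | ⟨c₂, rfl⟩ | ⟨c₁, c₂, rfl⟩ := hJ
      · exact bot_le
      · rw [idealS, Ideal.span_singleton_le_iff_mem]
        exact dualHom_sub_C_eq_zero (hv _ (Ideal.subset_span rfl)) e2
      · rw [idealE, Ideal.span_le]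
        rintro f (rfl | rfl)
        · exact dualHom_sub_C_eq_zero (hv _ (Ideal.subset_span (by simp))) e1
        · exact dualHom_sub_C_eq_zero (hv _ (Ideal.subset_span (by simp))) e2
    · rw [Ideal.span_singleton_le_iff_mem]
      exact dualHom_natCast_pow _ (h.vanish _ (Ideal.mem_sup_right
        (Ideal.mem_span_singleton_self _))))
  refine ⟨D, hD, ?_, ?_⟩
  · rw [map_H1]
    simp only [map_add, Derivation.leibniz, Derivation.leibniz_pow, Derivation.map_algebraMap, hD,
      smul_eq_mul]
    simp only [eulerField, Matrix.cons_val, yfun, map_mul, hC, map_sub]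
    ring
  · rw [map_H2]
    simp only [map_add, Derivation.leibniz_pow, hD, smul_eq_mul]
    simp only [eulerField, Matrix.cons_val, yfun, map_mul, hC, map_sub]
    ring

/-- The rotation about the third axis is tangent to the spheres. -/
theorem exists_rotation_field {c₂ : A}
    (h : IsPres (polyQ p a) (idealS c₂ ⊔ Ideal.span {(p : MvPolynomial (Fin 3) A) ^ n}) π) :
    ∃ D : Derivation A T T, D (π (H1 a)) = - 2 * π (yfun a) ∧ D (π (X 2)) = 0 := by
  obtain ⟨D, hD⟩ := h.exists_derivation ![-π (X 1), π (X 0), 0] (by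
    refine sup_le ?_ ?_
    · rw [idealS, Ideal.span_singleton_le_iff_mem]
      refine dualHom_sub_C_eq_zero (h.vanish _ (Ideal.mem_sup_left (Ideal.subset_span rfl))) ?_
      rw [snd_dualHom_H2]
      simp only [Matrix.cons_val]
      ring
    · rw [Ideal.span_singleton_le_iff_mem]
      exact dualHom_natCast_pow _ (h.vanish _ (Ideal.mem_sup_right
        (Ideal.mem_span_singleton_self _))))
  refine ⟨D, ?_, hD 2⟩
  rw [map_H1, map_yfun]
  simp only [map_add, Derivation.leibniz, Derivation.leibniz_pow, Derivation.map_algebraMap, hD,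
    smul_eq_mul, Matrix.cons_val, map_sub]
  ring

/-- Compatibility of derivations with equal values on the coordinates. -/
theorem IsPres.derivation_comp {σ : Type} {Q : MvPolynomial σ A} {J : Ideal (MvPolynomial σ A)}
    {T T' : Type u} [CommRing T] [Algebra A T] [CommRing T'] [Algebra A T']
    {π : MvPolynomial σ A →ₐ[A] T} (h : IsPres Q J π)
    {π' : MvPolynomial σ A →ₐ[A] T'} (r : T →+* T') (hr : ∀ f, r (π f) = π' f)
    {w : σ → MvPolynomial σ A} {D : Derivation A T T} {D' : Derivation A T' T'}
    (hD : ∀ i, D (π (X i)) = π (w i)) (hD' : ∀ i, D' (π' (X i)) = π' (w i)) (x : T) :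
    r (D x) = D' (r x) := by
  have hpoly : ∀ f, r (D (π f)) = D' (π' f) := by
    intro f
    induction f using MvPolynomial.induction_on with
    | C c =>
      rw [← MvPolynomial.algebraMap_eq, AlgHom.commutes, AlgHom.commutes,
        Derivation.map_algebraMap, Derivation.map_algebraMap, map_zero]
    | add f g hf hg => simp only [map_add, hf, hg]
    | mul_X f i hf =>
      simp only [map_mul, Derivation.leibniz, map_add, smul_eq_mul, hf, hD, hD', hr]
  obtain ⟨f, m, hf⟩ := h.gen x
  have h1 := hpoly f
  have h2 := hpoly (Q ^ m)
  rw [map_pow] at h2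
  have h3 := hr f
  rw [← hf, map_mul, map_pow, hr] at h3
  rw [← hf, ← h3, Derivation.leibniz, Derivation.leibniz] at h1
  simp only [map_add, smul_eq_mul, map_mul, h2, map_pow, hr] at h1
  have hu : IsUnit (π' Q ^ m) := by rw [← hr]; exact (h.isUnit.map r).pow m
  refine hu.mul_left_cancel ?_
  exact add_left_cancel h1

/-- The combination H₁ - a₂H₂ eliminates x₂, so modulo dx₃ its differential is 2(a₁ - a₂)x₁dx₁ with
unit coefficient; dx₂ then comes from dH₂. -/
theorem span_differentials_eq_top (h : IsPres (polyQ p a) J π) (ha : IsUnit (a 0 - a 1))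
    (h2 : IsUnit (2 : T)) (S : Submodule T Ω[T⁄A]) (e1 : D A T (π (H1 a)) ∈ S)
    (e2 : D A T (π (H2 A)) ∈ S) (e3 : D A T (π (X 2)) ∈ S) : S = ⊤ := by
  obtain ⟨u0, u1, -, -⟩ := isUnit_of_polyQ h.isUnit
  have cancel : ∀ {c : T} {m : Ω[T⁄A]}, IsUnit c → c • m ∈ S → m ∈ S := by
    rintro _ m ⟨c, rfl⟩ hm
    have := S.smul_mem ((c⁻¹ : Tˣ) : T) hm
    rwa [smul_smul, c.inv_mul, one_smul] at this
  have E1 : D A T (π (H1 a)) = (2 * (algebraMap A T (a 0) * π (X 0))) • D A T (π (X 0)) +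
      (2 * (algebraMap A T (a 1) * π (X 1))) • D A T (π (X 1)) +
      (2 * (algebraMap A T (a 2) * π (X 2))) • D A T (π (X 2)) := by
    rw [map_H1]
    simp only [map_add, Derivation.leibniz, Derivation.leibniz_pow, Derivation.map_algebraMap]
    module
  have E2 : D A T (π (H2 A)) = (2 * π (X 0)) • D A T (π (X 0)) +
      (2 * π (X 1)) • D A T (π (X 1)) + (2 * π (X 2)) • D A T (π (X 2)) := by
    rw [map_H2]
    simp only [map_add, Derivation.leibniz_pow]
    module
  have ha' : IsUnit (algebraMap A T (a 0 - a 1)) := ha.map _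
  have m0 : D A T (π (X 0)) ∈ S := by
    refine cancel ((h2.mul ha').mul u0) ?_
    have : (2 * algebraMap A T (a 0 - a 1) * π (X 0)) • D A T (π (X 0)) =
        D A T (π (H1 a)) - algebraMap A T (a 1) • D A T (π (H2 A)) -
        (2 * (algebraMap A T (a 2) - algebraMap A T (a 1)) * π (X 2)) • D A T (π (X 2)) := by
      rw [E1, E2, map_sub]
      module
    rw [this]
    exact S.sub_mem (S.sub_mem e1 (S.smul_mem _ e2)) (S.smul_mem _ e3)
  have m1 : D A T (π (X 1)) ∈ S := by
    refine cancel (h2.mul u1) ?_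
    have : (2 * π (X 1)) • D A T (π (X 1)) = D A T (π (H2 A)) - (2 * π (X 0)) • D A T (π (X 0)) -
        (2 * π (X 2)) • D A T (π (X 2)) := by
      rw [E2]
      module
    rw [this]
    exact S.sub_mem (S.sub_mem e2 (S.smul_mem _ m0)) (S.smul_mem _ e3)
  rw [eq_top_iff, ← h.span_differentials, Submodule.span_le]
  rintro _ ⟨i, rfl⟩
  fin_cases i
  · exact m0
  · exact m1
  · exact e3

end Geometry

/-! ## Frobenius pull-back of invariant forms -/

section FormCalculus

variable {p : ℕ} {A : Type*} [CommRing A] {δA : PDerivation p A}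
  {C : Type*} [CommRing C] [Algebra A C]

variable (p A C) in
/-- The differential as a derivation. -/
def dDerivation : Derivation ℤ C (Omega1 p A C) :=
  Derivation.mk' (AddMonoidHom.toIntLinearMap
    { toFun := dform p A C
      map_zero' := by simpa using dform_algebraMap (p := p) (A := A) (C := C) 0
      map_add' := dform_add p A C }) (dform_mul p A C)

theorem dDerivation_apply (c : C) : dDerivation p A C c = dform p A C c := rfl

theorem dform_natCast_mul (n : ℕ) (c : C) : dform p A C (n * c) = n • dform p A C c := by
  rw [← nsmul_eq_mul, ← dDerivation_apply, map_nsmul]; rfl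

theorem dform_pow (c : C) (n : ℕ) :
    dform p A C (c ^ n) = n • (c ^ (n - 1) • dform p A C c) :=
  (dDerivation p A C).leibniz_pow c n

/-- The function `⟨D, w⟩` modulo `p` for a `1`-form `w` and a vector field `D` modulo `p`. -/
def contract (D : Derivation A (Lvl p C 1) (Lvl p C 1)) : Omega1 p A C →+ Lvl p C 1 where
  toFun w := D.liftKaehlerDifferential (w.1 1)
  map_zero' := map_zero _
  map_add' x y := map_add D.liftKaehlerDifferential (x.1 1) (y.1 1)

theorem contract_smul (D : Derivation A (Lvl p C 1) (Lvl p C 1)) (c : C) (w : Omega1 p A C) :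
    contract D (c • w) = Ideal.Quotient.mk _ c * contract D w := by
  change D.liftKaehlerDifferential ((c • w.1) 1) = _
  rw [pi_smul_lvl, map_smul]; rfl

theorem contract_dform (D : Derivation A (Lvl p C 1) (Lvl p C 1)) (c : C) :
    contract D (dform p A C c) = D (Ideal.Quotient.mk _ c) :=
  D.liftKaehlerDifferential_comp_D _

theorem contract_nsmul (D : Derivation A (Lvl p C 1) (Lvl p C 1)) (w : Omega1 p A C) :
    contract D (p • w) = 0 := by
  have : (p : Lvl p C 1) = 0 := by simpa using lvl_natCast_pow (p := p) (C := C) 1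
  rw [map_nsmul, nsmul_eq_mul, this, zero_mul]

theorem lvl_mk_frob (δ : ArithFlow δA C) (c : C) :
    (Ideal.Quotient.mk _ (δ.frob c) : Lvl p C 1) = (Ideal.Quotient.mk _ c) ^ p := by
  rw [δ.frob_apply, map_add, map_pow, add_eq_left, lvl_mk_eq_zero]
  exact ⟨δ.toFun c, by rw [pow_one]⟩

theorem map_ringInverse {R S : Type*} [CommRing R] [CommRing S] (f : R →+* S) {r : R}
    (hr : IsUnit r) : f (Ring.inverse r) = Ring.inverse (f r) := by
  refine (Ring.eq_mul_inverse_iff_mul_eq _ 1 _ (hr.map f)).2 ?_ |>.trans (one_mul _)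
  rw [← map_mul, Ring.inverse_mul_cancel _ hr, map_one]

/-- The form `(φ^* / p) ω` for `ω = dx / y`. -/
def pullbackDiv (δ : ArithFlow δA C) (x y : C) : Omega1 p A C :=
  Ring.inverse (δ.frob y) • (x ^ (p - 1) • dform p A C x + dform p A C (δ x))

/-- Differentiating φ(x) = x^p + pδx produces the factor p, which is why division by p is possible.
-/
theorem nsmul_pullbackDiv (δ : ArithFlow δA C) (x : C) {y : C} (hy : IsUnit y) :
    p • pullbackDiv δ x y = δ.pullback1 (Ring.inverse y • dform p A C x) := by
  have h := map_ringInverse δ.frob hy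
  rw [LinearMap.map_smulₛₗ, δ.pullback1_dform, h, δ.frob_apply x, dform_add, dform_natCast_mul,
    dform_pow, pullbackDiv, smul_comm, smul_add]

/-- The obstruction modulo `p` to `(φ^* / p) ω ≡ α⁻¹ ω`. -/
def obstruction (p : ℕ) {T : Type*} [CommRing T] (D : T → T) (x y α f : T) : T :=
  α * (x ^ (p - 1) * y + D f) - y ^ p

/-- Since φ(y) ≡ y^p modulo p, the pairing with D is (x^{p-1}y + D(δx))/y^p - 1/α; multiplying by
αy^p clears the denominators. -/
theorem contract_pullbackDiv_sub (δ : ArithFlow δA C) {x y α : C} (hy : IsUnit y)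
    (hα : IsUnit α) (D : Derivation A (Lvl p C 1) (Lvl p C 1))
    (hD : D (Ideal.Quotient.mk _ x) = Ideal.Quotient.mk _ y) :
    contract D (pullbackDiv δ x y - Ring.inverse α • (Ring.inverse y • dform p A C x)) *
      Ideal.Quotient.mk _ (α * y ^ p) = obstruction p D (Ideal.Quotient.mk _ x)
        (Ideal.Quotient.mk _ y) (Ideal.Quotient.mk _ α) (Ideal.Quotient.mk _ (δ x)) := by
  have h1 : (Ideal.Quotient.mk _ (Ring.inverse (δ.frob y)) : Lvl p C 1) *
      (Ideal.Quotient.mk _ y) ^ p = 1 := by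
    rw [← lvl_mk_frob δ, ← map_mul, Ring.inverse_mul_cancel _ (hy.map δ.frob), map_one]
  have h2 : (Ideal.Quotient.mk _ (Ring.inverse α) : Lvl p C 1) * Ideal.Quotient.mk _ α = 1 := by
    rw [← map_mul, Ring.inverse_mul_cancel _ hα, map_one]
  have h3 : (Ideal.Quotient.mk _ (Ring.inverse y) : Lvl p C 1) * Ideal.Quotient.mk _ y = 1 := by
    rw [← map_mul, Ring.inverse_mul_cancel _ hy, map_one]
  simp only [pullbackDiv, map_sub, map_add, contract_smul, contract_dform, hD, obstruction,
    map_mul, map_pow]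
  generalize (Ideal.Quotient.mk _ (Ring.inverse (δ.frob y)) : Lvl p C 1) = i1 at *
  generalize (Ideal.Quotient.mk _ (Ring.inverse α) : Lvl p C 1) = i2 at *
  generalize (Ideal.Quotient.mk _ (Ring.inverse y) : Lvl p C 1) = i3 at *
  generalize (Ideal.Quotient.mk _ y : Lvl p C 1) = y' at *
  generalize (Ideal.Quotient.mk _ α : Lvl p C 1) = α' at *
  linear_combination ((Ideal.Quotient.mk (Ideal.span {(p : C) ^ 1})) x ^ (p - 1) * y' +
      D ((Ideal.Quotient.mk (Ideal.span {(p : C) ^ 1})) (δ x))) * α' * h1 -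
    i3 * y' * y' ^ p * h2 - y' ^ p * h3

theorem nsmul_of_lvl_one {g : C} (h : (Ideal.Quotient.mk _ g : Lvl p C 1) = 0) :
    ∃ d, g = (p : C) * d := by
  obtain ⟨d, hd⟩ := lvl_mk_eq_zero.1 h
  exact ⟨d, by rw [hd, pow_one]⟩

/-- A form `ω = dx / y` on a curve is an eigenform of `φ^* / p` modulo `p` if and only if the
obstruction vanishes. -/
theorem scales1_iff (htf : ∀ c : C, (p : C) * c = 0 → c = 0) (δ : ArithFlow δA C) {x y α : C}
    (hy : IsUnit y) (hα : IsUnit α) (D : Derivation A (Lvl p C 1) (Lvl p C 1))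
    (hD : D (Ideal.Quotient.mk _ x) = Ideal.Quotient.mk _ y) {ι : Type*} [Unique ι]
    (b : Module.Basis ι C (Omega1 p A C)) (hb : ∀ i, b i = dform p A C x) :
    δ.Scales1 (Ring.inverse y • dform p A C x) (Ring.inverse α) ↔
      obstruction p D (Ideal.Quotient.mk _ x) (Ideal.Quotient.mk _ y) (Ideal.Quotient.mk _ α)
        (Ideal.Quotient.mk _ (δ x)) = 0 := by
  rw [← contract_pullbackDiv_sub δ hy hα D hD]
  have hu : IsUnit (Ideal.Quotient.mk _ (α * y ^ p) : Lvl p C 1) := (hα.mul (hy.pow p)).map _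
  rw [hu.mul_left_eq_zero]
  constructor
  · rintro ⟨τ, ⟨-, hτ⟩, z, hz⟩
    rw [hτ _ (nsmul_pullbackDiv δ x hy), hz, contract_nsmul]
  · intro h
    refine ⟨pullbackDiv δ x y, ?_, ?_⟩
    · rw [← nsmul_pullbackDiv δ x hy]
      simpa only [pow_one] using isQuot_pow_of_basis b htf 1 (pullbackDiv δ x y)
    · unfold CongrMod
      -- In rank one w = g dx, whose pairing with D is gy. As y is a unit, a vanishing pairing
      -- forces p to divide g.
      set w := pullbackDiv δ x y - Ring.inverse α • (Ring.inverse y • dform p A C x)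
      have hw := b.sum_repr w
      rw [Fintype.sum_unique, hb] at hw
      rw [← hw, contract_smul, contract_dform, hD,
        (hy.map (Ideal.Quotient.mk _)).mul_left_eq_zero] at h
      obtain ⟨d, hd⟩ := nsmul_of_lvl_one h
      refine ⟨d • dform p A C x, ?_⟩
      rw [← hw, hd, mul_smul, Nat.cast_smul_eq_nsmul]

theorem wedge_smul_left (c : C) (v w : Omega1 p A C) :
    wedge p A C (c • v) w = c • wedge p A C v w := by
  unfold wedge
  rw [ιMulti_two_swap, ιMulti_two_smul_right, ιMulti_two_swap w v, smul_neg, neg_neg]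

theorem wedge_smul_right (c : C) (v w : Omega1 p A C) :
    wedge p A C v (c • w) = c • wedge p A C v w :=
  ιMulti_two_smul_right c v w

theorem wedge_self (u : Omega1 p A C) : wedge p A C u u = 0 :=
  ιMulti_two_self u

theorem wedge_add_right (u v w : Omega1 p A C) :
    wedge p A C u (v + w) = wedge p A C u v + wedge p A C u w :=
  ιMulti_two_add_right u v w

theorem wedge_sub_right (u v w : Omega1 p A C) :
    wedge p A C u (v - w) = wedge p A C u v - wedge p A C u w := by
  have := wedge_add_right u (v - w) w
  rw [sub_add_cancel] at this
  exact eq_sub_of_add_eq this.symm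

theorem wedge_nsmul_left (n : ℕ) (v w : Omega1 p A C) :
    wedge p A C (n • v) w = n • wedge p A C v w := by
  rw [← Nat.cast_smul_eq_nsmul C, wedge_smul_left, Nat.cast_smul_eq_nsmul]

theorem wedge_nsmul_right (n : ℕ) (v w : Omega1 p A C) :
    wedge p A C v (n • w) = n • wedge p A C v w := by
  rw [← Nat.cast_smul_eq_nsmul C, wedge_smul_right, Nat.cast_smul_eq_nsmul]

theorem congrMod_of_sub_eq {M : Type*} [AddCommGroup M] [Module C M] {c k r d : C} {u v z : M}
    (h : u - r • v = ((p : C) * d) • z) : CongrMod p ((c * k) • u) ((k * r) • c • v) := by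
  refine ⟨(c * k * d) • z, ?_⟩
  have : (c * k) • u - (k * r) • c • v = (c * k) • (u - r • v) := by module
  rw [this, h, ← Nat.cast_smul_eq_nsmul C, smul_smul, smul_smul]
  congr 1
  ring

/-- On a surface with a prime integral `h`, the `2`-form `η = c dh ∧ ω`, `c` a constant, is
multiplied by `h^{p-1} / α` by `φ^* / p²`, modulo `p`, if the obstruction vanishes. -/
theorem scales2_of_obstruction (htf : ∀ c : C, (p : C) * c = 0 → c = 0) (δ : ArithFlow δA C)
    {x y α h c : C} (hy : IsUnit y) (hα : IsUnit α) (hδ : δ h = 0) (hc : δ.frob c = c)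
    (D : Derivation A (Lvl p C 1) (Lvl p C 1))
    (hD : D (Ideal.Quotient.mk _ x) = Ideal.Quotient.mk _ y)
    (hDh : D (Ideal.Quotient.mk _ h) = 0)
    (b : Module.Basis (Fin 2) C (Omega1 p A C)) (hb0 : b 0 = dform p A C h)
    (hb1 : b 1 = dform p A C x)
    (hobs : obstruction p D (Ideal.Quotient.mk _ x) (Ideal.Quotient.mk _ y)
      (Ideal.Quotient.mk _ α) (Ideal.Quotient.mk _ (δ x)) = 0) :
    δ.Scales2 (c • wedge p A C (dform p A C h) (Ring.inverse y • dform p A C x))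
      (h ^ (p - 1) * Ring.inverse α) := by
  rw [← contract_pullbackDiv_sub δ hy hα D hD] at hobs
  have hu : IsUnit (Ideal.Quotient.mk _ (α * y ^ p) : Lvl p C 1) := (hα.mul (hy.pow p)).map _
  rw [hu.mul_left_eq_zero] at hobs
  set w := pullbackDiv δ x y - Ring.inverse α • (Ring.inverse y • dform p A C x) with hwdef
  have hw := b.sum_repr w
  rw [Fin.sum_univ_two, hb0, hb1] at hw
  rw [← hw, map_add, contract_smul, contract_smul, contract_dform, contract_dform, hD, hDh,
    mul_zero, zero_add, (hy.map (Ideal.Quotient.mk _)).mul_left_eq_zero] at hobs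
  obtain ⟨d, hd⟩ := nsmul_of_lvl_one hobs
  have hfrob : δ.frob h = h ^ p := by rw [δ.frob_apply, hδ, mul_zero, add_zero]
  -- One factor p comes from φ^*dh = p h^{p-1} dh, because φ(h) = h^p, and the other from φ^*ω.
  set τ : OmegaPow p A C 2 :=
    (c * h ^ (p - 1)) • wedge p A C (dform p A C h) (pullbackDiv δ x y) with hτ
  have hpull : δ.pullback 2 (c • wedge p A C (dform p A C h)
      (Ring.inverse y • dform p A C x)) = (p ^ 2) • τ := by
    rw [LinearMap.map_smulₛₗ, hc, δ.pullback_wedge, ← nsmul_pullbackDiv δ x hy,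
      δ.pullback1_dform, hfrob, dform_pow, wedge_nsmul_left, wedge_smul_left, wedge_nsmul_right,
      hτ, pow_two, mul_smul, mul_smul, ← smul_comm p, ← smul_comm p, ← smul_comm p]
  refine ⟨τ, ?_, ?_⟩
  · rw [hpull]
    exact isQuot_pow_of_basis (b.exteriorPower (n := 2)) htf 2 τ
  -- The vanishing pairing bounds only the dx-component of w; the uncontrolled dh-component
  -- disappears because dh ∧ dh = 0.
  · have hz : wedge p A C (dform p A C h) w =
        ((p : C) * d) • wedge p A C (dform p A C h) (dform p A C x) := by
      rw [← hw]
      rw [wedge_add_right, wedge_smul_right, wedge_smul_right, wedge_self, hd, smul_zero, zero_add]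
    have hs := wedge_smul_right (Ring.inverse α) (dform p A C h) (Ring.inverse y • dform p A C x)
    have hsub := wedge_sub_right (dform p A C h) (pullbackDiv δ x y)
      (Ring.inverse α • (Ring.inverse y • dform p A C x))
    replace hz := (hsub.symm.trans hz)
    exact congrMod_of_sub_eq (M := OmegaPow p A C 2) (c := c) (k := h ^ (p - 1)) (d := d)
      ((congrArg _ hs.symm).trans hz)

/-- The area form on a sphere is proportional to `dh ∧ ω` for a diagonal quadratic form `h`. -/
theorem areaForm_eq_wedge {a : Fin 3 → A} (x : Fin 3 → C) {h y c : C} {c₂ : A}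
    (u0 : IsUnit (x 0)) (hy : IsUnit y) (hc : 2 * c = -1)
    (hS : x 0 ^ 2 + x 1 ^ 2 + x 2 ^ 2 = algebraMap A C c₂)
    (hh : h = algebraMap A C (a 0) * x 0 ^ 2 + algebraMap A C (a 1) * x 1 ^ 2 +
      algebraMap A C (a 2) * x 2 ^ 2)
    (hyx : y = algebraMap A C (a 0 - a 1) * x 0 * x 1) :
    areaForm p A C x =
      c • wedge p A C (dform p A C h) (Ring.inverse y • dform p A C (x 2)) := by
  set d := dDerivation p A C
  have halg : ∀ r : A, d (algebraMap A C r) = 0 := dform_algebraMap p A C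
  have E2 : (2 * x 0) • d (x 0) + (2 * x 1) • d (x 1) + (2 * x 2) • d (x 2) = 0 := by
    have h := congrArg d hS
    rw [halg] at h
    simp only [map_add, Derivation.leibniz_pow] at h
    rw [← h]
    module
  -- Subtracting a₁ times the relation on the sphere removes dx₁ from dh. Wedging with dx₃/y then
  -- gives -2 dx₂ ∧ dx₃/x₁, whence c = -½.
  have E1 : d h = (2 * algebraMap A C (a 1 - a 0) * x 1) • d (x 1) +
      (2 * algebraMap A C (a 2 - a 0) * x 2) • d (x 2) := by
    have h : d h = (2 * algebraMap A C (a 1 - a 0) * x 1) • d (x 1) +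
      (2 * algebraMap A C (a 2 - a 0) * x 2) • d (x 2) + algebraMap A C (a 0) •
        ((2 * x 0) • d (x 0) + (2 * x 1) • d (x 1) + (2 * x 2) • d (x 2)) := by
      rw [hh]
      simp only [map_add, Derivation.leibniz, Derivation.leibniz_pow, halg, map_sub]
      module
    rw [h, E2, smul_zero, add_zero]
  have hw : ∀ (r s t : C) (v w : Omega1 p A C), c • wedge p A C (r • v + s • w) (t • w) =
      (c * t * r) • wedge p A C v w := by
    intro r s t v w
    have hswap : ∀ v w : Omega1 p A C, wedge p A C v w = -wedge p A C w v :=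
      fun v w => ιMulti_two_swap v w
    rw [wedge_smul_right, hswap, wedge_add_right, wedge_smul_right, wedge_smul_right, wedge_self,
      hswap w v, smul_zero, add_zero]
    simp only [smul_neg, neg_neg, smul_smul, mul_assoc]
  have hd : ∀ z, dform p A C z = d z := fun _ => rfl
  rw [areaForm, hd, hd, hd, E1, hw]
  congr 1
  refine u0.mul_right_cancel ?_
  rw [Ring.inverse_mul_cancel _ u0]
  have h3 := Ring.inverse_mul_cancel _ hy
  rw [map_sub] at hyx ⊢
  linear_combination (- h3) + Ring.inverse y * hyx -
    Ring.inverse y * (algebraMap A C (a 1) - algebraMap A C (a 0)) * x 0 * x 1 * hc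

end FormCalculus

/-! ## Torsion-freeness of the coordinate rings -/

section Torsion

/-- Saturation with respect to p survives localization, by clearing denominators. -/
theorem mem_map_of_natCast_mul_mem {P : Type*} [CommRing P] (p : ℕ) (Q : P) (J : Ideal P)
    (h : ∀ f, (p : P) * f ∈ J → f ∈ J) (x : Localization.Away Q)
    (hx : (p : Localization.Away Q) * x ∈ J.map (algebraMap P (Localization.Away Q))) :
    x ∈ J.map (algebraMap P (Localization.Away Q)) := by
  obtain ⟨m, f, hf⟩ := IsLocalization.Away.surj Q x
  have hu : IsUnit (algebraMap P (Localization.Away Q) Q) :=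
    IsLocalization.Away.algebraMap_isUnit Q
  rw [← Ideal.mul_unit_mem_iff_mem _ (hu.pow m), hf]
  have h1 : algebraMap P (Localization.Away Q) (p * f) ∈
      J.map (algebraMap P (Localization.Away Q)) := by
    rw [map_mul, map_natCast, ← hf, ← mul_assoc]
    exact Ideal.mul_mem_right _ _ hx
  rw [IsLocalization.algebraMap_mem_map_algebraMap_iff (Submonoid.powers Q)] at h1 ⊢
  obtain ⟨s, hs, h1⟩ := h1
  exact ⟨s, hs, h _ (by rwa [mul_left_comm])⟩

variable (p : ℕ) {A : Type u} [CommRing A] (a : Fin 3 → A)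

theorem torsionFree_ringV (J : Ideal (MvPolynomial (Fin 3) A))
    (h : ∀ f, (p : MvPolynomial (Fin 3) A) * f ∈ J → f ∈ J) (b : RingV p a J)
    (hb : (p : RingV p a J) * b = 0) : b = 0 := by
  obtain ⟨x, rfl⟩ := Ideal.Quotient.mk_surjective b
  rw [← map_natCast (Ideal.Quotient.mk _), ← map_mul, Ideal.Quotient.eq_zero_iff_mem] at hb
  rw [Ideal.Quotient.eq_zero_iff_mem]
  exact mem_map_of_natCast_mul_mem p _ J h x hb

theorem torsionFree_ringX (h : ∀ f : MvPolynomial (Fin 3) A, (p : MvPolynomial (Fin 3) A) * f = 0 →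
    f = 0) (b : RingX p a) (hb : (p : RingX p a) * b = 0) : b = 0 := by
  have := mem_map_of_natCast_mul_mem p (polyQ p a) ⊥ (by simpa using h) b (by simpa using hb)
  simpa using this

variable {p a}

theorem natCast_prime [IsDomain A] (hp : Prime (p : A)) : Prime (p : MvPolynomial (Fin 3) A) := by
  rw [← map_natCast C]
  exact (MvPolynomial.prime_C_iff _).2 hp

/-- Taking a difference of two values cancels the constant term of f, about which nothing is known
in the applications. -/
theorem not_dvd_of_eval_sub (hp : Prime (p : A)) {f : MvPolynomial (Fin 3) A} {v w : Fin 3 → A}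
    (h : IsUnit (eval v f - eval w f)) : ¬ (p : MvPolynomial (Fin 3) A) ∣ f := by
  rintro ⟨g, rfl⟩
  simp only [map_mul, map_natCast, ← mul_sub] at h
  exact hp.not_isUnit (isUnit_of_mul_isUnit_left h)

/-- The ideal is principal, and the prime p does not divide its generator. -/
theorem saturated_idealS [IsDomain A] (hp : Prime (p : A)) (c₂ : A) (f : MvPolynomial (Fin 3) A)
    (hf : (p : MvPolynomial (Fin 3) A) * f ∈ idealS c₂) : f ∈ idealS c₂ := by
  rw [idealS, Ideal.mem_span_singleton] at hf ⊢
  obtain ⟨g, hg⟩ := hf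
  obtain h | ⟨g', rfl⟩ := (natCast_prime hp).dvd_or_dvd (Dvd.intro f hg)
  · refine absurd h (not_dvd_of_eval_sub hp (v := ![1, 0, 0]) (w := 0) ?_)
    simp [H2, Fin.sum_univ_three]
  · exact ⟨g', mul_left_cancel₀ (natCast_prime hp).ne_zero (by rw [hg]; ring)⟩

/-- A common divisor has degree 0 because it divides a nonzero constant, and it divides the leading
coefficient, a unit. -/
theorem isRelPrime_quadratic_C {R : Type*} [CommRing R] [IsDomain R] {α b b' : R}
    (hα : IsUnit α) (hb : b ≠ 0) :
    IsRelPrime (Polynomial.C α * Polynomial.X ^ 2 + Polynomial.C b') (Polynomial.C b) := by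
  intro d h1 h2
  have hdeg : d.natDegree ≤ 0 := by
    have := Polynomial.natDegree_le_of_dvd h2 (Polynomial.C_ne_zero.2 hb)
    rwa [Polynomial.natDegree_C] at this
  obtain ⟨e, rfl⟩ : ∃ e, d = Polynomial.C e := ⟨_, Polynomial.eq_C_of_natDegree_le_zero hdeg⟩
  have := (Polynomial.C_dvd_iff_dvd_coeff _ _).1 h1 2
  simp at this
  exact (isUnit_of_dvd_unit this hα).map Polynomial.C

/-- The first equation of `E_c` in the variables `x₁, x₃`, the second in `x₂, x₃`. -/
def curveEq₁ (a : Fin 3 → A) (c₁ c₂ : A) : MvPolynomial (Fin 3) A :=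
  C (a 0 - a 1) * X 0 ^ 2 + C (a 2 - a 1) * X 2 ^ 2 - C (c₁ - a 1 * c₂)

/-- The second equation of `E_c`, in the variables `x₂, x₃`. -/
def curveEq₂ (a : Fin 3 → A) (c₁ c₂ : A) : MvPolynomial (Fin 3) A :=
  C (a 1 - a 0) * X 1 ^ 2 + C (a 2 - a 0) * X 2 ^ 2 - C (c₁ - a 0 * c₂)

/-- The combinations H₁ - a₂H₂ and H₁ - a₁H₂ each eliminate one variable; the change of generators
is invertible because a₁ - a₂ is a unit. -/
theorem idealE_eq (ha : IsUnit (a 0 - a 1)) (c₁ c₂ : A) :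
    idealE a c₁ c₂ = Ideal.span {curveEq₁ a c₁ c₂, curveEq₂ a c₁ c₂} := by
  have e1 : curveEq₁ a c₁ c₂ = (H1 a - C c₁) - C (a 1) * (H2 A - C c₂) := by
    simp only [curveEq₁, H1, H2, Fin.sum_univ_three, map_sub, map_mul]; ring
  have e2 : curveEq₂ a c₁ c₂ = (H1 a - C c₁) - C (a 0) * (H2 A - C c₂) := by
    simp only [curveEq₂, H1, H2, Fin.sum_univ_three, map_sub, map_mul]; ring
  obtain ⟨i, hi⟩ := ha.exists_left_inv
  have hi' : (C i : MvPolynomial (Fin 3) A) * (C (a 0) - C (a 1)) = 1 := by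
    rw [← map_sub, ← map_mul, hi, map_one]
  refine le_antisymm ?_ ?_
  · rw [idealE, Ideal.span_le]
    rintro f (rfl | rfl)
    · rw [SetLike.mem_coe, Ideal.mem_span_pair]
      refine ⟨C i * C (a 0), - (C i * C (a 1)), ?_⟩
      rw [e1, e2]; linear_combination (H1 a - C c₁) * hi'
    · rw [SetLike.mem_coe, Ideal.mem_span_pair]
      refine ⟨C i, - C i, ?_⟩
      rw [e1, e2]; linear_combination (H2 A - C c₂) * hi'
  · rw [Ideal.span_le]
    rintro f (rfl | rfl)
    · rw [e1]
      exact Ideal.sub_mem _ (Ideal.subset_span (by simp))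
        (Ideal.mul_mem_left _ _ (Ideal.subset_span (by simp)))
    · rw [e2]
      exact Ideal.sub_mem _ (Ideal.subset_span (by simp))
        (Ideal.mul_mem_left _ _ (Ideal.subset_span (by simp)))

/-- Reduction modulo the maximal ideal, the first variable being singled out. -/
def reduceSucc (A : Type u) [CommRing A] [IsLocalRing A] : MvPolynomial (Fin 3) A →+*
    Polynomial (MvPolynomial (Fin 2) (IsLocalRing.ResidueField A)) :=
  (finSuccEquiv (IsLocalRing.ResidueField A) 2).toRingEquiv.toRingHom.comp
    (MvPolynomial.map (IsLocalRing.residue A))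

variable [IsLocalRing A]

theorem reduceSucc_C (c : A) :
    reduceSucc A (C c) = Polynomial.C (C (IsLocalRing.residue A c)) := by
  change finSuccEquiv _ 2 (MvPolynomial.map _ (C c)) = _
  rw [map_C]
  exact (MvPolynomial.finSuccEquiv _ 2).commutes _

theorem reduceSucc_X_zero : reduceSucc A (X 0) = Polynomial.X := by
  change finSuccEquiv _ 2 (MvPolynomial.map _ (X 0)) = _
  rw [map_X, finSuccEquiv_X_zero]

theorem reduceSucc_X_succ (i : Fin 2) : reduceSucc A (X i.succ) = Polynomial.C (X i) := by
  change finSuccEquiv _ 2 (MvPolynomial.map _ (X i.succ)) = _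
  rw [map_X, finSuccEquiv_X_succ]

theorem reduceSucc_surjective : Function.Surjective (reduceSucc A) :=
  (finSuccEquiv (IsLocalRing.ResidueField A) 2).surjective.comp
    (map_surjective _ IsLocalRing.residue_surjective)

theorem map_residue_eq_zero (hmax : IsLocalRing.maximalIdeal A = Ideal.span {(p : A)})
    {σ : Type*} {f : MvPolynomial σ A} (h : MvPolynomial.map (IsLocalRing.residue A) f = 0) :
    (p : MvPolynomial σ A) ∣ f := by
  rw [← RingHom.mem_ker, MvPolynomial.ker_map, IsLocalRing.ker_residue, hmax, Ideal.map_span,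
    Set.image_singleton, map_natCast, Ideal.mem_span_singleton] at h
  exact h

theorem dvd_of_reduceSucc_eq_zero (hmax : IsLocalRing.maximalIdeal A = Ideal.span {(p : A)})
    {f : MvPolynomial (Fin 3) A} (h : reduceSucc A f = 0) : (p : MvPolynomial (Fin 3) A) ∣ f :=
  map_residue_eq_zero hmax ((finSuccEquiv (IsLocalRing.ResidueField A) 2).map_eq_zero_iff.1 h)

/-- A regular sequence argument. Let e₁, e₂ be the two separated equations and pf = ue₁ + ve₂.
Modulo p they are coprime: e₁ is quadratic in x₁ with unit leading coefficient and e₂ ≠ 0 is free of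
x₁. So e₂ divides u modulo p, say u = e₂s + pu'. Then p divides e₂(se₁ + v) but not e₂, so se₁ + v =
pv' and f = u'e₁ + v'e₂. -/
theorem saturated_idealE [IsDomain A] (hmax : IsLocalRing.maximalIdeal A = Ideal.span {(p : A)})
    (hp : Prime (p : A)) (ha : IsUnit (a 0 - a 1)) (c₁ c₂ : A) (f : MvPolynomial (Fin 3) A)
    (hf : (p : MvPolynomial (Fin 3) A) * f ∈ idealE a c₁ c₂) : f ∈ idealE a c₁ c₂ := by
  rw [idealE_eq ha, Ideal.mem_span_pair] at hf ⊢
  obtain ⟨u, v, huv⟩ := hf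
  set r := IsLocalRing.residue A
  have hX1 : reduceSucc A (X 1) = Polynomial.C (X 0) := reduceSucc_X_succ 0
  have hX2 : reduceSucc A (X 2) = Polynomial.C (X 1) := reduceSucc_X_succ 1
  set b' : MvPolynomial (Fin 2) (IsLocalRing.ResidueField A) :=
    C (r (a 2 - a 1)) * X 1 ^ 2 - C (r (c₁ - a 1 * c₂))
  set b : MvPolynomial (Fin 2) (IsLocalRing.ResidueField A) :=
    C (r (a 1 - a 0)) * X 0 ^ 2 + C (r (a 2 - a 0)) * X 1 ^ 2 - C (r (c₁ - a 0 * c₂)) with hb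
  have e1 : reduceSucc A (curveEq₁ a c₁ c₂) =
      Polynomial.C (C (r (a 0 - a 1))) * Polynomial.X ^ 2 + Polynomial.C b' := by
    simp only [curveEq₁, map_add, map_sub, map_mul, map_pow, reduceSucc_C, reduceSucc_X_zero, hX2,
      b', r]
    ring
  have e2 : reduceSucc A (curveEq₂ a c₁ c₂) = Polynomial.C b := by
    simp only [curveEq₂, map_add, map_sub, map_mul, map_pow, reduceSucc_C, hX1, hX2, b, r]
  have ha' : IsUnit (a 1 - a 0) := by rw [← neg_sub]; exact ha.neg
  have hb0 : b ≠ 0 := by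
    intro h0
    have h1 := congrArg (eval ![1, 0]) h0
    have h2 := congrArg (eval ![0, 0]) h0
    rw [hb] at h1 h2
    simp only [map_add, map_sub, map_mul, map_pow, eval_C, eval_X, Matrix.cons_val, map_zero] at h1 h2
    refine (ha'.map r).ne_zero ?_
    rw [map_sub]
    linear_combination h1 - h2
  have hrel := isRelPrime_quadratic_C (b' := b') ((ha.map r).map C) hb0
  have hp0 : reduceSucc A (p : MvPolynomial (Fin 3) A) = 0 := by
    rw [← map_natCast C, reduceSucc_C]
    have : r (p : A) = 0 := by
      rw [IsLocalRing.residue_eq_zero_iff, hmax]; exact Ideal.mem_span_singleton_self _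
    rw [this, map_zero, map_zero]
  have h1 := congrArg (reduceSucc A) huv
  rw [map_add, map_mul, map_mul, map_mul, e1, e2, hp0, zero_mul] at h1
  have h2 : Polynomial.C b ∣ reduceSucc A u :=
    hrel.symm.dvd_of_dvd_mul_right ⟨-reduceSucc A v, by linear_combination h1⟩
  obtain ⟨s', hs'⟩ := h2
  obtain ⟨s, rfl⟩ := reduceSucc_surjective s'
  obtain ⟨u', hu'⟩ := dvd_of_reduceSucc_eq_zero hmax (f := u - curveEq₂ a c₁ c₂ * s) (by
    rw [map_sub, map_mul, e2, hs', sub_self])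
  have h3 : (p : MvPolynomial (Fin 3) A) ∣ curveEq₂ a c₁ c₂ * (s * curveEq₁ a c₁ c₂ + v) :=
    ⟨f - u' * curveEq₁ a c₁ c₂, by linear_combination huv - curveEq₁ a c₁ c₂ * hu'⟩
  obtain h | ⟨v', hv'⟩ := (natCast_prime hp).dvd_or_dvd h3
  · refine absurd h (not_dvd_of_eval_sub hp (v := ![0, 1, 0]) (w := 0) ?_)
    convert ha' using 1
    simp [curveEq₂]
    ring
  · refine ⟨u', v', mul_left_cancel₀ (natCast_prime hp).ne_zero ?_⟩
    linear_combination huv - curveEq₂ a c₁ c₂ * hv' - curveEq₁ a c₁ c₂ * hu'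

end Torsion

/-! ## Induced flows -/

section Induced

/-- Without p-torsion the Frobenius lift determines δ, so compatibility with the base need only be
checked on φ. -/
theorem exists_arithFlow_of_frob {p : ℕ} {A : Type*} [CommRing A] {δA : PDerivation p A}
    {C : Type*} [CommRing C] [Algebra A C] (htf : ∀ c : C, (p : C) * c = 0 → c = 0)
    (φ : C →+* C) (h1 : ∀ c, ∃ d, φ c = c ^ p + p * d)
    (h2 : ∀ r, φ (algebraMap A C r) = algebraMap A C (δA.frob r)) :
    ∃ δ : ArithFlow δA C, δ.frob = φ := by
  choose d hd using h1
  refine ⟨⟨⟨d, φ, hd⟩, fun r => ?_⟩, rfl⟩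
  rw [← sub_eq_zero]
  apply htf
  have h3 := hd (algebraMap A C r)
  rw [h2, δA.frob_apply, map_add, map_mul, map_pow, map_natCast] at h3
  linear_combination -h3

variable {p : ℕ} {A : Type u} [CommRing A] {a : Fin 3 → A} {δA : PDerivation p A}

theorem restrict_algebraMap (J : Ideal (MvPolynomial (Fin 3) A)) (b : RingX p a) :
    restrict p a J (algebraMap _ _ b) = algebraMap (RingV p a J) _ (Ideal.Quotient.mk _ b) :=
  completionMap_algebraMap p _ _

theorem restrict_algebraMap_base (J : Ideal (MvPolynomial (Fin 3) A)) (r : A) :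
    restrict p a J (algebraMap A _ r) = algebraMap A _ r :=
  restrict_algebraMap J (algebraMap A _ r)

/-- Surjectivity modulo p suffices, the source being complete and the target separated. -/
theorem restrict_surjective (J : Ideal (MvPolynomial (Fin 3) A)) :
    Function.Surjective (restrict p a J) := by
  have hmap : (Ideal.span {(p : HatX p a)}).map (restrict p a J) =
      Ideal.span {(p : HatV p a J)} := by
    rw [Ideal.map_span, Set.image_singleton, map_natCast]
  have : IsHausdorff ((Ideal.span {(p : HatX p a)}).map (restrict p a J)) (HatV p a J) := by
    rw [hmap]; infer_instance
  refine surjective_of_mk_map_comp_surjective (I := Ideal.span {(p : HatX p a)}) _ fun x => ?_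
  obtain ⟨y, rfl⟩ := Ideal.Quotient.mk_surjective x
  obtain ⟨b, c, rfl⟩ := phat_exists_eq_add 1 y
  obtain ⟨b, rfl⟩ := Ideal.Quotient.mk_surjective b
  refine ⟨algebraMap _ _ b, ?_⟩
  rw [RingHom.comp_apply, restrict_algebraMap, Ideal.Quotient.eq, hmap,
    Ideal.mem_span_singleton]
  exact ⟨-c, by ring⟩

/-- An element f of the kernel is only approximated by JR, with R the coordinate ring of X: if f = b
+ pⁿc with b in R, then b is pⁿd modulo JR. Hence φ(f) restricts to a multiple of pⁿ for every n,
which is zero by separatedness. -/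
theorem restrict_frob_eq_zero (δX : ArithFlow δA (HatX p a)) {J : Ideal (MvPolynomial (Fin 3) A)}
    (hJ : ∀ g ∈ J, restrict p a J (δX.frob (fnX p a g)) = 0) {f : HatX p a}
    (hf : restrict p a J f = 0) : restrict p a J (δX.frob f) = 0 := by
  set θ : RingX p a →+* HatV p a J :=
    ((restrict p a J).comp δX.frob).comp (algebraMap (RingX p a) (HatX p a))
  have hθ : J.map (algebraMap (MvPolynomial (Fin 3) A) (RingX p a)) ≤ RingHom.ker θ := by
    rw [Ideal.map_le_iff_le_comap]
    exact fun g hg => hJ g hg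
  refine eq_zero_of_forall_pow_dvd (p := p) fun n => ?_
  obtain ⟨b, c, rfl⟩ := phat_exists_eq_add n f
  rw [map_add, restrict_algebraMap, map_mul, map_pow, map_natCast] at hf
  obtain ⟨d, hd⟩ := phat_pow_dvd_of_dvd (p := p) (n := n) (b := Ideal.Quotient.mk _ b)
    ⟨-restrict p a J c, by linear_combination hf⟩
  obtain ⟨d, rfl⟩ := Ideal.Quotient.mk_surjective d
  rw [← sub_eq_zero, ← map_natCast (Ideal.Quotient.mk _), ← map_pow, ← map_mul, ← map_sub,
    Ideal.Quotient.eq_zero_iff_mem] at hd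
  have h1 : θ (b - p ^ n * d) = 0 := hθ hd
  rw [map_sub, sub_eq_zero, map_mul, map_pow, map_natCast] at h1
  refine ⟨θ d + restrict p a J (δX.frob c), ?_⟩
  have h2 : restrict p a J (δX.frob (algebraMap _ _ b)) = θ b := rfl
  simp only [map_add, map_mul, map_pow, map_natCast, h2, h1]
  ring

/-- A flow whose Frobenius lift preserves a closed subscheme induces a flow on it. -/
theorem exists_induced (δX : ArithFlow δA (HatX p a)) {J : Ideal (MvPolynomial (Fin 3) A)}
    (hJ : ∀ g ∈ J, restrict p a J (δX.frob (fnX p a g)) = 0)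
    (htf : ∀ c : HatV p a J, (p : HatV p a J) * c = 0 → c = 0) :
    ∃ δV : ArithFlow δA (HatV p a J), Induces J δX δV := by
  set φ : HatV p a J →+* HatV p a J := (restrict p a J).liftOfSurjective (restrict_surjective J)
    ⟨(restrict p a J).comp δX.frob, fun f hf => restrict_frob_eq_zero δX hJ hf⟩
  have hφ : ∀ f, φ (restrict p a J f) = restrict p a J (δX.frob f) := fun f =>
    RingHom.liftOfRightInverse_comp_apply _ _ _ _ f
  obtain ⟨δV, hδV⟩ := exists_arithFlow_of_frob (δA := δA) htf φ (fun c => by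
      obtain ⟨f, rfl⟩ := restrict_surjective J c
      exact ⟨restrict p a J (δX f), by rw [hφ, δX.frob_apply]; simp⟩) (fun r => by
      rw [← restrict_algebraMap_base, hφ, δX.frob_algebraMap, restrict_algebraMap_base])
  refine ⟨δV, fun f => ?_⟩
  rw [← sub_eq_zero]
  apply htf
  have h1 := δV.frob_apply (restrict p a J f)
  rw [hδV, hφ, δX.frob_apply, map_add, map_mul, map_pow, map_natCast] at h1
  linear_combination -h1

theorem Induces.unique {δX : ArithFlow δA (HatX p a)} {J : Ideal (MvPolynomial (Fin 3) A)}
    {δ₁ δ₂ : ArithFlow δA (HatV p a J)} (h₁ : Induces J δX δ₁) (h₂ : Induces J δX δ₂) :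
    δ₁ = δ₂ := by
  have h : ∀ c, δ₁ c = δ₂ c := fun c => by
    obtain ⟨f, rfl⟩ := restrict_surjective J c
    rw [h₁, h₂]
  refine ArithFlow.ext (funext h) (RingHom.ext fun c => ?_)
  rw [δ₁.frob_apply, δ₂.frob_apply, h]

/-- For constants φ(f - c) = f^p - c^p, which vanishes where f = c. -/
theorem restrict_frob_sub_C {δX : ArithFlow δA (HatX p a)} {J : Ideal (MvPolynomial (Fin 3) A)}
    {f : MvPolynomial (Fin 3) A} {c : A} (hf : δX (fnX p a f) = 0) (hc : δA c = 0)
    (hmem : f - C c ∈ J) : restrict p a J (δX.frob (fnX p a (f - C c))) = 0 := by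
  have hC : fnX p a (C c) = algebraMap A _ c := rfl
  have h0 : fnX p a (f - C c) = fnX p a f - algebraMap A _ c := by
    rw [← hC]; simp [fnX]
  have h1 : fnV p a J f = algebraMap A _ c := by
    have := fnV_eq_zero_of_mem p a J hmem
    rw [map_sub, sub_eq_zero] at this
    rw [this]
    exact (fnV p a J).commutes c
  rw [h0, map_sub, δX.frob_apply, hf, δX.frob_algebraMap, δA.frob_apply, hc, mul_zero, mul_zero,
    add_zero, add_zero, map_sub, map_pow, restrict_fnX, h1, restrict_algebraMap_base, map_pow,
    sub_self]

theorem restrict_frob_span {δX : ArithFlow δA (HatX p a)} {s : Set (MvPolynomial (Fin 3) A)}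
    (h : ∀ g ∈ s, restrict p a (Ideal.span s) (δX.frob (fnX p a g)) = 0) :
    ∀ g ∈ Ideal.span s, restrict p a (Ideal.span s) (δX.frob (fnX p a g)) = 0 := by
  set θ : MvPolynomial (Fin 3) A →+* HatV p a (Ideal.span s) :=
    (((restrict p a _).comp δX.frob).comp (algebraMap (RingX p a) (HatX p a))).comp
      (algebraMap _ (RingX p a))
  exact fun g hg => (Ideal.span_le (I := RingHom.ker θ)).2 (fun f hf => h f hf) hg

theorem restrict_frob_idealS {δX : ArithFlow δA (HatX p a)} (h2 : δX (fnX p a (H2 A)) = 0)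
    {c₂ : A} (hc : δA c₂ = 0) :
    ∀ g ∈ idealS c₂, restrict p a (idealS c₂) (δX.frob (fnX p a g)) = 0 := by
  refine restrict_frob_span fun g hg => ?_
  rw [Set.mem_singleton_iff.1 hg]
  exact restrict_frob_sub_C h2 hc (Ideal.mem_span_singleton_self _)

theorem restrict_frob_idealE {δX : ArithFlow δA (HatX p a)} (h1 : δX (fnX p a (H1 a)) = 0)
    (h2 : δX (fnX p a (H2 A)) = 0) {c₁ c₂ : A} (hc₁ : δA c₁ = 0) (hc₂ : δA c₂ = 0) :
    ∀ g ∈ idealE a c₁ c₂, restrict p a (idealE a c₁ c₂) (δX.frob (fnX p a g)) = 0 := by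
  refine restrict_frob_span fun g hg => ?_
  obtain rfl | rfl := hg
  · exact restrict_frob_sub_C h1 hc₁ (Ideal.subset_span (by simp))
  · exact restrict_frob_sub_C h2 hc₂ (Ideal.subset_span (by simp))

end Induced

/-! ## The obstruction modulo `p` -/

section Abstract

theorem isUnit_two_of_base {A : Type*} [CommRing A] (h2 : IsUnit (2 : A)) {T : Type*} [CommRing T]
    [Algebra A T] : IsUnit (2 : T) := by
  have := h2.map (algebraMap A T)
  rwa [map_ofNat] at this

variable {p : ℕ} {A : Type u} [CommRing A] {a : Fin 3 → A} {δA : PDerivation p A}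
  {C : Type u} [CommRing C] [Algebra A C]
  {e : MvPolynomial (Fin 3) A →ₐ[A] C}

variable (p) in
/-- The reduction modulo `pⁿ` of a homomorphism from the polynomial ring. -/
def lvlHom (e : MvPolynomial (Fin 3) A →ₐ[A] C) (n : ℕ) :
    MvPolynomial (Fin 3) A →ₐ[A] Lvl p C n :=
  (Ideal.Quotient.mkₐ A _).comp e

theorem lvlHom_apply (n : ℕ) (f : MvPolynomial (Fin 3) A) :
    lvlHom p e n f = Ideal.Quotient.mk _ (e f) := rfl

theorem D_lvlHom_eq_zero {f : MvPolynomial (Fin 3) A} {c : A} (h : e f = algebraMap A C c)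
    (n : ℕ) : D A (Lvl p C n) (lvlHom p e n f) = 0 := by
  rw [lvlHom_apply, h]
  exact Derivation.map_algebraMap _ c

variable [IsAdicComplete (Ideal.span {(p : C)}) C] {c₁ c₂ : A}

/-- On the curve dH₁ = dH₂ = 0, so dx₃ generates; it is independent because D x₃ = y is a unit. -/
theorem exists_basis_curve
    (hP : ∀ n, IsPres (polyQ p a) (idealE a c₁ c₂ ⊔ Ideal.span {(p : MvPolynomial (Fin 3) A) ^ n})
      (lvlHom p e n))
    (e1 : e (H1 a) = algebraMap A C c₁) (e2 : e (H2 A) = algebraMap A C c₂)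
    (h2 : IsUnit (2 : A)) (ha : IsUnit (a 0 - a 1)) :
    ∃ b : Module.Basis Unit C (Omega1 p A C), ∀ i, b i = dform p A C (e (X 2)) := by
  refine exists_basis_omega1 (fun _ => e (X 2)) (fun n => ?_) (fun n => ?_)
  · obtain ⟨D, hD, -, -⟩ := exists_euler_field (hP n) (Or.inr (Or.inr ⟨c₁, c₂, rfl⟩))
    refine linearIndependent_differentials _ (fun _ => D) (fun i j hij => absurd rfl hij) fun _ => ?_
    have := hD 2
    rw [lvlHom_apply] at this
    rw [this]
    exact isUnit_yfun (hP n).isUnit ha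
  · refine span_differentials_eq_top (hP n) ha (isUnit_two_of_base h2)
      _ ?_ ?_ (Submodule.subset_span ⟨(), rfl⟩)
    · rw [D_lvlHom_eq_zero e1]
      exact Submodule.zero_mem _
    · rw [D_lvlHom_eq_zero e2]
      exact Submodule.zero_mem _

/-- The rotation E and the Euler field D form a dual frame up to units: E H₁ = -2y, E x₃ = 0, D H₁ =
0, D x₃ = y. -/
theorem exists_basis_sphere
    (hP : ∀ n, IsPres (polyQ p a) (idealS c₂ ⊔ Ideal.span {(p : MvPolynomial (Fin 3) A) ^ n})
      (lvlHom p e n))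
    (e2 : e (H2 A) = algebraMap A C c₂) (h2 : IsUnit (2 : A)) (ha : IsUnit (a 0 - a 1)) :
    ∃ b : Module.Basis (Fin 2) C (Omega1 p A C),
      b 0 = dform p A C (e (H1 a)) ∧ b 1 = dform p A C (e (X 2)) := by
  have hli : ∀ n, LinearIndependent (Lvl p C n) fun i =>
      D A (Lvl p C n) (Ideal.Quotient.mk _ (![e (H1 a), e (X 2)] i)) := by
    intro n
    obtain ⟨D, hD, hD1, -⟩ := exists_euler_field (hP n) (Or.inr (Or.inl ⟨c₂, rfl⟩))
    obtain ⟨E, hE, hE2⟩ := exists_rotation_field (hP n)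
    have hy := isUnit_yfun (hP n).isUnit ha
    refine linearIndependent_differentials _ ![E, D] (fun i j hij => ?_) fun i => ?_
    · fin_cases i <;> fin_cases j
      · exact absurd rfl hij
      · exact hE2
      · exact hD1
      · exact absurd rfl hij
    · fin_cases i
      · have h := (isUnit_two_of_base h2).neg.mul hy
        rw [← hE] at h
        exact h
      · have h := hy
        rw [show lvlHom p e n (yfun a) = D (lvlHom p e n (X 2)) from (hD 2).symm] at h
        exact h
  obtain ⟨b, hb⟩ := exists_basis_omega1 (p := p) (A := A) ![e (H1 a), e (X 2)] hli fun n => by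
    refine span_differentials_eq_top (hP n) ha (isUnit_two_of_base h2)
      _ (Submodule.subset_span ⟨0, rfl⟩) ?_ (Submodule.subset_span ⟨1, rfl⟩)
    rw [D_lvlHom_eq_zero e2]
    exact Submodule.zero_mem _
  exact ⟨b, hb 0, hb 1⟩

theorem scales1_curve_iff
    (hP : ∀ n, IsPres (polyQ p a) (idealE a c₁ c₂ ⊔ Ideal.span {(p : MvPolynomial (Fin 3) A) ^ n})
      (lvlHom p e n))
    (e1 : e (H1 a) = algebraMap A C c₁) (e2 : e (H2 A) = algebraMap A C c₂)
    (hQ : IsUnit (e (polyQ p a))) (h2 : IsUnit (2 : A)) (ha : IsUnit (a 0 - a 1))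
    (htf : ∀ c : C, (p : C) * c = 0 → c = 0) (δ : ArithFlow δA C)
    {D : Derivation A (Lvl p C 1) (Lvl p C 1)}
    (hD : ∀ i, D (lvlHom p e 1 (X i)) = lvlHom p e 1 (eulerField a i)) :
    δ.Scales1 (curveForm p A C (fun i => e (X i)) (algebraMap A C (a 0 - a 1)))
      (Ring.inverse (e (hasseH p a))) ↔
      obstruction p D (lvlHom p e 1 (X 2)) (lvlHom p e 1 (yfun a)) (lvlHom p e 1 (hasseH p a))
        (Ideal.Quotient.mk _ (δ (e (X 2)))) = 0 := by
  obtain ⟨b, hb⟩ := exists_basis_curve hP e1 e2 h2 ha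
  have hω : curveForm p A C (fun i => e (X i)) (algebraMap A C (a 0 - a 1)) =
      Ring.inverse (e (yfun a)) • dform p A _ (e (X 2)) := by
    rw [map_yfun]; rfl
  rw [hω]
  exact scales1_iff htf δ (isUnit_yfun hQ ha) (isUnit_of_polyQ hQ).2.2.2 D (hD 2) b hb

theorem scales2_sphere
    (hP : ∀ n, IsPres (polyQ p a) (idealS c₂ ⊔ Ideal.span {(p : MvPolynomial (Fin 3) A) ^ n})
      (lvlHom p e n))
    (e2 : e (H2 A) = algebraMap A C c₂)
    (hQ : IsUnit (e (polyQ p a))) (h2 : IsUnit (2 : A)) (ha : IsUnit (a 0 - a 1))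
    (htf : ∀ c : C, (p : C) * c = 0 → c = 0) {δ : ArithFlow δA C} (hδ : δ (e (H1 a)) = 0)
    {D : Derivation A (Lvl p C 1) (Lvl p C 1)}
    (hD : ∀ i, D (lvlHom p e 1 (X i)) = lvlHom p e 1 (eulerField a i))
    (hobs : obstruction p D (lvlHom p e 1 (X 2)) (lvlHom p e 1 (yfun a))
      (lvlHom p e 1 (hasseH p a)) (Ideal.Quotient.mk _ (δ (e (X 2)))) = 0) :
    δ.Scales2 (areaForm p A C (fun i => e (X i)))
      (e (H1 a) ^ (p - 1) * Ring.inverse (e (hasseH p a))) := by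
  obtain ⟨b, hb0, hb1⟩ := exists_basis_sphere hP e2 h2 ha
  have h2' : IsUnit (2 : C) := isUnit_two_of_base h2
  -- The constant -½ in η = -½ dH₁ ∧ ω; every ring endomorphism fixes it.
  obtain ⟨c, hc⟩ : ∃ c : C, 2 * c = -1 := by
    obtain ⟨i, hi⟩ := h2'.exists_right_inv
    exact ⟨-i, by linear_combination -hi⟩
  have hfrob : δ.frob c = c := by
    refine h2'.mul_left_cancel ?_
    have h5 := congrArg δ.frob hc
    rw [map_mul, map_neg, map_one, map_ofNat] at h5
    rw [h5, hc]
  have hDH : D (lvlHom p e 1 (H1 a)) = 0 := by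
    have hC : ∀ c : A, lvlHom p e 1 (MvPolynomial.C c) = algebraMap A _ c :=
      (lvlHom p e 1).commutes
    rw [map_H1]
    simp only [map_add, Derivation.leibniz, Derivation.leibniz_pow, Derivation.map_algebraMap, hD,
      smul_eq_mul]
    simp only [eulerField, Matrix.cons_val, yfun, map_mul, hC, map_sub]
    ring
  rw [areaForm_eq_wedge (a := a) (fun i => e (X i)) (isUnit_of_polyQ hQ).1 (isUnit_yfun hQ ha) hc
    ((map_H2 e).symm.trans e2) (map_H1 a e) (map_yfun a e)]
  exact scales2_of_obstruction htf δ (isUnit_yfun hQ ha) (isUnit_of_polyQ hQ).2.2.2 hδ hfrob D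
    (hD 2) hDH b hb0 hb1 hobs

end Abstract

/-! ### The obstruction on X and its restrictions -/

section Obstruction

variable (p : ℕ) {A : Type u} [CommRing A] (a : Fin 3 → A)

/-- A polynomial as a function on the reduction modulo `pⁿ` of `X`. -/
def lvlX (n : ℕ) : MvPolynomial (Fin 3) A →ₐ[A] Lvl p (HatX p a) n :=
  lvlPi p (IsScalarTower.toAlgHom A (MvPolynomial (Fin 3) A) (RingX p a)) n

/-- A polynomial as a function on the reduction modulo `pⁿ` of `V(J) ∩ X`. -/
def lvlV (J : Ideal (MvPolynomial (Fin 3) A)) (n : ℕ) :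
    MvPolynomial (Fin 3) A →ₐ[A] Lvl p (HatV p a J) n :=
  lvlPi p ((Ideal.Quotient.mkₐ A (J.map (algebraMap (MvPolynomial (Fin 3) A)
      (RingX p a)))).comp (IsScalarTower.toAlgHom A (MvPolynomial (Fin 3) A) (RingX p a))) n

theorem lvlX_apply (n : ℕ) (f : MvPolynomial (Fin 3) A) :
    lvlX p a n f = Ideal.Quotient.mk _ (fnX p a f) := rfl

theorem lvlV_apply (J : Ideal (MvPolynomial (Fin 3) A)) (n : ℕ) (f : MvPolynomial (Fin 3) A) :
    lvlV p a J n f = Ideal.Quotient.mk _ (fnV p a J f) := rfl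

theorem isPres_lvlX (n : ℕ) :
    IsPres (polyQ p a) (⊥ ⊔ Ideal.span {(p : MvPolynomial (Fin 3) A) ^ n}) (lvlX p a n) :=
  isPres_lvl p (isPres_localization _) n

theorem isPres_lvlV (J : Ideal (MvPolynomial (Fin 3) A)) (n : ℕ) :
    IsPres (polyQ p a) (J ⊔ Ideal.span {(p : MvPolynomial (Fin 3) A) ^ n}) (lvlV p a J n) :=
  isPres_lvl p (isPres_quotient _ _) n

/-- The restriction of functions from `X` to `V(J) ∩ X`, modulo `p`. -/
def restrictLvl (J : Ideal (MvPolynomial (Fin 3) A)) :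
    Lvl p (HatX p a) 1 →+* Lvl p (HatV p a J) 1 :=
  Ideal.quotientMap _ (restrict p a J) (by
    rw [Ideal.span_singleton_le_iff_mem, Ideal.mem_comap, map_pow, map_natCast]
    exact Ideal.mem_span_singleton_self _)

theorem restrictLvl_mk (J : Ideal (MvPolynomial (Fin 3) A)) (f : HatX p a) :
    restrictLvl p a J (Ideal.Quotient.mk _ f) = Ideal.Quotient.mk _ (restrict p a J f) := rfl

theorem restrictLvl_lvlX (J : Ideal (MvPolynomial (Fin 3) A)) (f : MvPolynomial (Fin 3) A) :
    restrictLvl p a J (lvlX p a 1 f) = lvlV p a J 1 f := by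
  rw [lvlX_apply, restrictLvl_mk, restrict_fnX, lvlV_apply]

variable {p a} {δA : PDerivation p A}

/-- The obstruction on `X` to the linearization property of a flow. -/
def obstructionX (δX : ArithFlow δA (HatX p a))
    (D : Derivation A (Lvl p (HatX p a) 1) (Lvl p (HatX p a) 1)) : Lvl p (HatX p a) 1 :=
  obstruction p D (lvlX p a 1 (X 2)) (lvlX p a 1 (yfun a)) (lvlX p a 1 (hasseH p a))
    (Ideal.Quotient.mk _ (δX (fnX p a (X 2))))

/-- The Euler field has the same polynomial components on X and on the subscheme, so it commutes
with restriction. -/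
theorem restrictLvl_obstructionX {δX : ArithFlow δA (HatX p a)}
    {J : Ideal (MvPolynomial (Fin 3) A)} {δV : ArithFlow δA (HatV p a J)} (h : Induces J δX δV)
    {D : Derivation A (Lvl p (HatX p a) 1) (Lvl p (HatX p a) 1)}
    (hD : ∀ i, D (lvlX p a 1 (X i)) = lvlX p a 1 (eulerField a i))
    {D' : Derivation A (Lvl p (HatV p a J) 1) (Lvl p (HatV p a J) 1)}
    (hD' : ∀ i, D' (lvlV p a J 1 (X i)) = lvlV p a J 1 (eulerField a i)) :
    restrictLvl p a J (obstructionX δX D) = obstruction p D' (lvlV p a J 1 (X 2))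
      (lvlV p a J 1 (yfun a)) (lvlV p a J 1 (hasseH p a))
      (Ideal.Quotient.mk _ (δV (fnV p a J (X 2)))) := by
  have hc := (isPres_lvlX p a 1).derivation_comp (restrictLvl p a J)
    (restrictLvl_lvlX p a J) hD hD' (Ideal.Quotient.mk _ (δX (fnX p a (X 2))))
  rw [restrictLvl_mk, ← h, restrict_fnX] at hc
  simp only [obstructionX, obstruction, map_sub, map_mul, map_add, map_pow, restrictLvl_lvlX, hc]

theorem fnV_hasseH (J : Ideal (MvPolynomial (Fin 3) A)) : fnV p a J (hasseH p a) =
    aeval ![fnV p a J (H1 a), fnV p a J (H2 A)] (hasse p a) := by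
  rw [hasseH, ← AlgHom.comp_apply, comp_aeval]
  congr 2
  funext i
  fin_cases i <;> rfl

theorem fnV_eq_of_mem {J : Ideal (MvPolynomial (Fin 3) A)} {f : MvPolynomial (Fin 3) A} {c : A}
    (h : f - C c ∈ J) : fnV p a J f = algebraMap A _ c := by
  have := fnV_eq_zero_of_mem p a J h
  rw [map_sub, sub_eq_zero] at this
  rw [this]
  exact (fnV p a J).commutes c

theorem H1_sub_mem_idealE (c₁ c₂ : A) : H1 a - C c₁ ∈ idealE a c₁ c₂ :=
  Ideal.subset_span (Or.inl rfl)

theorem H2_sub_mem_idealE (c₁ c₂ : A) : H2 A - C c₂ ∈ idealE a c₁ c₂ :=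
  Ideal.subset_span (Or.inr rfl)

section Curve

variable {c₁ c₂ : A}

theorem fnV_hasseH_curve : fnV p a (idealE a c₁ c₂) (hasseH p a) =
    algebraMap A _ (aeval ![c₁, c₂] (hasse p a)) := by
  rw [fnV_hasseH, fnV_eq_of_mem (H1_sub_mem_idealE c₁ c₂),
    fnV_eq_of_mem (H2_sub_mem_idealE c₁ c₂), ← MvPolynomial.aeval_algebraMap_apply]
  congr 2
  funext i
  fin_cases i <;> rfl

/-- The linearization property of an induced flow on `E_c` in terms of the obstruction. -/
theorem scales1_iff_obstruction (h2 : IsUnit (2 : A)) (ha : IsUnit (a 0 - a 1))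
    (htf : ∀ c : HatV p a (idealE a c₁ c₂), (p : HatV p a (idealE a c₁ c₂)) * c = 0 → c = 0)
    (hu : IsUnit (aeval ![c₁, c₂] (hasse p a)))
    {δX : ArithFlow δA (HatX p a)} {δE : ArithFlow δA (HatV p a (idealE a c₁ c₂))}
    (h : Induces (idealE a c₁ c₂) δX δE)
    {D : Derivation A (Lvl p (HatX p a) 1) (Lvl p (HatX p a) 1)}
    (hD : ∀ i, D (lvlX p a 1 (X i)) = lvlX p a 1 (eulerField a i)) :
    δE.Scales1 (omegaE p a c₁ c₂) (algebraMap A _ (Ring.inverse (aeval ![c₁, c₂] (hasse p a)))) ↔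
      restrictLvl p a (idealE a c₁ c₂) (obstructionX δX D) = 0 := by
  obtain ⟨D', hD', -, -⟩ := exists_euler_field (isPres_lvlV p a (idealE a c₁ c₂) 1)
    (Or.inr (Or.inr ⟨c₁, c₂, rfl⟩))
  rw [restrictLvl_obstructionX h hD hD', map_ringInverse _ hu, ← fnV_hasseH_curve]
  exact scales1_curve_iff (isPres_lvlV p a (idealE a c₁ c₂))
    (fnV_eq_of_mem (H1_sub_mem_idealE c₁ c₂)) (fnV_eq_of_mem (H2_sub_mem_idealE c₁ c₂))
    (isUnit_fnV_polyQ p a _) h2 ha htf δE hD'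

end Curve

section Sphere

variable {c₂ : A}

theorem hasseS_eq : hasseS p a c₂ = fnV p a (idealS c₂) (hasseH p a) := by
  rw [fnV_hasseH, fnV_H2, hasseS]

/-- The Hamiltonian property of an induced flow on `S_{c₂}` in terms of the obstruction. -/
theorem scales2_of_obstructionX (h2 : IsUnit (2 : A)) (ha : IsUnit (a 0 - a 1))
    (htf : ∀ c : HatV p a (idealS c₂), (p : HatV p a (idealS c₂)) * c = 0 → c = 0)
    {δX : ArithFlow δA (HatX p a)} (h1 : δX (fnX p a (H1 a)) = 0)
    {δS : ArithFlow δA (HatV p a (idealS c₂))} (h : Induces (idealS c₂) δX δS)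
    {D : Derivation A (Lvl p (HatX p a) 1) (Lvl p (HatX p a) 1)}
    (hD : ∀ i, D (lvlX p a 1 (X i)) = lvlX p a 1 (eulerField a i))
    (hobs : restrictLvl p a (idealS c₂) (obstructionX δX D) = 0) :
    δS.Scales2 (etaS p a c₂) (lambdaS p a c₂) := by
  obtain ⟨D', hD', -, -⟩ := exists_euler_field (isPres_lvlV p a (idealS c₂) 1)
    (Or.inr (Or.inl ⟨c₂, rfl⟩))
  rw [restrictLvl_obstructionX h hD hD'] at hobs
  rw [lambdaS, hasseS_eq]
  have hδ : δS (fnV p a (idealS c₂) (H1 a)) = 0 := by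
    rw [← restrict_fnX, h, h1, map_zero]
  exact scales2_sphere (isPres_lvlV p a (idealS c₂)) (fnV_H2 p a c₂) (isUnit_fnV_polyQ p a _)
    h2 ha htf hδ hD' hobs

end Sphere

end Obstruction

/-! ## Teichmüller constants and pseudo-constants -/

section Constants

/-- The sequence of `p`-power roots of an element of a perfect ring. -/
def rootSeq {k : Type*} [CommRing k] (p : ℕ) [Fact p.Prime] [CharP k p] [PerfectRing k p] (c : k) :
    Perfection k p :=
  ⟨fun n => (frobeniusEquiv k p).symm^[n] c, fun n => by
    beta_reduce
    rw [Function.iterate_succ_apply', frobeniusEquiv_symm_pow_p]⟩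

/-- Consequently a Teichmüller lift has pⁿ-th roots for every n, themselves Teichmüller lifts. -/
theorem rootSeq_pow {k : Type*} [CommRing k] (p : ℕ) [Fact p.Prime] [CharP k p] [PerfectRing k p]
    (c : k) (n : ℕ) : rootSeq p ((frobeniusEquiv k p).symm^[n] c) ^ p ^ n = rootSeq p c := by
  induction n generalizing c with
  | zero => simp
  | succ n ih =>
    rw [Function.iterate_succ_apply, pow_succ, pow_mul, ih]
    ext i
    rw [map_pow]
    change ((frobeniusEquiv k p).symm^[i] ((frobeniusEquiv k p).symm c)) ^ p =
      (frobeniusEquiv k p).symm^[i] c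
    rw [← Function.iterate_succ_apply, Function.iterate_succ_apply', frobeniusEquiv_symm_pow_p]

variable {p : ℕ} {A : Type*} [CommRing A] [IsDomain A] [IsLocalRing A]

/-- The Teichmüller lift t works: writing t = y^{pⁿ}, the congruence φ(y) ≡ y^p modulo p yields φ(t)
≡ t^p modulo p^{n+1} for every n, so δt = 0. -/
theorem exists_constant_of_residue (hp : p.Prime) (hp0 : (p : A) ≠ 0)
    (hmax : IsLocalRing.maximalIdeal A = Ideal.span {(p : A)})
    [hc : IsAdicComplete (IsLocalRing.maximalIdeal A) A]
    [PerfectField (IsLocalRing.ResidueField A)] (δA : PDerivation p A) (x : A) :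
    ∃ t : A, δA t = 0 ∧ IsLocalRing.residue A t = IsLocalRing.residue A x := by
  have : Fact p.Prime := ⟨hp⟩
  have hchar : CharP (IsLocalRing.ResidueField A) p := by
    refine (CharP.charP_iff_prime_eq_zero hp).2 ?_
    rw [← map_natCast (IsLocalRing.residue A), IsLocalRing.residue_eq_zero_iff, hmax]
    exact Ideal.mem_span_singleton_self _
  have : ExpChar (IsLocalRing.ResidueField A) p := ExpChar.prime hp
  have : PerfectRing (IsLocalRing.ResidueField A) p := PerfectField.toPerfectRing p
  have hchar' : CharP (A ⧸ IsLocalRing.maximalIdeal A) p := hchar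
  have hperf' : PerfectRing (A ⧸ IsLocalRing.maximalIdeal A) p := this
  set τ : (A ⧸ IsLocalRing.maximalIdeal A) → A := fun c =>
    Perfection.teichmuller p (IsLocalRing.maximalIdeal A) (rootSeq p c) with hτ
  have hroot : ∀ c n, τ c = τ ((frobeniusEquiv _ p).symm^[n] c) ^ p ^ n := by
    intro c n
    simp only [hτ]
    rw [← map_pow, rootSeq_pow]
  refine ⟨τ (Ideal.Quotient.mk _ x), ?_, Perfection.mk_teichmuller _⟩
  have hfrob : δA.frob (τ (Ideal.Quotient.mk _ x)) - τ (Ideal.Quotient.mk _ x) ^ p = 0 := by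
    have hc' : IsAdicComplete (Ideal.span {(p : A)}) A := hmax ▸ hc
    refine eq_zero_of_forall_pow_dvd (p := p) fun n => ?_
    set y := τ ((frobeniusEquiv _ p).symm^[n] (Ideal.Quotient.mk _ x)) with hy
    rw [hroot _ n, ← hy, map_pow, ← pow_mul, mul_comm, pow_mul]
    have h1 : (p : A) ∣ δA.frob y - y ^ p := ⟨δA y, by rw [δA.frob_apply]; ring⟩
    obtain ⟨d, hd⟩ := dvd_sub_pow_of_dvd_sub h1 n
    exact ⟨p * d, by rw [hd]; ring⟩
  rw [δA.frob_apply, add_sub_cancel_left] at hfrob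
  exact (mul_eq_zero.1 hfrob).resolve_left hp0

/-- Truncate the Teichmüller expansion; its digits are constants. -/
theorem exists_constSubring_near (hp : p.Prime) (hp0 : (p : A) ≠ 0)
    (hmax : IsLocalRing.maximalIdeal A = Ideal.span {(p : A)})
    [IsAdicComplete (IsLocalRing.maximalIdeal A) A]
    [PerfectField (IsLocalRing.ResidueField A)] (δA : PDerivation p A) (n : ℕ) (x : A) :
    ∃ u ∈ constSubring δA, ∃ r, x - u = (p : A) ^ n * r := by
  induction n generalizing x with
  | zero => exact ⟨0, Subring.zero_mem _, x, by simp⟩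
  | succ n ih =>
    obtain ⟨t, ht, htx⟩ := exists_constant_of_residue hp hp0 hmax δA x
    have h1 : x - t ∈ Ideal.span {(p : A)} := by
      rw [← hmax, ← IsLocalRing.residue_eq_zero_iff, map_sub, htx, sub_self]
    obtain ⟨x', hx'⟩ := Ideal.mem_span_singleton.1 h1
    obtain ⟨u, hu, r, hr⟩ := ih x'
    refine ⟨t + p * u, Subring.add_mem _ (Subring.subset_closure ht)
      (Subring.mul_mem _ (natCast_mem _ p) hu), r, ?_⟩
    linear_combination hx' + p * hr

end Constants

section PseudoConstant

variable {p : ℕ} {A : Type*} [CommRing A] {δA : PDerivation p A}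
  {C : Type*} [CommRing C] [Algebra A C]

theorem algebraMap_mem_constSubring (δ : ArithFlow δA C) {r : A} (hr : r ∈ constSubring δA) :
    algebraMap A C r ∈ constSubring δ.toPDerivation := by
  have : constSubring δA ≤ (constSubring δ.toPDerivation).comap (algebraMap A C) := by
    refine Subring.closure_le.2 fun r hr => Subring.subset_closure ?_
    change δ (algebraMap A C r) = 0
    rw [δ.extends_base, hr, map_zero]
  exact this hr

theorem exists_constSubring_near_aeval
    (hA : ∀ (n : ℕ) (x : A), ∃ u ∈ constSubring δA, ∃ r, x - u = (p : A) ^ n * r)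
    (δ : ArithFlow δA C) {σ : Type*} {v : σ → C} (hv : ∀ i, δ (v i) = 0) (n : ℕ)
    (q : MvPolynomial σ A) :
    ∃ s ∈ constSubring δ.toPDerivation, ∃ r, aeval v q - s = (p : C) ^ n * r := by
  induction q using MvPolynomial.induction_on with
  | C c =>
    obtain ⟨u, hu, r, hr⟩ := hA n c
    refine ⟨algebraMap A C u, algebraMap_mem_constSubring δ hu, algebraMap A C r, ?_⟩
    rw [← MvPolynomial.algebraMap_eq, AlgHom.commutes, ← map_sub, hr, map_mul, map_pow,
      map_natCast]
  | add f g hf hg =>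
    obtain ⟨s, hs, r, hr⟩ := hf
    obtain ⟨s', hs', r', hr'⟩ := hg
    refine ⟨s + s', Subring.add_mem _ hs hs', r + r', ?_⟩
    rw [map_add]
    linear_combination hr + hr'
  | mul_X f i hf =>
    obtain ⟨s, hs, r, hr⟩ := hf
    refine ⟨s * v i, Subring.mul_mem _ hs (Subring.subset_closure (hv i)), r * v i, ?_⟩
    rw [map_mul, aeval_X]
    linear_combination v i * hr

theorem isPseudoConstant_mul_inverse [IsAdicComplete (Ideal.span {(p : C)}) C]
    (δ : PDerivation p C) {u α : C} (hu : u ∈ constSubring δ) (hα : IsUnit α)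
    (h : ∀ n : ℕ, ∃ s ∈ constSubring δ, ∃ r, α - s = (p : C) ^ n * r) :
    IsPseudoConstant δ (u * Ring.inverse α) := by
  intro n
  -- Precision n + 1 guarantees agreement modulo p even for n = 0, so that the approximation s
  -- inherits invertibility from α.
  obtain ⟨s, hs, r, hr⟩ := h (n + 1)
  obtain ⟨s, rfl⟩ : IsUnit s := isUnit_of_sub_dvd (p := p) hα ⟨-(p ^ n * r), by
    linear_combination -hr⟩
  refine ⟨u, hu, s, hs, - u * Ring.inverse α * ((s⁻¹ : Cˣ) : C) * (p * r), ?_⟩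
  have h1 := Ring.inverse_mul_cancel _ hα
  have h2 := s.mul_inv
  linear_combination -u * Ring.inverse α * ((s⁻¹ : Cˣ) : C) * hr -
    u * Ring.inverse α * h2 + u * ((s⁻¹ : Cˣ) : C) * h1

end PseudoConstant

/-! ## Detection of functions on a sphere by their restrictions to the curves `E_c` -/

section Detection

variable {A : Type u} [CommRing A] {a : Fin 3 → A}

/-- Substitution of the functions `H₁, H₂, x₃` into a polynomial. -/
def substH (a : Fin 3 → A) : MvPolynomial (Fin 3) A →ₐ[A] MvPolynomial (Fin 3) A :=
  aeval ![H1 a, H2 A, X 2]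

/-- The polynomial ring has the basis `1, x₁, x₂, x₁ x₂` over `A[H₁, H₂, x₃]`. -/
theorem exists_decomposition (ha : IsUnit (a 0 - a 1)) (f : MvPolynomial (Fin 3) A) :
    ∃ g₀ g₁ g₂ g₃, f = substH a g₀ + X 0 * substH a g₁ + X 1 * substH a g₂ +
      X 0 * X 1 * substH a g₃ := by
  obtain ⟨i, hi⟩ := ha.exists_left_inv
  have hi' : (C i : MvPolynomial (Fin 3) A) * (C (a 0) - C (a 1)) = 1 := by
    rw [← map_sub, ← map_mul, hi, map_one]
  have hC : ∀ c : A, substH a (C c) = C c := fun c => (substH a).commutes c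
  have hX0 : substH a (X 0) = C (a 0) * X 0 ^ 2 + C (a 1) * X 1 ^ 2 + C (a 2) * X 2 ^ 2 := by
    simp [substH, H1, Fin.sum_univ_three]
  have hX1 : substH a (X 1) = X 0 ^ 2 + X 1 ^ 2 + X 2 ^ 2 := by
    simp [substH, H2, Fin.sum_univ_three]
  have hX2 : substH a (X 2) = X 2 := by simp [substH]
  -- Solving H₁ and H₂ for the squares: (a₁ - a₂)x₁² = H₁ - a₂H₂ - (a₃ - a₂)x₃², and similarly for
  -- x₂².
  have h0 : ∃ u, substH a u = X 0 ^ 2 := by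
    refine ⟨C i * (X 0 - C (a 1) * X 1 - (C (a 2) - C (a 1)) * X 2 ^ 2), ?_⟩
    simp only [map_mul, map_sub, map_pow, hC, hX0, hX1, hX2]
    linear_combination X 0 ^ 2 * hi'
  have h1 : ∃ u, substH a u = X 1 ^ 2 := by
    refine ⟨-C i * (X 0 - C (a 0) * X 1 - (C (a 2) - C (a 0)) * X 2 ^ 2), ?_⟩
    simp only [map_mul, map_sub, map_pow, map_neg, hC, hX0, hX1, hX2]
    linear_combination X 1 ^ 2 * hi'
  obtain ⟨u0, hu0⟩ := h0
  obtain ⟨u1, hu1⟩ := h1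
  induction f using MvPolynomial.induction_on with
  | C c => exact ⟨C c, 0, 0, 0, by simp [hC]⟩
  | add f g hf hg =>
    obtain ⟨g₀, g₁, g₂, g₃, rfl⟩ := hf
    obtain ⟨g₀', g₁', g₂', g₃', rfl⟩ := hg
    refine ⟨g₀ + g₀', g₁ + g₁', g₂ + g₂', g₃ + g₃', ?_⟩
    simp only [map_add]
    ring
  | mul_X f j hf =>
    obtain ⟨g₀, g₁, g₂, g₃, rfl⟩ := hf
    fin_cases j
    · refine ⟨u0 * g₁, g₀, u0 * g₃, g₂, ?_⟩
      simp only [map_mul, hu0, Fin.zero_eta]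
      ring
    · refine ⟨u1 * g₂, u1 * g₃, g₀, g₁, ?_⟩
      simp only [map_mul, hu1, Fin.mk_one]
      ring
    · refine ⟨X 2 * g₀, X 2 * g₁, X 2 * g₂, X 2 * g₃, ?_⟩
      simp only [map_mul, hX2, Fin.reduceFinMk]
      ring

theorem map_decomposition_eq_zero {R T : Type*} [CommRing R] [CommRing T] [Algebra A R]
    [Algebra A T] (π : R →ₐ[A] T) (x y : R) {f₀ f₁ f₂ f₃ : R} (h₀ : π f₀ = 0) (h₁ : π f₁ = 0)
    (h₂ : π f₂ = 0) (h₃ : π f₃ = 0) : π (f₀ + x * f₁ + y * f₂ + x * y * f₃) = 0 := by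
  simp only [map_add, map_mul, h₀, h₁, h₂, h₃, mul_zero, add_zero]

variable [IsLocalRing A]

/-- Reduction modulo the maximal ideal of the specialization `z₂ = c₂` of a polynomial in
`z₁, z₂, t`, as a polynomial in `z₁`. -/
def specialize (c₂ : A) : MvPolynomial (Fin 3) A →+*
    Polynomial (MvPolynomial (Fin 1) (IsLocalRing.ResidueField A)) :=
  ((MvPolynomial.finSuccEquiv (IsLocalRing.ResidueField A) 1).toRingEquiv.toRingHom.comp
    (MvPolynomial.map (IsLocalRing.residue A))).comp
    (aeval ![X 0, C c₂, X 1] : MvPolynomial (Fin 3) A →ₐ[A] MvPolynomial (Fin 2) A).toRingHom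

theorem specialize_apply (c₂ : A) (g : MvPolynomial (Fin 3) A) :
    specialize c₂ g = MvPolynomial.finSuccEquiv (IsLocalRing.ResidueField A) 1
      (MvPolynomial.map (IsLocalRing.residue A)
        (aeval ![X 0, C c₂, X 1] g : MvPolynomial (Fin 2) A)) := rfl

variable {p : ℕ}

/-- On the sphere modulo p, H₂ equals c₂, so the substituted function depends only on the
specialization z₂ = c₂ of g modulo p. -/
theorem lvlV_substH_eq_zero (hmax : IsLocalRing.maximalIdeal A = Ideal.span {(p : A)})
    {c₂ : A} {g : MvPolynomial (Fin 3) A} (hg : specialize c₂ g = 0) :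
    lvlV p a (idealS c₂) 1 (substH a g) = 0 := by
  rw [specialize_apply, EmbeddingLike.map_eq_zero_iff] at hg
  obtain ⟨q, hq⟩ := map_residue_eq_zero hmax hg
  set π := lvlV p a (idealS c₂) 1
  have hp : (p : Lvl p (HatV p a (idealS c₂)) 1) = 0 := by
    simpa using lvl_natCast_pow (p := p) (C := HatV p a (idealS c₂)) 1
  have h2 : π (H2 A) = algebraMap A _ c₂ := by
    change Ideal.Quotient.mk _ (fnV p a (idealS c₂) (H2 A)) = _
    rw [fnV_H2]; rfl
  have h : π.comp (substH a) = (aeval ![π (H1 a), π (X 2)]).comp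
      (aeval ![X 0, C c₂, X 1] : MvPolynomial (Fin 3) A →ₐ[A] MvPolynomial (Fin 2) A) := by
    refine MvPolynomial.algHom_ext fun i => ?_
    fin_cases i
    · simp [substH]
    · simp [substH, h2]
    · simp [substH]
  have h' := congrArg (fun e => e g) h
  simp only [AlgHom.comp_apply] at h'
  rw [h', hq, map_mul, map_natCast, hp, zero_mul]

/-- Evaluate at generic points of E_c. In an algebraically closed field L containing k[t], put x₃ =
t and let x₁, x₂ be the square roots dictated by the equations. The four sign choices give four
L-points of E_c ∩ X where κ vanishes, and they separate the coefficients of 1, x₁, x₂, x₁x₂. -/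
theorem eval_specialize_eq_zero {L : Type u} [Field L] [IsAlgClosed L]
    (j : MvPolynomial (Fin 1) (IsLocalRing.ResidueField A) →+* L) (hj : Function.Injective j)
    (hmax : IsLocalRing.maximalIdeal A = Ideal.span {(p : A)}) (h2 : IsUnit (2 : A))
    (ha : IsUnit (a 0 - a 1))
    (ha' : IsUnit (a 1 - a 2)) (ha'' : IsUnit (a 2 - a 0)) {c₁ c₂ : A}
    (hc : IsUnit (aeval ![c₁, c₂] (discN a) * aeval ![c₁, c₂] (hasse p a)))
    {κ : Lvl p (HatX p a) 1} (hκ : restrictLvl p a (idealE a c₁ c₂) κ = 0) {m : ℕ}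
    {g₀ g₁ g₂ g₃ : MvPolynomial (Fin 3) A}
    (hf : κ * lvlX p a 1 (polyQ p a) ^ m = lvlX p a 1 (substH a g₀ + X 0 * substH a g₁ +
      X 1 * substH a g₂ + X 0 * X 1 * substH a g₃)) :
    ∀ g ∈ [g₀, g₁, g₂, g₃],
      Polynomial.eval (C (IsLocalRing.residue A c₁)) (specialize c₂ g) = 0 := by
  set r := IsLocalRing.residue A
  let algL : Algebra A L := (j.comp (C.comp r)).toAlgebra
  have halg : ∀ x : A, algebraMap A L x = j (C (r x)) := fun _ => rfl
  have hunit : ∀ x : A, IsUnit x → algebraMap A L x ≠ 0 := fun x hx => (hx.map _).ne_zero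
  have hpL : (p : L) = 0 := by
    rw [← map_natCast (algebraMap A L), halg]
    have : r (p : A) = 0 := by
      rw [IsLocalRing.residue_eq_zero_iff, hmax]; exact Ideal.mem_span_singleton_self _
    rw [this, map_zero, map_zero]
  set t : L := j (X 0)
  -- As t is transcendental over k, such a quadratic in t is nonzero. This keeps x₁ and x₂ nonzero,
  -- hence Q invertible at the points used.
  have hquad : ∀ x y : A, IsUnit x → algebraMap A L x * t ^ 2 + algebraMap A L y ≠ 0 := by
    intro x y hx h0
    have h1 : j (C (r x) * X 0 ^ 2 + C (r y)) = 0 := by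
      rw [map_add, map_mul, map_pow, ← halg, ← halg]; exact h0
    rw [map_eq_zero_iff j hj] at h1
    have h3 := congrArg (eval fun _ => 1) h1
    have h4 := congrArg (eval fun _ => 0) h1
    simp only [map_add, map_mul, map_pow, eval_C, eval_X, map_zero] at h3 h4
    refine (hx.map r).ne_zero ?_
    linear_combination h3 - h4
  have hsqrt : ∀ x y z : A, IsUnit x → IsUnit y → ∃ s : L, s ≠ 0 ∧
      algebraMap A L x * s ^ 2 + algebraMap A L y * t ^ 2 - algebraMap A L z = 0 := by
    intro x y z hx hy
    obtain ⟨s, hs⟩ := IsAlgClosed.exists_pow_nat_eq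
      (-(algebraMap A L y * t ^ 2 + algebraMap A L (-z)) / algebraMap A L x) two_pos
    have hs' : algebraMap A L x * s ^ 2 = -(algebraMap A L y * t ^ 2 + algebraMap A L (-z)) := by
      rw [hs, mul_div_cancel₀ _ (hunit x hx)]
    refine ⟨s, fun h0 => hquad y (-z) hy ?_, ?_⟩
    · rw [h0] at hs'
      linear_combination hs'
    · rw [hs', map_neg]; ring
  obtain ⟨s0, hs0, hs0'⟩ := hsqrt (a 0 - a 1) (a 2 - a 1) (c₁ - a 1 * c₂) ha
    (by rw [← neg_sub]; exact ha'.neg)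
  obtain ⟨s1, hs1, hs1'⟩ := hsqrt (a 1 - a 0) (a 2 - a 0) (c₁ - a 0 * c₂)
    (by rw [← neg_sub]; exact ha.neg) ha''
  have hvanish : ∀ σ τ : L, σ ^ 2 = s0 ^ 2 → τ ^ 2 = s1 ^ 2 →
      (j (Polynomial.eval (C (r c₁)) (specialize c₂ g₀)) +
        σ * j (Polynomial.eval (C (r c₁)) (specialize c₂ g₁)) +
        τ * j (Polynomial.eval (C (r c₁)) (specialize c₂ g₂)) +
        σ * τ * j (Polynomial.eval (C (r c₁)) (specialize c₂ g₃)) = 0) := by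
    intro σ τ hσ hτ
    set ψ : MvPolynomial (Fin 3) A →ₐ[A] L := aeval ![σ, τ, t] with hψ
    have hψC : ∀ c, ψ (C c) = algebraMap A L c := ψ.commutes
    have hψ0 : ψ (X 0) = σ := by simp [ψ]
    have hψ1 : ψ (X 1) = τ := by simp [ψ]
    have hψ2 : ψ (X 2) = t := by simp [ψ]
    have hJ : ∀ f ∈ idealE a c₁ c₂, ψ f = 0 := by
      rw [idealE_eq ha]
      refine fun f hf => (Ideal.span_le (I := RingHom.ker ψ)).2 ?_ hf
      rintro f (rfl | rfl)
      · change ψ _ = 0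
        simp only [curveEq₁, map_add, map_sub, map_mul, map_pow, hψC, hψ0, hψ2, hσ]
        simp only [map_sub, map_mul] at hs0'
        exact hs0'
      · change ψ _ = 0
        simp only [curveEq₂, map_add, map_sub, map_mul, map_pow, hψC, hψ1, hψ2, hτ]
        simp only [map_sub, map_mul] at hs1'
        exact hs1'
    have hH1 : ψ (H1 a) = algebraMap A L c₁ := by
      have := hJ _ (H1_sub_mem_idealE c₁ c₂)
      rwa [map_sub, hψC, sub_eq_zero] at this
    have hH2 : ψ (H2 A) = algebraMap A L c₂ := by
      have := hJ _ (H2_sub_mem_idealE c₁ c₂)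
      rwa [map_sub, hψC, sub_eq_zero] at this
    have hsub : ∀ q : MvPolynomial (Fin 2) A, ψ (aeval ![H1 a, H2 A] q) =
        algebraMap A L (aeval ![c₁, c₂] q) := by
      intro q
      rw [← AlgHom.comp_apply, comp_aeval, ← MvPolynomial.aeval_algebraMap_apply]
      congr 2
      funext i
      fin_cases i
      · exact hH1
      · exact hH2
    have hQ : IsUnit (ψ (polyQ p a)) := by
      rw [isUnit_iff_ne_zero, polyQ, map_mul, map_mul, map_mul, hsub, hsub, hψ0, hψ1, mul_assoc,
        ← map_mul]
      refine mul_ne_zero (mul_ne_zero ?_ ?_) (hunit _ hc)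
      · rintro rfl
        exact hs0 (pow_eq_zero_iff two_ne_zero |>.1 (by rw [← hσ]; ring))
      · rintro rfl
        exact hs1 (pow_eq_zero_iff two_ne_zero |>.1 (by rw [← hτ]; ring))
    obtain ⟨Ψ, hΨ⟩ := (isPres_lvlV p a (idealE a c₁ c₂) 1).lift L ψ hQ (by
      have : idealE a c₁ c₂ ⊔ Ideal.span {(p : MvPolynomial (Fin 3) A) ^ 1} ≤
          RingHom.ker ψ := by
        refine sup_le (fun f hf => hJ f hf) ?_
        rw [Ideal.span_singleton_le_iff_mem, RingHom.mem_ker, map_pow, map_natCast, hpL, pow_one]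
      exact fun f hf => this hf)
    have hzero := congrArg (fun x => Ψ (restrictLvl p a (idealE a c₁ c₂) x)) hf
    simp only [map_mul, hκ, zero_mul, map_zero, restrictLvl_lvlX, hΨ] at hzero
    have hfC : ∀ x : IsLocalRing.ResidueField A, MvPolynomial.finSuccEquiv _ 1 (C x) =
        Polynomial.C (C x) := fun x => (MvPolynomial.finSuccEquiv _ 1).commutes x
    have hcoef : ∀ g, ψ (substH a g) = j (Polynomial.eval (C (r c₁)) (specialize c₂ g)) := by
      have h : ψ.toRingHom.comp (substH a).toRingHom =
          (j.comp (Polynomial.evalRingHom (C (r c₁)))).comp (specialize c₂) := by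
        refine MvPolynomial.ringHom_ext (fun c => ?_) fun i => ?_
        · change ψ (substH a (C c)) = j (Polynomial.eval (C (r c₁)) (specialize c₂ (C c)))
          have : substH a (C c) = C c := (substH a).commutes c
          rw [this, hψC, specialize_apply]
          simp [halg, r, hfC]
        · change ψ (substH a (X i)) = j (Polynomial.eval (C (r c₁)) (specialize c₂ (X i)))
          rw [specialize_apply, substH, aeval_X, aeval_X]
          fin_cases i
          · simp [hH1, halg, r, finSuccEquiv_X_zero]
          · simp [hH2, halg, r, hfC]
          · have := finSuccEquiv_X_succ (R := IsLocalRing.ResidueField A) (n := 1) (j := 0)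
            simp only [Fin.succ_zero_eq_one] at this
            simp [hψ2, t, this]
      exact fun g => congrArg (fun e : MvPolynomial (Fin 3) A →+* L => e g) h
    simp only [map_add, map_mul, hψ0, hψ1, hcoef] at hzero
    exact hzero.symm
  have h2L : (2 : L) ≠ 0 := by
    have := hunit 2 h2
    rwa [map_ofNat] at this
  -- The signed sums of these four relations are 4 times each coefficient times 1, x₁, x₂ or x₁x₂,
  -- and those multipliers are nonzero.
  have v1 := hvanish s0 s1 rfl rfl
  have v2 := hvanish (-s0) s1 (by ring) rfl
  have v3 := hvanish s0 (-s1) rfl (by ring)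
  have v4 := hvanish (-s0) (-s1) (by ring) (by ring)
  have key : ∀ {x y : L}, y ≠ 0 → y * x = 0 → x = 0 := fun hy h => (mul_eq_zero.1 h).resolve_left hy
  intro g hg
  rw [← map_eq_zero_iff j hj]
  simp only [List.mem_cons, List.not_mem_nil, or_false] at hg
  have h4 := mul_ne_zero h2L h2L
  obtain rfl | rfl | rfl | rfl := hg
  · exact key h4 (by linear_combination v1 + v2 + v3 + v4)
  · exact key (mul_ne_zero h4 hs0) (by linear_combination v1 - v2 + v3 - v4)
  · exact key (mul_ne_zero h4 hs1) (by linear_combination v1 + v2 - v3 - v4)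
  · exact key (mul_ne_zero h4 (mul_ne_zero hs0 hs1)) (by linear_combination v1 - v2 - v3 + v4)

/-- If A_{p-1}(z, c₂) vanishes modulo p, then Q becomes both zero and invertible on the sphere
modulo p, so the ring there is zero. -/
theorem restrictLvl_eq_zero_of_hasse
    (hmax : IsLocalRing.maximalIdeal A = Ideal.span {(p : A)}) {c₂ : A}
    (h : Polynomial.map (IsLocalRing.residue A)
      (aeval ![Polynomial.X, Polynomial.C c₂] (hasse p a)) = 0) (x : Lvl p (HatV p a (idealS c₂)) 1) :
    x = 0 := by
  have hP := isPres_lvlV p a (idealS c₂) 1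
  set π := lvlV p a (idealS c₂) 1
  have hp : (p : Lvl p (HatV p a (idealS c₂)) 1) = 0 := by
    simpa using lvl_natCast_pow (p := p) (C := HatV p a (idealS c₂)) 1
  have h2 : π (H2 A) = algebraMap A _ c₂ := by
    change Ideal.Quotient.mk _ (fnV p a (idealS c₂) (H2 A)) = _
    rw [fnV_H2]; rfl
  set q : Polynomial A := aeval ![Polynomial.X, Polynomial.C c₂] (hasse p a) with hq
  have hdvd : Polynomial.C (p : A) ∣ q := by
    rw [Polynomial.C_dvd_iff_dvd_coeff]
    intro i
    rw [← Ideal.mem_span_singleton, ← hmax, ← IsLocalRing.residue_eq_zero_iff,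
      ← Polynomial.coeff_map, h, Polynomial.coeff_zero]
  have h1 : π (hasseH p a) = Polynomial.aeval (π (H1 a)) q := by
    rw [hq, hasseH, ← AlgHom.comp_apply, ← AlgHom.comp_apply, comp_aeval, comp_aeval]
    congr 2
    funext i
    fin_cases i
    · simp
    · simp [h2]
  have h0 : π (hasseH p a) = 0 := by
    obtain ⟨q', hq'⟩ := hdvd
    rw [h1, hq', map_mul, map_natCast, map_natCast, hp, zero_mul]
  have hu := (isUnit_of_polyQ hP.isUnit).2.2.2
  rw [h0, isUnit_zero_iff] at hu
  exact eq_zero_of_zero_eq_one hu x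

/-- A function modulo `p` on `X` that vanishes on the curves `E_c` over the sphere `S_{c₂}`, where
`c₁` runs through an infinite set of residue classes, vanishes on `S_{c₂}`. -/
theorem restrictLvl_idealS_eq_zero [Infinite (IsLocalRing.ResidueField A)]
    (hmax : IsLocalRing.maximalIdeal A = Ideal.span {(p : A)}) (h2 : IsUnit (2 : A))
    (ha : IsUnit (a 0 - a 1)) (ha' : IsUnit (a 1 - a 2)) (ha'' : IsUnit (a 2 - a 0)) {c₂ : A}
    {P : A → Prop}
    (hlift : ∀ x : A, ∃ t, P t ∧ IsLocalRing.residue A t = IsLocalRing.residue A x)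
    {κ : Lvl p (HatX p a) 1}
    (h : ∀ c₁, P c₁ → IsUnit (aeval ![c₁, c₂] (discN a) * aeval ![c₁, c₂] (hasse p a)) →
      restrictLvl p a (idealE a c₁ c₂) κ = 0) :
    restrictLvl p a (idealS c₂) κ = 0 := by
  set r := IsLocalRing.residue A
  set B : Polynomial (IsLocalRing.ResidueField A) := Polynomial.map r
    (aeval ![Polynomial.X, Polynomial.C c₂] (discN a * hasse p a)) with hB
  have hdisc : Polynomial.map r (aeval ![Polynomial.X, Polynomial.C c₂] (discN a)) ≠ 0 := by
    have : Polynomial.map r (aeval ![Polynomial.X, Polynomial.C c₂] (discN a)) =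
        ∏ i, (Polynomial.X - Polynomial.C (r (a i * c₂))) := by
      simp only [discN, map_prod, map_sub, map_mul, aeval_X, Polynomial.map_prod]
      refine Finset.prod_congr rfl fun i _ => ?_
      rw [← MvPolynomial.algebraMap_eq, AlgHom.commutes, Polynomial.algebraMap_eq]
      simp
    rw [this, Finset.prod_ne_zero_iff]
    exact fun i _ => Polynomial.X_sub_C_ne_zero _
  -- N(z, c₂) is monic in z, so B can vanish only through the Hasse invariant; in that case the
  -- sphere is empty modulo p.
  by_cases hB0 : B = 0
  · rw [hB, map_mul, Polynomial.map_mul, mul_eq_zero] at hB0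
    exact restrictLvl_eq_zero_of_hasse hmax (hB0.resolve_left hdisc) _
  obtain ⟨f, m, hf⟩ := (isPres_lvlX p a 1).gen κ
  obtain ⟨g₀, g₁, g₂, g₃, rfl⟩ := exists_decomposition ha f
  let L := AlgebraicClosure (FractionRing (MvPolynomial (Fin 1) (IsLocalRing.ResidueField A)))
  let j : MvPolynomial (Fin 1) (IsLocalRing.ResidueField A) →+* L :=
    (algebraMap (FractionRing (MvPolynomial (Fin 1) (IsLocalRing.ResidueField A))) L).comp
      (algebraMap _ _)
  have hj : Function.Injective j :=
    (algebraMap (FractionRing (MvPolynomial (Fin 1) (IsLocalRing.ResidueField A))) L).injective.comp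
      (IsFractionRing.injective _ _)
  have hzero : ∀ g ∈ [g₀, g₁, g₂, g₃], specialize c₂ g = 0 := by
    intro g hg
    -- Each coefficient is a polynomial in z₁ over k[t], and it vanishes at every class of k that is
    -- not a root of B.
    refine Polynomial.eq_zero_of_infinite_isRoot _ ?_
    have hfin : {c : IsLocalRing.ResidueField A | B.IsRoot c}.Finite :=
      Polynomial.finite_setOfPred_isRoot hB0
    refine Set.Infinite.mono ?_ ((hfin.infinite_compl).image
      (f := (C : IsLocalRing.ResidueField A →
        MvPolynomial (Fin 1) (IsLocalRing.ResidueField A))) (C_injective _ _).injOn)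
    rintro _ ⟨c, hc, rfl⟩
    obtain ⟨x, rfl⟩ := IsLocalRing.residue_surjective c
    obtain ⟨c₁, hPc, hcx⟩ := hlift x
    rw [← hcx] at hc ⊢
    refine eval_specialize_eq_zero j hj hmax h2 ha ha' ha'' ?_ (h c₁ hPc ?_) hf g hg
    all_goals
      have hval : B.eval (r c₁) =
          r (aeval ![c₁, c₂] (discN a) * aeval ![c₁, c₂] (hasse p a)) := by
        rw [hB, Polynomial.eval_map, Polynomial.eval₂_at_apply, ← map_mul]
        congr 1
        rw [← Polynomial.coe_aeval_eq_eval, ← AlgHom.comp_apply, comp_aeval]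
        congr 2
        funext i
        fin_cases i <;> simp
      by_contra hnu
      refine hc ?_
      change B.eval _ = 0
      rw [hval, IsLocalRing.residue_eq_zero_iff]
      exact (IsLocalRing.mem_maximalIdeal _).2 hnu
  have hu := ((isPres_lvlV p a (idealS c₂) 1).isUnit.pow m)
  rw [← hu.mul_left_eq_zero, ← restrictLvl_lvlX, ← map_pow, ← map_mul, hf, restrictLvl_lvlX]
  have hz : ∀ g ∈ [g₀, g₁, g₂, g₃], lvlV p a (idealS c₂) 1 (substH a g) = 0 := fun g hg =>
    lvlV_substH_eq_zero hmax (hzero g hg)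
  exact map_decomposition_eq_zero _ _ _ (hz g₀ (by simp)) (hz g₁ (by simp)) (hz g₂ (by simp))
    (hz g₃ (by simp))

end Detection

/-! ## Existence of an Euler flow -/

section Antiderivative

/-- Integrating x^j requires j + 1 prime to p. The bad exponents are p - 1, whose term is removed,
and 2p - 1 onwards, which the degree bound excludes. -/
theorem exists_antiderivative {p : ℕ} (hp : p.Prime) {R : Type*} [CommRing R]
    (hu : ∀ n : ℕ, p.Coprime n → IsUnit (n : R)) (Φ : Polynomial R)
    (hΦ : Φ.natDegree ≤ 2 * (p - 1)) :
    ∃ G : Polynomial R, Polynomial.derivative G =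
      Φ - Polynomial.C (Φ.coeff (p - 1)) * Polynomial.X ^ (p - 1) := by
  have hp2 := hp.two_le
  refine ⟨∑ j ∈ (Finset.range (2 * p - 1)).erase (p - 1),
    Polynomial.C (Ring.inverse ((j + 1 : ℕ) : R) * Φ.coeff j) * Polynomial.X ^ (j + 1), ?_⟩
  have h1 : Φ = ∑ j ∈ Finset.range (2 * p - 1),
      Polynomial.C (Φ.coeff j) * Polynomial.X ^ j :=
    Φ.as_sum_range_C_mul_X_pow' (by omega)
  rw [eq_sub_iff_add_eq']
  refine Eq.trans ?_ h1.symm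
  rw [← Finset.add_sum_erase _ _ (Finset.mem_range.2 (by omega : p - 1 < 2 * p - 1)),
    Polynomial.derivative_sum]
  refine congrArg _ (Finset.sum_congr rfl fun j hj => ?_)
  rw [Finset.mem_erase, Finset.mem_range] at hj
  have hc : IsUnit ((j + 1 : ℕ) : R) := by
    refine hu _ ((Nat.Prime.coprime_iff_not_dvd hp).2 fun ⟨k, hk⟩ => ?_)
    obtain rfl | rfl | hk2 : k = 0 ∨ k = 1 ∨ 2 ≤ k := by omega
    · omega
    · omega
    · have := Nat.mul_le_mul_left p hk2
      omega
  rw [Polynomial.derivative_C_mul_X_pow, Nat.add_sub_cancel, mul_right_comm,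
    Ring.inverse_mul_cancel _ hc, one_mul]

theorem derivation_eval₂ {A R T : Type*} [CommRing A] [CommRing R] [CommRing T] [Algebra A T]
    (D : Derivation A T T) (ρ : R →+* T) (hρ : ∀ r, D (ρ r) = 0) (x : T) (G : Polynomial R) :
    D (G.eval₂ ρ x) = (Polynomial.derivative G).eval₂ ρ x * D x := by
  induction G using Polynomial.induction_on' with
  | add f g hf hg => simp only [Polynomial.eval₂_add, map_add, hf, hg, add_mul]
  | monomial n r =>
    rw [Polynomial.eval₂_monomial, Polynomial.derivative_monomial, Polynomial.eval₂_monomial,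
      Derivation.leibniz, Derivation.leibniz_pow, hρ, map_mul, map_natCast]
    simp only [smul_eq_mul, nsmul_eq_mul]
    ring

theorem derivation_aeval_eq_zero {A T : Type*} [CommRing A] [CommRing T] [Algebra A T]
    {σ : Type*} (D : Derivation A T T) {v : σ → T} (hv : ∀ i, D (v i) = 0) (q : MvPolynomial σ A) :
    D (aeval v q) = 0 := by
  induction q using MvPolynomial.induction_on with
  | C c => rw [aeval_C, Derivation.map_algebraMap]
  | add f g hf hg => rw [map_add, map_add, hf, hg, add_zero]
  | mul_X f i hf => rw [map_mul, aeval_X, Derivation.leibniz, hf, hv, smul_zero, smul_zero, add_zero]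

variable {A : Type*} [CommRing A] (a : Fin 3 → A)

/-- Evaluation at the prime integrals and at `x₃`. -/
def evalIntegrals : Polynomial (MvPolynomial (Fin 2) A) →+* MvPolynomial (Fin 3) A :=
  Polynomial.eval₂RingHom (aeval ![H1 a, H2 A] : MvPolynomial (Fin 2) A →ₐ[A] _).toRingHom (X 2)

theorem evalIntegrals_C (q : MvPolynomial (Fin 2) A) :
    evalIntegrals a (Polynomial.C q) = aeval ![H1 a, H2 A] q :=
  Polynomial.eval₂_C _ _

theorem evalIntegrals_X : evalIntegrals a Polynomial.X = X 2 :=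
  Polynomial.eval₂_X _ _

/-- The equation `y² = F(x₃)` of the curves. -/
theorem evalIntegrals_quartic : evalIntegrals a (quartic a) = yfun a ^ 2 := by
  simp only [quartic, map_mul, map_add, map_sub, map_pow, evalIntegrals_C, evalIntegrals_X, aeval_X,
    Matrix.cons_val_zero, Matrix.cons_val_one, H1, H2, Fin.sum_univ_three, yfun, algHom_C,
    MvPolynomial.algebraMap_eq]
  ring

theorem natDegree_quartic_pow_le (n : ℕ) : (quartic a ^ n).natDegree ≤ n * 4 := by
  refine Polynomial.natDegree_pow_le_of_le n ?_
  unfold quartic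
  compute_degree

/-- With y² = F(x₃) and p odd, y^p = F^{(p-1)/2}(x₃) y. Since D kills H₁ and H₂, the chain rule
gives D(G(x₃)) = G'(x₃) y, where G is the antiderivative of F^{(p-1)/2} without its x^{p-1} term. -/
theorem exists_antiderivative_integrals {p : ℕ} (hp : p.Prime) (hodd : p ≠ 2)
    (hu : ∀ n : ℕ, p.Coprime n → IsUnit (n : A)) :
    ∃ g : MvPolynomial (Fin 3) A, ∀ {T : Type _} [CommRing T] [Algebra A T]
      (π : MvPolynomial (Fin 3) A →ₐ[A] T) (D : Derivation A T T), D (π (H1 a)) = 0 →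
      D (π (H2 A)) = 0 → D (π (X 2)) = π (yfun a) →
      D (π g) = π (yfun a) ^ p - π (hasseH p a) * π (X 2) ^ (p - 1) * π (yfun a) := by
  have hp2 := hp.two_le
  obtain ⟨k, hk⟩ := hp.odd_of_ne_two hodd
  obtain ⟨G, hG⟩ := exists_antiderivative hp (R := MvPolynomial (Fin 2) A) (fun n hn => by
    have := (hu n hn).map (C : A →+* MvPolynomial (Fin 2) A)
    rwa [map_natCast] at this) (quartic a ^ ((p - 1) / 2))
    ((natDegree_quartic_pow_le a _).trans (by omega))
  refine ⟨evalIntegrals a G, fun {T} _ _ π D h1 h2 h3 => ?_⟩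
  have hπ : ∀ F, π (evalIntegrals a F) =
      F.eval₂ (π.toRingHom.comp (aeval ![H1 a, H2 A] : MvPolynomial (Fin 2) A →ₐ[A] _).toRingHom)
        (π (X 2)) := fun F => Polynomial.hom_eval₂ F _ π.toRingHom (X 2)
  rw [hπ, derivation_eval₂ D _ (fun q => ?_), ← hπ, hG, h3]
  · rw [map_sub, map_mul, map_pow, map_pow, evalIntegrals_C, evalIntegrals_X,
      evalIntegrals_quartic, ← pow_mul, map_sub, map_mul, map_pow, map_pow, sub_mul,
      ← pow_succ, show 2 * ((p - 1) / 2) + 1 = p by omega]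
    rfl
  · change D (π (aeval ![H1 a, H2 A] q)) = 0
    rw [← AlgHom.comp_apply, comp_aeval]
    refine derivation_aeval_eq_zero D (fun i => ?_) q
    fin_cases i
    · exact h1
    · exact h2

end Antiderivative

/-! ### Square roots and Frobenius lifts over complete rings -/

section Lift

variable {p : ℕ} {C : Type*} [CommRing C]

variable (C) in
/-- The Frobenius endomorphism of `C / p`. -/
def lvlFrobenius (hp : p.Prime) : Lvl p C 1 →+* Lvl p C 1 where
  toFun x := x ^ p
  map_one' := one_pow _
  map_mul' x y := mul_pow x y p
  map_zero' := zero_pow hp.ne_zero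
  map_add' x y := by
    obtain ⟨r, hr⟩ := exists_add_pow_prime_eq hp x y
    have h0 : (p : Lvl p C 1) = 0 := by simpa using lvl_natCast_pow (p := p) (C := C) 1
    rw [hr, h0]
    ring

variable [hC : IsAdicComplete (Ideal.span {(p : C)}) C]

/-- The quotient w/z² has the form 1 + pu, so Hensel's lemma gives it a root congruent to 1. -/
theorem exists_sqrt (h2 : IsUnit (2 : C)) {z w : C} (hz : IsUnit z)
    (h : (Ideal.Quotient.mk _ w : Lvl p C 1) = (Ideal.Quotient.mk _ z) ^ 2) :
    ∃ s, s ^ 2 = w ∧ (Ideal.Quotient.mk _ s : Lvl p C 1) = Ideal.Quotient.mk _ z := by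
  rw [← map_pow, ← sub_eq_zero, ← map_sub] at h
  obtain ⟨d, hd⟩ := nsmul_of_lvl_one h
  obtain ⟨i, hi⟩ := hz.exists_right_inv
  obtain ⟨s, r, hs, hr⟩ := exists_sq_eq_one_add (p := p) h2 (d * i ^ 2)
  refine ⟨z * s, ?_, ?_⟩
  · rw [mul_pow, hs]
    linear_combination -hd + p * d * (z * i + 1) * hi
  · rw [← sub_eq_zero, ← map_sub, lvl_mk_eq_zero]
    exact ⟨z * r, by rw [hr]; ring⟩

theorem exists_completion_lift {R : Type*} [CommRing R] (θ : R →+* C) :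
    ∃ φ : PHat p R →+* C, ∀ r, φ (algebraMap R _ r) = θ r := by
  refine ⟨IsAdicComplete.liftRingHom (Ideal.span {(p : C)}) (completionLvl p θ)
    (completionLvl_compat p θ), fun r => eq_of_sub_eq_zero (eq_zero_of_forall_pow_dvd (p := p)
    fun n => ?_)⟩
  have h := IsAdicComplete.mk_liftRingHom (Ideal.span {(p : C)}) (completionLvl p θ)
    (completionLvl_compat p θ) n (algebraMap R _ r)
  have h' : completionLvl p θ n (algebraMap R _ r) = Ideal.Quotient.mk _ (θ r) := by
    simp [completionLvl, AdicCompletion.algebraMap_apply]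
  rw [h', Ideal.Quotient.eq, Ideal.span_singleton_pow, Ideal.mem_span_singleton] at h
  exact h

end Lift

section FrobLift

variable {p : ℕ} {A : Type u} [CommRing A] {a : Fin 3 → A} {δA : PDerivation p A}
  {C : Type u} [CommRing C] [Algebra A C]

theorem lvl_frob_base (c : A) :
    (Ideal.Quotient.mk _ (algebraMap A C (δA.frob c)) : Lvl p C 1) =
      (Ideal.Quotient.mk _ (algebraMap A C c)) ^ p := by
  rw [δA.frob_apply, map_add, map_pow, map_mul, map_natCast, map_add, map_pow, add_eq_left,
    lvl_mk_eq_zero]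
  exact ⟨_, by rw [pow_one]⟩

variable [IsAdicComplete (Ideal.span {(p : C)}) C]

/-- A lift of Frobenius on polynomials with prime integrals `H₁`, `H₂` and with a given value on
`x₃`. -/
theorem exists_frobenius_lift (hp : p.Prime) (h2 : IsUnit (2 : A)) (ha : IsUnit (a 0 - a 1))
    (e : MvPolynomial (Fin 3) A →ₐ[A] C) (hQ : IsUnit (e (polyQ p a))) (f : C) :
    ∃ φ : MvPolynomial (Fin 3) A →+* C, (∀ c, φ (MvPolynomial.C c) = algebraMap A C (δA.frob c)) ∧
      φ (X 2) = e (X 2) ^ p + p * f ∧ φ (H1 a) = e (H1 a) ^ p ∧ φ (H2 A) = e (H2 A) ^ p ∧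
      ∀ g, (Ideal.Quotient.mk _ (φ g) : Lvl p C 1) = (Ideal.Quotient.mk _ (e g)) ^ p := by
  obtain ⟨u0, u1, -, -⟩ := isUnit_of_polyQ hQ
  set F := lvlFrobenius C hp
  have hF : ∀ x, F x = x ^ p := fun _ => rfl
  set b : Fin 3 → C := fun i => algebraMap A C (δA.frob (a i)) with hb
  have hbF : ∀ i, (Ideal.Quotient.mk _ (b i) : Lvl p C 1) =
      F (Ideal.Quotient.mk _ (algebraMap A C (a i))) := fun i => lvl_frob_base (a i)
  have hbu : IsUnit (b 0 - b 1) := by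
    simp only [hb, ← map_sub]
    exact (ha.map δA.frob).map _
  obtain ⟨i, hi⟩ := hbu.exists_right_inv
  have hi' := congrArg (Ideal.Quotient.mk (Ideal.span {(p : C) ^ 1})) hi
  rw [map_mul, map_one, map_sub, hbF, hbF] at hi'
  set y2 := e (X 2) ^ p + p * f with hy2
  have hy2F : (Ideal.Quotient.mk _ y2 : Lvl p C 1) = F (Ideal.Quotient.mk _ (e (X 2))) := by
    rw [hy2, map_add, map_pow, hF, add_eq_left, lvl_mk_eq_zero]
    exact ⟨f, by rw [pow_one]⟩
  -- The argument `w` is the only possible value of φ(x₁)²: it solves, with the twisted coefficients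
  -- φ(a_i), the linear system imposed by φ(H₁) = H₁^p, φ(H₂) = H₂^p and φ(x₃). Modulo p it is
  -- (x₁^p)².
  obtain ⟨y0, hy0, hy0F⟩ := exists_sqrt (p := p) (isUnit_two_of_base h2)
    (z := e (X 0) ^ p) (w := i * (e (H1 a) ^ p - b 1 * e (H2 A) ^ p - (b 2 - b 1) * y2 ^ 2))
    (u0.pow p) (by
      simp only [map_mul, map_sub, map_pow, hbF, hy2F, ← hF]
      rw [map_H1, map_H2]
      simp only [map_add, map_mul, map_pow] at hi' ⊢
      linear_combination (F (Ideal.Quotient.mk _ (e (X 0)))) ^ 2 * hi')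
  obtain ⟨y1, hy1, hy1F⟩ := exists_sqrt (p := p) (isUnit_two_of_base h2)
    (z := e (X 1) ^ p) (w := -i * (e (H1 a) ^ p - b 0 * e (H2 A) ^ p - (b 2 - b 0) * y2 ^ 2))
    (u1.pow p) (by
      simp only [map_mul, map_sub, map_pow, map_neg, hbF, hy2F, ← hF]
      rw [map_H1, map_H2]
      simp only [map_add, map_mul, map_pow] at hi' ⊢
      linear_combination (F (Ideal.Quotient.mk _ (e (X 1)))) ^ 2 * hi')
  refine ⟨eval₂Hom ((algebraMap A C).comp δA.frob) ![y0, y1, y2], fun c => eval₂Hom_C _ _ c,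
    eval₂Hom_X' _ _ 2, ?_, ?_, fun g => ?_⟩
  · have h : eval₂Hom ((algebraMap A C).comp δA.frob) ![y0, y1, y2] (H1 a) =
        b 0 * y0 ^ 2 + b 1 * y1 ^ 2 + b 2 * y2 ^ 2 := by
      simp only [H1, Fin.sum_univ_three, map_add, map_mul, map_pow, eval₂Hom_C, eval₂Hom_X',
        Matrix.cons_val, RingHom.comp_apply, hb]
    rw [h, hy0, hy1]
    linear_combination (e (H1 a) ^ p - b 2 * y2 ^ 2) * hi
  · have h : eval₂Hom ((algebraMap A C).comp δA.frob) ![y0, y1, y2] (H2 A) =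
        y0 ^ 2 + y1 ^ 2 + y2 ^ 2 := by
      simp only [H2, Fin.sum_univ_three, map_add, map_pow, eval₂Hom_X', Matrix.cons_val]
    rw [h, hy0, hy1]
    linear_combination (e (H2 A) ^ p - y2 ^ 2) * hi
  · rw [← hF]
    induction g using MvPolynomial.induction_on with
    | C c =>
      rw [eval₂Hom_C, ← MvPolynomial.algebraMap_eq, AlgHom.commutes]
      exact lvl_frob_base c
    | add f g hf hg => simp only [map_add, hf, hg]
    | mul_X f i hf =>
      simp only [map_mul, hf, eval₂Hom_X']
      congr 1
      fin_cases i
      · exact hy0F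
      · exact hy1F
      · exact hy2F

end FrobLift

/-! ### Construction of an Euler flow on X -/

section Existence

variable {p : ℕ} {A : Type u} [CommRing A] {a : Fin 3 → A} {δA : PDerivation p A}

variable (p a) in
/-- A polynomial as a function on the completion of `X`, as a homomorphism of algebras. -/
def fnXHom : MvPolynomial (Fin 3) A →ₐ[A] HatX p a where
  toRingHom := (algebraMap (RingX p a) (HatX p a)).comp (algebraMap _ (RingX p a))
  commutes' r := by
    change AdicCompletion.of _ _ (algebraMap (MvPolynomial (Fin 3) A) (RingX p a)
      (algebraMap A _ r)) = AdicCompletion.of _ _ (algebraMap A (RingX p a) r)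
    rw [← IsScalarTower.algebraMap_apply A (MvPolynomial (Fin 3) A) (RingX p a)]

theorem fnXHom_apply (f : MvPolynomial (Fin 3) A) : fnXHom p a f = fnX p a f := rfl

theorem isUnit_fnX_polyQ : IsUnit (fnXHom p a (polyQ p a)) :=
  (IsLocalization.Away.algebraMap_isUnit (S := RingX p a) (polyQ p a)).map
    (algebraMap (RingX p a) (HatX p a))

/-- The image of Q is congruent to the unit Q^p modulo p, hence a unit, so φ extends to the
localization and then to the completion. The Frobenius congruence propagates because it depends only
on classes modulo p. -/
theorem exists_flow_of_lift (hp : p.Prime)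
    (htf : ∀ c : HatX p a, (p : HatX p a) * c = 0 → c = 0)
    (φ : MvPolynomial (Fin 3) A →+* HatX p a)
    (hφ : ∀ c, φ (C c) = algebraMap A (HatX p a) (δA.frob c))
    (hF : ∀ g, (Ideal.Quotient.mk _ (φ g) : Lvl p (HatX p a) 1) = (lvlX p a 1 g) ^ p) :
    ∃ δX : ArithFlow δA (HatX p a), ∀ g, δX.frob (fnX p a g) = φ g := by
  have hu : IsUnit (φ (polyQ p a)) := by
    refine isUnit_of_sub_dvd (p := p) ((isUnit_fnX_polyQ (p := p) (a := a)).pow p)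
      (nsmul_of_lvl_one ?_)
    rw [map_sub, hF, map_pow, sub_eq_zero]
    rfl
  set θ : RingX p a →+* HatX p a := IsLocalization.Away.lift (polyQ p a) hu
  have hθ : ∀ g, θ (algebraMap _ _ g) = φ g := fun g => IsLocalization.Away.lift_eq _ hu g
  have hθF : (Ideal.Quotient.mk (Ideal.span {(p : HatX p a) ^ 1})).comp θ =
      (lvlFrobenius (HatX p a) hp).comp
        ((Ideal.Quotient.mk _).comp (algebraMap (RingX p a) (HatX p a))) :=
    (isPres_localization (polyQ p a)).hom_ext fun g => by
      exact (congrArg _ (hθ g)).trans (hF g)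
  obtain ⟨Ψ, hΨ⟩ := exists_completion_lift (p := p) θ
  have hΨp : ∀ c, ∃ d, Ψ c = c ^ p + p * d := by
    intro c
    obtain ⟨b, c, rfl⟩ := phat_exists_eq_add 1 c
    have h1 := congrArg (fun f : RingX p a →+* _ => f b) hθF
    have h2 : (Ideal.Quotient.mk _ (Ψ (algebraMap _ _ b + (p : HatX p a) ^ 1 * c) -
        (algebraMap _ _ b + (p : HatX p a) ^ 1 * c) ^ p) : Lvl p (HatX p a) 1) = 0 := by
      have h0 := lvl_natCast_pow (p := p) (C := HatX p a) 1
      have h3 : (Ideal.Quotient.mk _ (θ b) : Lvl p (HatX p a) 1) =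
        (Ideal.Quotient.mk _ (algebraMap (RingX p a) (HatX p a) b)) ^ p := h1
      simp only [map_sub, map_add, map_mul, map_pow, map_natCast, hΨ, h0, h3]
      ring
    obtain ⟨d, hd⟩ := nsmul_of_lvl_one h2
    exact ⟨d, by linear_combination hd⟩
  have hΨA : ∀ r, Ψ (algebraMap A _ r) = algebraMap A _ (δA.frob r) := by
    intro r
    have h1 : algebraMap A (HatX p a) r = fnX p a (C r) := ((fnXHom p a).commutes r).symm
    rw [h1, ← hφ, ← hθ]
    exact hΨ _
  obtain ⟨δX, hδ⟩ := exists_arithFlow_of_frob (δA := δA) htf Ψ hΨp hΨA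
  exact ⟨δX, fun g => by rw [hδ]; exact (hΨ _).trans (hθ g)⟩

/-- Take δx₃ = g/α with g the antiderivative. Since α is a polynomial in H₁ and H₂, D α = 0, so
αD(δx₃) = D g cancels the other terms of the obstruction. -/
theorem exists_flow (hp : p.Prime) (hodd : p ≠ 2) (h2 : IsUnit (2 : A))
    (hu : ∀ n : ℕ, p.Coprime n → IsUnit (n : A)) (ha : IsUnit (a 0 - a 1))
    (htf : ∀ c : HatX p a, (p : HatX p a) * c = 0 → c = 0) :
    ∃ δX : ArithFlow δA (HatX p a), δX (fnX p a (H1 a)) = 0 ∧ δX (fnX p a (H2 A)) = 0 ∧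
      ∀ D : Derivation A (Lvl p (HatX p a) 1) (Lvl p (HatX p a) 1),
        (∀ i, D (lvlX p a 1 (X i)) = lvlX p a 1 (eulerField a i)) → D (lvlX p a 1 (H1 a)) = 0 →
        D (lvlX p a 1 (H2 A)) = 0 → obstructionX δX D = 0 := by
  obtain ⟨g, hg⟩ := exists_antiderivative_integrals a hp hodd hu
  have hα : IsUnit (fnX p a (hasseH p a)) :=
    (isUnit_of_polyQ (isUnit_fnX_polyQ (p := p) (a := a))).2.2.2
  obtain ⟨φ, hφC, hφ2, hφH1, hφH2, hφF⟩ := exists_frobenius_lift (δA := δA) hp h2 ha (fnXHom p a)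
    isUnit_fnX_polyQ (Ring.inverse (fnX p a (hasseH p a)) * fnX p a g)
  obtain ⟨δX, hδ⟩ := exists_flow_of_lift hp htf φ hφC hφF
  have key : ∀ q r, φ q = fnXHom p a q ^ p + p * r → δX (fnX p a q) = r := by
    intro q r h
    refine eq_of_sub_eq_zero (htf _ ?_)
    have h1 := δX.frob_apply (fnX p a q)
    rw [hδ, h, fnXHom_apply] at h1
    linear_combination -h1
  refine ⟨δX, key _ _ (by rw [hφH1]; ring), key _ _ (by rw [hφH2]; ring), fun D hD h1 h2 => ?_⟩
  have h3 := hg (lvlX p a 1) D h1 h2 (hD 2)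
  have hαinv : lvlX p a 1 (hasseH p a) *
      D (Ideal.Quotient.mk _ (Ring.inverse (fnX p a (hasseH p a)) * fnX p a g)) =
      D (lvlX p a 1 g) := by
    have h4 : D (lvlX p a 1 (hasseH p a)) = 0 := by
      rw [hasseH, ← AlgHom.comp_apply, comp_aeval]
      refine derivation_aeval_eq_zero D (fun i => ?_) _
      fin_cases i
      · exact h1
      · exact h2
    have h5 : lvlX p a 1 (hasseH p a) *
      Ideal.Quotient.mk _ (Ring.inverse (fnX p a (hasseH p a)) * fnX p a g) = lvlX p a 1 g := by
      rw [lvlX_apply, ← map_mul, ← mul_assoc, Ring.mul_inverse_cancel _ hα, one_mul, lvlX_apply]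
    have h6 := congrArg D h5
    rwa [Derivation.leibniz, h4, smul_zero, add_zero, smul_eq_mul] at h6
  rw [obstructionX, key _ _ hφ2, obstruction, mul_add, hαinv, h3]
  ring

end Existence

/-! ## The Hamiltonian property of Euler flows -/

section Hamiltonian

variable {p : ℕ} {A : Type u} [CommRing A] [IsDomain A] {a : Fin 3 → A}
  {δA : PDerivation p A}

/-- Vanishing of the obstruction on the one sphere suffices: the prime integrals give the induced
flow, and λ is a pseudo-constant because it is built from the constants H₁, c₂ and coefficients in
A. -/
theorem hamiltonianModP_of_obstruction (hprime : Prime (p : A)) (h2 : IsUnit (2 : A))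
    (ha : IsUnit (a 0 - a 1))
    (hA : ∀ (n : ℕ) (x : A), ∃ u ∈ constSubring δA, ∃ r, x - u = (p : A) ^ n * r)
    {δX : ArithFlow δA (HatX p a)} (h₁ : δX (fnX p a (H1 a)) = 0)
    (h₂ : δX (fnX p a (H2 A)) = 0) {c₂ : A} (hc : δA c₂ = 0)
    {D : Derivation A (Lvl p (HatX p a) 1) (Lvl p (HatX p a) 1)}
    (hD : ∀ i, D (lvlX p a 1 (X i)) = lvlX p a 1 (eulerField a i))
    (hobs : restrictLvl p a (idealS c₂) (obstructionX δX D) = 0) : HamiltonianModP δX c₂ := by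
  have htf := phat_torsionFree (torsionFree_ringV p a _ (saturated_idealS hprime c₂))
  obtain ⟨δS, hS⟩ := exists_induced δX (restrict_frob_idealS h₂ hc) htf
  have hδ : δS (fnV p a (idealS c₂) (H1 a)) = 0 := by
    rw [← restrict_fnX, hS, h₁, map_zero]
  refine ⟨δS, hS, fun δ' h' => h'.unique hS, isUnit_hasseS p a c₂, ?_,
    scales2_of_obstructionX h2 ha htf h₁ hS hD hobs⟩
  have hmem : fnV p a (idealS c₂) (H1 a) ∈ constSubring δS.toPDerivation :=
    Subring.subset_closure hδ
  refine isPseudoConstant_mul_inverse _ (Subring.pow_mem _ hmem _)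
    (isUnit_hasseS p a c₂) fun n => exists_constSubring_near_aeval hA δS (fun i => ?_) n _
  fin_cases i
  · exact hδ
  · exact (δS.extends_base c₂).trans (by rw [hc, map_zero])

theorem isEulerFlow_of_obstruction [IsLocalRing A]
    (hmax : IsLocalRing.maximalIdeal A = Ideal.span {(p : A)})
    (hprime : Prime (p : A)) (h2 : IsUnit (2 : A)) (ha : IsUnit (a 0 - a 1))
    {δX : ArithFlow δA (HatX p a)} (h₁ : δX (fnX p a (H1 a)) = 0)
    (h₂ : δX (fnX p a (H2 A)) = 0)
    {D : Derivation A (Lvl p (HatX p a) 1) (Lvl p (HatX p a) 1)}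
    (hD : ∀ i, D (lvlX p a 1 (X i)) = lvlX p a 1 (eulerField a i))
    (hobs : obstructionX δX D = 0) : IsEulerFlow δX where
  prime_integral₁ := h₁
  prime_integral₂ := h₂
  linearization c₁ c₂ hc₁ hc₂ hu := by
    have htf := phat_torsionFree (torsionFree_ringV p a _ (saturated_idealE hmax hprime ha c₁ c₂))
    obtain ⟨δE, hE⟩ := exists_induced δX (restrict_frob_idealE h₁ h₂ hc₁ hc₂) htf
    refine ⟨δE, hE, (scales1_iff_obstruction h2 ha htf (isUnit_of_mul_isUnit_right hu) hE hD).2 ?_⟩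
    rw [hobs, map_zero]

end Hamiltonian

theorem isUnit_natCast_of_coprime {p : ℕ} {A : Type*} [CommRing A] [IsLocalRing A]
    (hmax : IsLocalRing.maximalIdeal A = Ideal.span {(p : A)}) {n : ℕ} (hn : p.Coprime n) :
    IsUnit (n : A) := by
  by_contra h
  rw [← mem_nonunits_iff, ← IsLocalRing.mem_maximalIdeal] at h
  have hp : (p : A) ∈ IsLocalRing.maximalIdeal A := hmax ▸ Ideal.mem_span_singleton_self _
  have h1 := (Nat.isCoprime_iff_coprime.2 hn).map (Int.castRingHom A)
  obtain ⟨r, s, hrs⟩ := h1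
  simp only [eq_intCast, Int.cast_natCast] at hrs
  exact (Ideal.ne_top_iff_one _).1 (IsLocalRing.maximalIdeal.isMaximal A).ne_top
    (hrs ▸ Ideal.add_mem _ (Ideal.mul_mem_left _ _ hp) (Ideal.mul_mem_left _ _ h))

end ArithmeticEuler
end

/-! ### The theorem -/

open ArithmeticEuler in
theorem theorem4p5 {A : Type*} [CommRing A] [IsDomain A] [IsDiscreteValuationRing A]
    (p : ℕ) (hp : p.Prime) (hodd : p ≠ 2)
    (hmax : IsLocalRing.maximalIdeal A = Ideal.span {(p : A)})
    [IsAdicComplete (IsLocalRing.maximalIdeal A) A]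
    [PerfectField (IsLocalRing.ResidueField A)]
    (δA : PDerivation p A) (a : Fin 3 → A)
    (ha : IsUnit ((a 0 - a 1) * (a 1 - a 2) * (a 2 - a 0))) :
    (∃ δX : ArithFlow δA (HatX p a), IsEulerFlow δX ∧
      ∀ c₂ : A, IsUnit c₂ → δA c₂ = 0 → HamiltonianModP δX c₂) ∧
    (Infinite (IsLocalRing.ResidueField A) →
      ∀ δX : ArithFlow δA (HatX p a), IsEulerFlow δX →
        ∀ c₂ : A, IsUnit c₂ → δA c₂ = 0 → HamiltonianModP δX c₂) := by
  rw [IsUnit.mul_iff, IsUnit.mul_iff] at ha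
  obtain ⟨⟨ha, ha'⟩, ha''⟩ := ha
  have hp0 : (p : A) ≠ 0 := by
    intro h
    rw [h, Ideal.span_singleton_eq_bot.2 rfl] at hmax
    exact IsDiscreteValuationRing.not_a_field A hmax
  have hprime : Prime (p : A) := by
    rw [← Ideal.span_singleton_prime hp0, ← hmax]
    exact (IsLocalRing.maximalIdeal.isMaximal A).isPrime
  have hu : ∀ n : ℕ, p.Coprime n → IsUnit (n : A) := fun n => isUnit_natCast_of_coprime hmax
  have h2 : IsUnit (2 : A) := by
    exact_mod_cast hu 2 ((Nat.coprime_primes hp Nat.prime_two).2 hodd)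
  have hA := exists_constSubring_near hp hp0 hmax δA
  obtain ⟨D, hD, hD1, hD2⟩ := exists_euler_field (isPres_lvlX p a 1) (Or.inl rfl)
  constructor
  · have htf := phat_torsionFree (torsionFree_ringX p a fun f hf =>
      (mul_eq_zero.1 hf).resolve_left (natCast_prime hprime).ne_zero)
    obtain ⟨δX, h₁, h₂, hobs⟩ := exists_flow (δA := δA) hp hodd h2 hu ha htf
    have hobs := hobs D hD hD1 hD2
    refine ⟨δX, isEulerFlow_of_obstruction hmax hprime h2 ha h₁ h₂ hD hobs, fun c₂ _ hc => ?_⟩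
    -- Here the obstruction vanishes on all of X, so no density argument, and no infinite residue
    -- field, is needed.
    exact hamiltonianModP_of_obstruction hprime h2 ha hA h₁ h₂ hc hD (by rw [hobs, map_zero])
  · intro _ δX hδ c₂ _ hc
    -- The admissible values of c₁ are the δ-constants, which meet every residue class.
    refine hamiltonianModP_of_obstruction hprime h2 ha hA hδ.prime_integral₁ hδ.prime_integral₂ hc
      hD (restrictLvl_idealS_eq_zero hmax h2 ha ha' ha'' (P := fun c => δA c = 0)
        (exists_constant_of_residue hp hp0 hmax δA) fun c₁ hc₁ hu => ?_)
    obtain ⟨δE, hE, hs⟩ := hδ.linearization c₁ c₂ hc₁ hc hu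
    exact (scales1_iff_obstruction h2 ha (phat_torsionFree (torsionFree_ringV p a _
      (saturated_idealE hmax hprime ha c₁ c₂))) (isUnit_of_mul_isUnit_right hu) hE hD).1 hs
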